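/- **Conventions.** Links are oriented tame (polygonal) links in $\mathbb R^3$ up to isotopy. An oriented $(0,2n)$-tangle is a properly embedded oriented polygonal 1-manifold in the half-space $y\ge 0$ with $2n$ boundary points on the line $y=z=0$; tangles are considered up to isotopy of the half-space in which the (unmarked) endpoints may move along this line without passing each other. (For polygonal objects, isotopy means a finite sequence of triangle moves and their inverses, for tangles together with such slides of endpoints.) Diagrams are drawn in the $(x,y)$-plane. For a tangle $T$, $-\overline T$ denotes its mirror image under $(x,y,z)\mapsto(x,-y,z)$ with all orientations reversed. **Partitions and the Thompson group.** A standard dyadic (s.d.) interval is $[\frac k{2^m},\frac{k+1}{2^m}]\subseteq[0,1]$; an s.d. $n$-partition is $0=a_0<\dots<a_n=1$ with all $[a_i,a_{i+1}]$ s.d. intervals. $F$ is the group of increasing piecewise linear homeomorphisms of $[0,1]$ with dyadic breakpoints and slopes powers of $2$. A pair $(\mathcal I,\mathcal J)$ of s.d. $n$-partitions represents $g\in F$ if $g$ maps the $i$-th subinterval of $\mathcal I$ linearly onto the $i$-th subinterval of $\mathcal J$ for every $i$. It is reduced if it is not a refinement of another pair, i.e. no other pair $(\mathcal I',\mathcal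 J')$ with $\mathcal I$ refining $\mathcal I'$ and $\mathcal J$ refining $\mathcal J'$ represents the same $g$; each $g\in F$ has a unique reduced pair. Let $\mathcal S(\mathcal I)$ be the set of s.d. intervals whose endpoints are breakpoints of $\mathcal I$; they label the edges of the binary tree $F_{\mathcal I}$, with $[0,1]$ labelling the edge above the root. Write $m(A)$ for the midpoint of $A$, and $\overline A$ for the other half of the s.d. interval of twice the length that contains $A\ne[0,1]$. Signs of s.d. intervals: $[0,1]$ has sign $+$, the left half of an interval has the sign of that interval, and the right half has the opposite sign. Signs of the regions of the complement of $F_{\mathcal I}$ (except the rightmost one): the leftmost one has sign $+$, and the region directly below a trivalent vertex has the sign opposite to that of the region on the left of the vertex. The $n$-sign $\sigma_{\mathcal I}$ lists the signs of the regions above $a_0,\dots,a_{n-1}$. $\vec F$ is the set of $g\in F$ represented by some pair with $\sigma_{\mathcal I}=\sigma_{\mathcal J}$, and $(\mathcal I,\mathcal J)$ is compatible if it represents an element of $\vec F$. **Jones' links.** Embed $F_{\mathcal I}$ in $[0,1]^2$ with root at $(\frac12,1)$, so that the lower vertex of the edge labelled $A$ has $x$-coordinate $m(A)$, and lies on $y=0$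 if $A$ is a subinterval of $\mathcal I$. Replace each trivalent vertex by a crossing: the strand formed by the two edges below the vertex passes over the strand formed by the edge above the vertex and a vertical segment from the vertex down to $y=0$. Orient a strand upwards if the region to the left of the corresponding edge has sign $+$, downwards if it has sign $-$. This gives $T_{\mathcal I}$, with bottom endpoints $m(A)$, $A\in\mathcal S(\mathcal I)$, i.e. at the midpoints of the subintervals and the interior breakpoints of $\mathcal I$. Its cap-off $\widehat{T_{\mathcal I}}$ is the $(0,2n)$-tangle obtained by adding a vertical strand, oriented downwards, over $x=0$ and joining it on the top to $(\frac12,1)$. For a compatible pair, $L_{(\mathcal I,\mathcal J)}$ is obtained by placing $\widehat{T_{\mathcal I}}$ above $-\overline{\widehat{T_{\mathcal J}}}$ and connecting their endpoints one by one, in order, by straight lines. For $g\in\vec F$, $L_g=L_{(\mathcal I,\mathcal J)}$ with $(\mathcal I,\mathcal J)$ the reduced pair of $g$. **Grid links.** An $m\times m$ grid diagram has exactly one $X$ and one $O$ (in different squares) in each row and column. Its oriented link is obtained by joining $X$ to $O$ in rows and $O$ to $X$ in columns, with horizontal segments over vertical ones. An $n\times 2n$ half grid diagram ($n$ rows, $2n$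 columns) has exactly one $X$ and one $O$ in each row and exactly one marking in each column. Its oriented $(0,2n)$-tangle $\mathcal T(\mathbb H)$ is obtained by joining $X$ to $O$ in rows and each marking vertically to the bottom, upwards for $X$ and downwards for $O$, with horizontal segments over vertical ones. Two $n\times 2n$ half grid diagrams are compatible if their $i$-th columns contain the same symbol for each $i$; then $(\mathbb H_+,\mathbb H_-)$ is the grid diagram obtained by stacking $\mathbb H_+$ over $\mathbb H_-$ flipped upside down with $X$ and $O$ exchanged, and $\mathcal L(\mathbb H_+,\mathbb H_-)$ is its link. For an s.d. $n$-partition $\mathcal I$, let $p_x(A)-1$ be the position of $A$ in $\mathcal S(\mathcal I)$ ordered by midpoint. For positive $A$ let $p_y(A)$ be its position among the positive intervals of $\mathcal S(\mathcal I)$ ordered by length and, for equal lengths, by midpoint; for negative $A$ let $p_y(A)=p_y(\overline A)$. Columns are counted from the left and rows from the bottom, from $1$. $\mathbb H_{\mathcal I}$ has an $O$ in column $1$ and row $n$, and in column $p_x(A)$ and row $p_y(A)$ an $X$ if $A$ is positive and an $O$ if $A$ is negative, for each $A\in\mathcal S(\mathcal I)$. **Theorem.** 1. For every s.d. $n$-partition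 $\mathcal I$, $\mathbb H_{\mathcal I}$ is an $n\times 2n$ half grid diagram and $\widehat{T_{\mathcal I}}=\mathcal T(\mathbb H_{\mathcal I})$ as oriented $(0,2n)$-tangles. 2. For every compatible s.d. partition pair $(\mathcal I,\mathcal J)$, $(\mathbb H_{\mathcal I},\mathbb H_{\mathcal J})$ is a compatible half grid pair, so that it gives a $2n\times 2n$ grid diagram, and $\mathcal L(\mathbb H_{\mathcal I},\mathbb H_{\mathcal J})=L_{(\mathcal I,\mathcal J)}$ as oriented links. 3. In particular, if $(\mathcal I,\mathcal J)$ is the reduced s.d. partition pair of some $g\in\vec F$, then $\mathcal L(\mathbb H_{\mathcal I},\mathbb H_{\mathcal J})=L_g$ as oriented links. -/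

import Mathlib

noncomputable section

namespace ThompsonLink

/-! ## Oriented polygonal links and tangles in three-space

The coordinates of a point are `(x, y, z)`.  Diagrams are drawn in the `(x, y)`-plane, and `z` is the
height above the paper: a strand with larger `z` passes over a strand with smaller `z`. -/

/-- Points of three-space. -/
abbrev Pt : Type := ℝ × ℝ × ℝ

/-- A directed straight edge, from its first component to its second component. -/
abbrev Edge : Type := Pt × Pt

/-- The underlying point set of a set of directed edges. -/
def support (K : Set Edge) : Set Pt := ⋃ e ∈ K, segment ℝ e.1 e.2

/-- `K` consists of finitely many non-degenerate directed edges, and two different edges meet at most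
in a point that is the end of one of them and the start of the other.  (In particular at most one edge
starts and at most one edge ends at any given point.) -/
structure IsOrientedPolygonal (K : Set Edge) : Prop where
  finite : K.Finite
  ne : ∀ e ∈ K, e.1 ≠ e.2
  inter : ∀ e ∈ K, ∀ f ∈ K, e ≠ f →
    ∀ p ∈ segment ℝ e.1 e.2 ∩ segment ℝ f.1 f.2, (p = e.2 ∧ p = f.1) ∨ (p = e.1 ∧ p = f.2)

/-- An oriented polygonal link: a finite disjoint union of simple closed oriented polygons. -/
structure IsOrientedLink (K : Set Edge) : Prop extends IsOrientedPolygonal K where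
  next : ∀ e ∈ K, ∃ f ∈ K, f.1 = e.2
  prev : ∀ e ∈ K, ∃ f ∈ K, f.2 = e.1

/-- An oriented polygonal `(0, k)`-tangle: a finite disjoint union of simple oriented polygonal arcs
and closed polygons, properly embedded in the half-space `y ≥ 0`, with exactly `k` boundary points,
all of which lie on the line `y = z = 0`. -/
structure IsOrientedTangle (k : ℕ) (K : Set Edge) : Prop extends IsOrientedPolygonal K where
  /-- the tangle lies in the half-space -/
  nonneg : ∀ e ∈ K, 0 ≤ e.1.2.1 ∧ 0 ≤ e.2.2.1
  /-- no edge lies in the boundary plane -/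
  proper : ∀ e ∈ K, 0 < e.1.2.1 ∨ 0 < e.2.2.1
  /-- a strand ends at, and only at, the boundary plane -/
  next : ∀ e ∈ K, (∃ f ∈ K, f.1 = e.2) ↔ 0 < e.2.2.1
  prev : ∀ e ∈ K, (∃ f ∈ K, f.2 = e.1) ↔ 0 < e.1.2.1
  /-- the boundary points lie on the line `y = z = 0` -/
  line : ∀ p ∈ support K, p.2.1 = 0 → p.2.2 = 0
  /-- there are `k` boundary points -/
  card : {p | p ∈ support K ∧ p.2.1 = 0}.ncard = k

/-- An elementary triangle move (`Δ`-move) between two oriented polygonal objects of a given kind: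
a directed edge from `a` to `b` is replaced by the two edges from `a` to `c` and from `c` to `b`,
where the triangle `a b c` meets the object in the edge `a b` only. -/
def TriangleMove (Valid : Set Edge → Prop) (K K' : Set Edge) : Prop :=
  Valid K ∧ Valid K' ∧ ∃ a b c : Pt, (a, b) ∈ K ∧
    convexHull ℝ {a, b, c} ∩ support K = segment ℝ a b ∧
    K' = (K \ {(a, b)}) ∪ {(a, c), (c, b)}

/-- Equality of oriented links, i.e. isotopy of oriented polygonal links: both sides are oriented
links, and they are related by finitely many triangle moves and their inverses. -/
def LinkIsotopic (K K' : Set Edge) : Prop :=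
  IsOrientedLink K ∧ IsOrientedLink K' ∧ Relation.EqvGen (TriangleMove IsOrientedLink) K K'

/-- A slide of one endpoint of a tangle along the boundary line, from `b` to `b'`, sweeping out a
triangle that meets the tangle only in the terminal edge. -/
def EndpointSlide (k : ℕ) (K K' : Set Edge) : Prop :=
  IsOrientedTangle k K ∧ IsOrientedTangle k K' ∧ ∃ a b b' : Pt,
    b.2 = (0, 0) ∧ b'.2 = (0, 0) ∧
    convexHull ℝ {a, b, b'} ∩ support K = segment ℝ a b ∧
    (((a, b) ∈ K ∧ K' = (K \ {(a, b)}) ∪ {(a, b')}) ∨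
      ((b, a) ∈ K ∧ K' = (K \ {(b, a)}) ∪ {(b', a)}))

/-- Equality of oriented `(0, k)`-tangles with unmarked endpoints, i.e. isotopy in the half-space
`y ≥ 0`, during which the endpoints may move along the boundary line without passing each other. -/
def TangleIsotopic (k : ℕ) (K K' : Set Edge) : Prop :=
  IsOrientedTangle k K ∧ IsOrientedTangle k K' ∧
    Relation.EqvGen (fun K₁ K₂ => TriangleMove (IsOrientedTangle k) K₁ K₂ ∨ EndpointSlide k K₁ K₂)
      K K'

/-! ## Grid diagrams and half grid diagrams -/

/-- The two markings. -/
inductive Mark : Type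
  | X : Mark
  | O : Mark

/-- Exchange the two markings. -/
def Mark.swap : Mark → Mark
  | Mark.X => Mark.O
  | Mark.O => Mark.X

/-- A marked grid, as the set of all `(i, j, μ)` such that the square in column `i` and row `j`
contains the marking `μ`.  Columns are counted from the left, rows from the bottom, from `1`. -/
abbrev MarkedGrid : Type := Set (ℕ × ℕ × Mark)

/-- `G` is an `m × m` grid diagram. -/
structure IsGridDiagram (m : ℕ) (G : MarkedGrid) : Prop where
  range : ∀ i j μ, (i, j, μ) ∈ G → (1 ≤ i ∧ i ≤ m) ∧ (1 ≤ j ∧ j ≤ m)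
  square : ∀ i j, ¬ ((i, j, Mark.X) ∈ G ∧ (i, j, Mark.O) ∈ G)
  row : ∀ j, 1 ≤ j → j ≤ m → ∀ μ, ∃! i, (i, j, μ) ∈ G
  col : ∀ i, 1 ≤ i → i ≤ m → ∀ μ, ∃! j, (i, j, μ) ∈ G

/-- `H` is an `n × 2n` half grid diagram (`n` rows and `2n` columns). -/
structure IsHalfGridDiagram (n : ℕ) (H : MarkedGrid) : Prop where
  range : ∀ i j μ, (i, j, μ) ∈ H → (1 ≤ i ∧ i ≤ 2 * n) ∧ (1 ≤ j ∧ j ≤ n)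
  row : ∀ j, 1 ≤ j → j ≤ n → ∀ μ, ∃! i, (i, j, μ) ∈ H
  col : ∀ i, 1 ≤ i → i ≤ 2 * n → ∃! q : ℕ × Mark, (i, q.1, q.2) ∈ H

/-- Two `n × 2n` half grid diagrams are compatible if their `i`-th columns contain the same symbol
for every `i`. -/
def HalfGridCompatible (n : ℕ) (H₁ H₂ : MarkedGrid) : Prop :=
  IsHalfGridDiagram n H₁ ∧ IsHalfGridDiagram n H₂ ∧
    ∀ i, 1 ≤ i → i ≤ 2 * n → ∀ μ, (∃ j, (i, j, μ) ∈ H₁) ↔ (∃ j, (i, j, μ) ∈ H₂)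

/-- The grid diagram of a pair of `n × 2n` half grid diagrams: `H₁` stacked over the diagram obtained
from `H₂` by flipping it upside down and exchanging the two markings. -/
def stack (n : ℕ) (H₁ H₂ : MarkedGrid) : MarkedGrid :=
  {q | (∃ i j μ, (i, j, μ) ∈ H₁ ∧ q = (i, n + j, μ)) ∨
    (∃ i j μ, (i, j, μ) ∈ H₂ ∧ q = (i, n + 1 - j, μ.swap))}

/-- The point over the square in column `i` and row `j`, at height `z`. -/
def gridPt (i j : ℕ) (z : ℝ) : Pt := ((i : ℝ), (j : ℝ), z)

/-- The horizontal edges of a marked grid (from `X` to `O` in each row), at height `1`, together with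
the edges that connect heights `0` and `1` at the markings (upwards at `X`, downwards at `O`). -/
def rowEdges (G : MarkedGrid) : Set Edge :=
  {e | (∃ i i' j, (i, j, Mark.X) ∈ G ∧ (i', j, Mark.O) ∈ G ∧ e = (gridPt i j 1, gridPt i' j 1)) ∨
    (∃ i j, (i, j, Mark.X) ∈ G ∧ e = (gridPt i j 0, gridPt i j 1)) ∨
    (∃ i j, (i, j, Mark.O) ∈ G ∧ e = (gridPt i j 1, gridPt i j 0))}

/-- The oriented link of a grid diagram: `X` is connected to `O` in each row and `O` to `X` in each
column, and horizontal segments pass over vertical segments. -/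
def gridLink (G : MarkedGrid) : Set Edge :=
  rowEdges G ∪
    {e | ∃ i j j', (i, j, Mark.O) ∈ G ∧ (i, j', Mark.X) ∈ G ∧ e = (gridPt i j 0, gridPt i j' 0)}

/-- The oriented tangle of a half grid diagram: `X` is connected to `O` in each row, and each marking
is connected vertically to the bottom of the grid (the line `y = 0`), upwards for `X` and downwards
for `O`; horizontal segments pass over vertical segments. -/
def gridTangle (H : MarkedGrid) : Set Edge :=
  rowEdges H ∪
    {e | (∃ i j, (i, j, Mark.X) ∈ H ∧ e = (gridPt i 0 0, gridPt i j 0)) ∨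
      (∃ i j, (i, j, Mark.O) ∈ H ∧ e = (gridPt i j 0, gridPt i 0 0))}

/-! ## Standard dyadic intervals and partitions -/

/-- The standard dyadic interval `[idx / 2 ^ lvl, (idx + 1) / 2 ^ lvl]` in `[0, 1]`. -/
@[ext] structure SDInterval : Type where
  lvl : ℕ
  idx : ℕ
  idx_lt : idx < 2 ^ lvl

namespace SDInterval

def left (A : SDInterval) : ℝ := (A.idx : ℝ) / 2 ^ A.lvl

def right (A : SDInterval) : ℝ := ((A.idx : ℝ) + 1) / 2 ^ A.lvl

def length (A : SDInterval) : ℝ := 1 / 2 ^ A.lvl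

def mid (A : SDInterval) : ℝ := (A.left + A.right) / 2

/-- For `A ≠ [0, 1]` the union of `A` and its conjugate, i.e. the standard dyadic interval of twice
the length that contains `A`.  (By convention `[0, 1]` is its own parent.) -/
def parent (A : SDInterval) : SDInterval where
  lvl := A.lvl - 1
  idx := A.idx / 2
  idx_lt := by
    have h := A.idx_lt
    rcases hl : A.lvl with _ | l
    · rw [hl] at h
      simp at h
      simp [h]
    · rw [hl, pow_succ] at h
      simp only [Nat.add_sub_cancel]
      omega

/-- The conjugate of `A`: the other half of the parent of `A`.  (By convention `[0, 1]` is its own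
conjugate.) -/
def conj (A : SDInterval) : SDInterval where
  lvl := A.lvl
  idx := if A.lvl = 0 then A.idx else if A.idx % 2 = 0 then A.idx + 1 else A.idx - 1
  idx_lt := by
    have h := A.idx_lt
    rcases hl : A.lvl with _ | l
    · rw [hl] at h
      simpa using h
    · rw [hl, pow_succ] at h
      simp only [Nat.add_eq_zero_iff, one_ne_zero, and_false, if_false, pow_succ]
      split_ifs <;> omega

/-- The sign (`true` for `+`) of the standard dyadic interval `[k / 2 ^ m, (k + 1) / 2 ^ m]`: the sign
of `[0, 1]` is `+`, a left half has the sign of its parent, and a right half the opposite sign. -/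
def signAux : ℕ → ℕ → Bool
  | 0, _ => true
  | m + 1, k => if k % 2 = 0 then signAux m (k / 2) else !signAux m (k / 2)

/-- The sign of a standard dyadic interval. -/
def sign (A : SDInterval) : Bool := signAux A.lvl A.idx

/-- The midpoint order. -/
def LeMid (A B : SDInterval) : Prop := A.mid ≤ B.mid

/-- The length order. -/
def LeLen (A B : SDInterval) : Prop :=
  A.length < B.length ∨ (A.length = B.length ∧ A.LeMid B)

end SDInterval

/-- A standard dyadic `n`-partition `0 = a 0 < a 1 < ... < a n = 1` of `[0, 1]`. -/
structure SDPartition (n : ℕ) : Type where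
  pt : Fin (n + 1) → ℝ
  strictMono : StrictMono pt
  zero : pt 0 = 0
  one : pt (Fin.last n) = 1
  sd : ∀ i : Fin n, ∃ A : SDInterval, A.left = pt i.castSucc ∧ A.right = pt i.succ

namespace SDPartition

variable {n : ℕ}

/-- The set of breakpoints. -/
def breakpoints (I : SDPartition n) : Set ℝ := Set.range I.pt

/-- The `i`-th subinterval, as a standard dyadic interval. -/
def sub (I : SDPartition n) (i : Fin n) : SDInterval := Classical.choose (I.sd i)

theorem sub_spec (I : SDPartition n) (i : Fin n) :
    (I.sub i).left = I.pt i.castSucc ∧ (I.sub i).right = I.pt i.succ :=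
  Classical.choose_spec (I.sd i)

/-- `A` is a subinterval of the partition. -/
def IsSub (I : SDPartition n) (A : SDInterval) : Prop := ∃ i, A = I.sub i

/-- The standard dyadic intervals both of whose endpoints are breakpoints of the partition.  They
label the edges of the binary tree of the partition: `[0, 1]` labels the edge attached to the root, the
subintervals of the partition label the lowermost edges, and every other interval labels an edge that
splits at its lower vertex into the edges labelled by its two halves. -/
def intervals (I : SDPartition n) : Set SDInterval :=
  {A | A.left ∈ I.breakpoints ∧ A.right ∈ I.breakpoints}

/-! ### The half grid diagram of a partition -/

/-- The column of the marking of `A`: the intervals are put into the columns `2, 3, ..., 2n` in the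
midpoint order. -/
def px (I : SDPartition n) (A : SDInterval) : ℕ :=
  {B | B ∈ I.intervals ∧ B.LeMid A}.ncard + 1

/-- The position of a positive interval among the positive intervals in the length order. -/
def posRank (I : SDPartition n) (A : SDInterval) : ℕ :=
  {B | B ∈ I.intervals ∧ B.sign = true ∧ B.LeLen A}.ncard

/-- The row of the marking of `A`: a positive interval is put into the row given by its position in
the length order, and a negative interval into the row of its conjugate. -/
def py (I : SDPartition n) (A : SDInterval) : ℕ :=
  if A.sign = true then I.posRank A else I.posRank A.conj

/-- The half grid diagram of a partition: a marking `O` in column `1` and row `n`, and for every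
interval `A` a marking in column `px A` and row `py A`, namely `X` if `A` is positive and `O` if `A`
is negative. -/
def halfGrid (I : SDPartition n) : MarkedGrid :=
  {(1, n, Mark.O)} ∪
    {q | ∃ A ∈ I.intervals, q = (I.px A, I.py A, if A.sign = true then Mark.X else Mark.O)}

/-! ### Jones' tangle of a partition -/

/-- Signs (`true` for `+`) of the regions of the complement of an embedded binary tree: the value at
`m` and `k` is the sign of the region above the dyadic number `k / 2 ^ m`.  The leftmost region, which
is above `0`, has sign `+`, and the region directly below a trivalent vertex has the sign opposite to
that of the region on the left of the vertex.  (The vertex below the edge labelled by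
`[k / 2 ^ m, (k + 1) / 2 ^ m]` lies above the midpoint `(2 k + 1) / 2 ^ (m + 1)`, and the region on its
left lies above `k / 2 ^ m`.) -/
def regionSign : ℕ → ℕ → Bool
  | 0, _ => true
  | m + 1, k => if k % 2 = 0 then regionSign m (k / 2) else !regionSign m (k / 2)

/-- The sign of the region on the left of the edge labelled by `A`, which is the region above the
left endpoint of `A`. -/
def edgeSign (A : SDInterval) : Bool := regionSign A.lvl A.idx

/-- The `n`-sign induced by the tree of the partition: the `i`-th sign is the sign of the region above
the left endpoint of the `i`-th subinterval. -/
def nSign (I : SDPartition n) : Fin n → Bool := fun i => edgeSign (I.sub i)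

/-- The directed edge between a lower point `p` and an upper point `q`, directed upwards if `up` is
true and downwards otherwise. -/
def strand (up : Bool) (p q : Pt) : Edge := if up = true then (p, q) else (q, p)

open Classical in
/-- The `y`-coordinate of the lower vertex of the edge labelled by `A` in the standard embedding of
the tree: `0` for lowermost edges, and `length A / 2` for the others.  The `x`-coordinate of this lower
vertex is the midpoint of `A`. -/
def height (I : SDPartition n) (A : SDInterval) : ℝ := if I.IsSub A then 0 else A.length / 2

/-- Jones' oriented tangle of a partition with one endpoint `(1/2, 1)` on the top and `2n - 1` endpoints
on the bottom.  Each trivalent vertex of the embedded tree is replaced by a crossing.  The over-strand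
at height `1` comes from the two edges below the vertex.  The under-strand at height `0` comes from
the edge above the vertex and continues vertically down to the bottom.  A strand is directed upwards
if the region on the left of the corresponding edge of the tree has sign `+`, downwards otherwise:
positive regions induce the counterclockwise orientation and negative regions the clockwise one. -/
def jonesTangle (I : SDPartition n) : Set Edge :=
  {e | (∃ A ∈ I.intervals, A.lvl ≠ 0 ∧
          e = strand (edgeSign A) (A.mid, I.height A, 0) (A.parent.mid, I.height A.parent, 1)) ∨
    (∃ A ∈ I.intervals, A.lvl = 0 ∧
          e = strand (edgeSign A) (A.mid, I.height A, 0) (A.mid, 1, 0)) ∨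
    (∃ A ∈ I.intervals, ¬ I.IsSub A ∧
          e = strand (edgeSign A) (A.mid, 0, 0) (A.mid, I.height A, 0))}

/-- The cap-off of Jones' tangle, an oriented `(0, 2n)`-tangle: a trivial vertical strand over `x = 0`
is added on the left and joined on the top to the endpoint `(1/2, 1)`. -/
def jonesCap (I : SDPartition n) : Set Edge :=
  I.jonesTangle ∪ {((1 / 2, 1, 0), (0, 1, 0)), ((0, 1, 0), (0, 0, 0))}

/-! ### Jones' link of a pair of partitions -/

/-- Translate a point by `1` in the direction of `y`. -/
def raise (p : Pt) : Pt := (p.1, p.2.1 + 1, p.2.2)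

/-- Vertical mirror image of a point of the diagram. -/
def mirror (p : Pt) : Pt := (p.1, -p.2.1, p.2.2)

/-- The straight lines that connect the lower endpoints for `I`, on the line `y = 1`, to those for
`J`, on the line `y = 0`, one by one: breakpoints to breakpoints (the breakpoint `0` belongs to the
trivial strand on the left) and midpoints of subintervals to midpoints of subintervals.  At the midpoint
of the `i`-th subinterval the orientation is given by the `i`-th sign of the `n`-sign (upwards for `+`),
and at the left endpoint of this subinterval it is the opposite one. -/
def connection (I J : SDPartition n) : Set Edge :=
  {e | ∃ i : Fin n,
    e = strand (!I.nSign i) (J.pt i.castSucc, 0, 0) (I.pt i.castSucc, 1, 0) ∨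
    e = strand (I.nSign i) ((J.sub i).mid, 0, 0) ((I.sub i).mid, 1, 0)}

/-- Jones' oriented link of a pair of partitions: the capped-off tangle for `I`, the connecting lines,
and the vertical mirror image, with reversed orientation, of the capped-off tangle for `J`. -/
def jonesLink (I J : SDPartition n) : Set Edge :=
  {e | ∃ f ∈ I.jonesCap, e = (raise f.1, raise f.2)} ∪ connection I J ∪
    {e | ∃ f ∈ J.jonesCap, e = (mirror f.2, mirror f.1)}

end SDPartition

/-! ## The Thompson group and the oriented Thompson group -/

/-- Thompson's group `F`, as a set of homeomorphisms of `[0, 1]`: the increasing piecewise linear ones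
with dyadic breakpoints and with slopes that are powers of `2`. -/
def thompsonF : Set (unitInterval ≃ₜ unitInterval) :=
  {g | StrictMono g ∧ ∃ (k : ℕ) (t : Fin (k + 1) → unitInterval),
    StrictMono t ∧ t 0 = 0 ∧ t (Fin.last k) = 1 ∧
    (∀ i, ∃ a m : ℕ, (t i : ℝ) = (a : ℝ) / 2 ^ m) ∧
    ∀ i : Fin k, ∃ s : ℤ, ∀ x ∈ Set.Icc (t i.castSucc) (t i.succ),
      (g x : ℝ) = (g (t i.castSucc) : ℝ) + (2 : ℝ) ^ s * ((x : ℝ) - (t i.castSucc : ℝ))}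

/-- The pair `(I, J)` represents `g`: `g` maps the `i`-th subinterval of `I` linearly onto the `i`-th
subinterval of `J`, for every `i`. -/
def Represents {n : ℕ} (g : unitInterval ≃ₜ unitInterval) (I J : SDPartition n) : Prop :=
  ∀ i : Fin n, ∀ x : unitInterval, (x : ℝ) ∈ Set.Icc (I.pt i.castSucc) (I.pt i.succ) →
    (g x : ℝ) = J.pt i.castSucc +
      (J.pt i.succ - J.pt i.castSucc) / (I.pt i.succ - I.pt i.castSucc) *
        ((x : ℝ) - I.pt i.castSucc)

/-- The oriented Thompson group: the elements of `F` that are represented by some pair of partitions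
inducing the same `n`-sign. -/
def orientedThompsonF : Set (unitInterval ≃ₜ unitInterval) :=
  {g | g ∈ thompsonF ∧ ∃ (n : ℕ) (I J : SDPartition n), Represents g I J ∧ I.nSign = J.nSign}

/-- The pair `(I, J)` is compatible: it represents an element of the oriented Thompson group. -/
def Compatible {n : ℕ} (I J : SDPartition n) : Prop :=
  ∃ g ∈ orientedThompsonF, Represents g I J

/-- The pair `(I, J)` is a refinement of the pair `(I', J')`: `I` refines `I'`, `J` refines `J'`, and
both pairs represent the same element. -/
def IsPairRefinement {n n' : ℕ} (I J : SDPartition n) (I' J' : SDPartition n') : Prop :=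
  I'.breakpoints ⊆ I.breakpoints ∧ J'.breakpoints ⊆ J.breakpoints ∧
    ∃ g, Represents g I J ∧ Represents g I' J'

/-- A pair of partitions is reduced if it is not a refinement of any other pair. -/
def IsReducedPair {n : ℕ} (I J : SDPartition n) : Prop :=
  ∀ (n' : ℕ) (I' J' : SDPartition n'), IsPairRefinement I J I' J' →
    I'.breakpoints = I.breakpoints ∧ J'.breakpoints = J.breakpoints

/-- A pair of partitions with the same number of breakpoints. -/
abbrev PartitionPair : Type := Σ n : ℕ, SDPartition n × SDPartition n

open Classical in
/-- The oriented Thompson link `L_g`: Jones' link of the reduced pair that represents `g`. -/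
def thompsonLink (g : unitInterval ≃ₜ unitInterval) : Set Edge :=
  if h : ∃ P : PartitionPair, Represents g P.2.1 P.2.2 ∧ IsReducedPair P.2.1 P.2.2 then
    SDPartition.jonesLink (Classical.choose h).2.1 (Classical.choose h).2.2
  else ∅

end ThompsonLink

end

open ThompsonLink

namespace ThompsonLink

/-! ## Elementary triangle moves -/

/-! All objects are compared with arch diagrams. An arch diagram has vertical strands in the plane
`z = 0`; each steps up to `z = 1` at its upper end and is joined to a partner by a horizontal
segment there. The strands are indexed by the intervals of the tree together with the outer strand
of the cap-off; an interval is paired with its conjugate, and `[0, 1]` with the outer strand. An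
abscissa and a height for every strand determine the diagram. It is embedded as soon as the
abscissas differ, the heights are positive and equal on partners, and different arches of equal
height lie over disjoint segments (`IsSeparated.isEmbedded`).

The tangle of the half grid diagram is exactly the arch diagram with abscissas `px` and heights
`py`, the outer strand being in column `1` and row `n` (`gridTangle_halfGrid`). Midpoints and
lengths of the intervals give another arch diagram, `midTangle`. Columns increase strictly with the
midpoint and rows with the length. So during linear interpolation two heights agree only if the
lengths agree, and then the arches lie over different parents of the same length, which are disjoint
up to endpoints (`isSeparated_inter`). The interpolation is therefore a continuous family of
embedded polygons.

Since isotopy is defined by triangle moves and endpoint slides, such a family has to be discretised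
(`isotopic_of_family`). Embeddedness is an open condition, so nearby polygons can be joined by
moving one vertex at a time. An interior vertex is moved by way of a generic position, which splits
its motion into clear triangle moves.

To pass from `midTangle` to Jones' tangle, the arches are cut in the middle. The part of a strand
above the vertex of the tree, its step to `z = 1` and its half of the arch lie in a tetrahedron, the
set of points with `InFan`, and collapse across two triangles to the slanted edge of Jones' tangle.
This is possible because the tetrahedron of an interval meets those of the other intervals at most
in the two ends of its slanted edge (`InFan.inter`).

For links, equal `n`-signs say that strands in the same column have the same direction, so two arch
diagrams can be glued, and the interpolation is carried out in both halves at once. The passage to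
Jones' tangle uses triangle moves only. These fix the endpoints, so they extend from the tangle to
the glued link (`TriangleIsotopic.extend`). Compatibility provides equal signs for one representing
pair only; all other pairs inherit them, because the sign of a dyadic point is the product of the
sign of an interval containing it and a sign that depends on the relative position
(`Represents.nSign_eq`). The last statement then needs that the reduced pair is unique
(`IsReducedPair.unique`). -/

/-- Oriented links (`none`) and oriented `(0, k)`-tangles (`some k`). -/
def IsKind : Option ℕ → Set Edge → Prop
  | none => IsOrientedLink
  | some k => IsOrientedTangle k

/-- The elementary moves of oriented links and of oriented tangles. -/
def KindMove : Option ℕ → Set Edge → Set Edge → Prop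
  | none => TriangleMove IsOrientedLink
  | some k => fun K K' => TriangleMove (IsOrientedTangle k) K K' ∨ EndpointSlide k K K'

/-- Isotopy of oriented links or of oriented tangles. -/
def KindIsotopic (κ : Option ℕ) (K K' : Set Edge) : Prop :=
  IsKind κ K ∧ IsKind κ K' ∧ Relation.EqvGen (KindMove κ) K K'

theorem KindIsotopic.refl {κ : Option ℕ} {K : Set Edge} (h : IsKind κ K) : KindIsotopic κ K K :=
  ⟨h, h, Relation.EqvGen.refl _⟩

theorem KindIsotopic.symm {κ : Option ℕ} {K K' : Set Edge} (h : KindIsotopic κ K K') :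
    KindIsotopic κ K' K :=
  ⟨h.2.1, h.1, Relation.EqvGen.symm _ _ h.2.2⟩

theorem KindIsotopic.trans {κ : Option ℕ} {K K' K'' : Set Edge} (h : KindIsotopic κ K K')
    (h' : KindIsotopic κ K' K'') : KindIsotopic κ K K'' :=
  ⟨h.1, h'.2.1, Relation.EqvGen.trans _ _ _ h.2.2 h'.2.2⟩

/-- Isotopy of oriented links or tangles by triangle moves only. -/
def TriangleIsotopic (κ : Option ℕ) (K K' : Set Edge) : Prop :=
  IsKind κ K ∧ IsKind κ K' ∧ Relation.EqvGen (TriangleMove (IsKind κ)) K K'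

theorem TriangleIsotopic.refl {κ : Option ℕ} {K : Set Edge} (h : IsKind κ K) :
    TriangleIsotopic κ K K :=
  ⟨h, h, Relation.EqvGen.refl _⟩

theorem TriangleIsotopic.symm {κ : Option ℕ} {K K' : Set Edge} (h : TriangleIsotopic κ K K') :
    TriangleIsotopic κ K' K :=
  ⟨h.2.1, h.1, Relation.EqvGen.symm _ _ h.2.2⟩

theorem TriangleIsotopic.trans {κ : Option ℕ} {K K' K'' : Set Edge} (h : TriangleIsotopic κ K K')
    (h' : TriangleIsotopic κ K' K'') : TriangleIsotopic κ K K'' :=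
  ⟨h.1, h'.2.1, Relation.EqvGen.trans _ _ _ h.2.2 h'.2.2⟩

theorem TriangleIsotopic.kindIsotopic {κ : Option ℕ} {K K' : Set Edge}
    (h : TriangleIsotopic κ K K') : KindIsotopic κ K K' := by
  refine ⟨h.1, h.2.1, Relation.EqvGen.mono (fun A B hAB => ?_) _ _ h.2.2⟩
  cases κ with
  | none => exact hAB
  | some k => exact Or.inl hAB

theorem IsKind.polygonal {κ : Option ℕ} {K : Set Edge} (h : IsKind κ K) : IsOrientedPolygonal K := by
  cases κ with
  | none => exact IsOrientedLink.toIsOrientedPolygonal h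
  | some k => exact IsOrientedTangle.toIsOrientedPolygonal h

theorem mem_support {K : Set Edge} {p : Pt} :
    p ∈ support K ↔ ∃ e ∈ K, p ∈ segment ℝ e.1 e.2 := by
  simp only [support, Set.mem_iUnion, exists_prop]

theorem support_insert (e : Edge) (Q : Set Edge) :
    support (insert e Q) = segment ℝ e.1 e.2 ∪ support Q := by
  simp only [support, Set.biUnion_insert]

theorem support_union (P Q : Set Edge) : support (P ∪ Q) = support P ∪ support Q := by
  simp only [support, Set.biUnion_union]

theorem support_mono {P Q : Set Edge} (h : P ⊆ Q) : support P ⊆ support Q :=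
  Set.biUnion_subset_biUnion_left h

/-! ### Triangles that are clear of the remaining edges -/

/-- The triangle `a b c` meets the set of edges `Q` at most in `a` and `b`, and the path `a c b` is
embedded. -/
structure TriangleClear (Q : Set Edge) (a b c : Pt) : Prop where
  ne : a ≠ b
  ne_left : a ≠ c
  ne_right : c ≠ b
  inter : segment ℝ a c ∩ segment ℝ c b ⊆ {c}
  clear : convexHull ℝ {a, b, c} ∩ support Q ⊆ {a, b}

section TriangleClear

variable {Q : Set Edge} {a b c : Pt}

theorem segment_ab_subset_hull : segment ℝ a b ⊆ convexHull ℝ {a, b, c} :=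
  (convex_convexHull ℝ _).segment_subset (subset_convexHull ℝ _ (by simp))
    (subset_convexHull ℝ _ (by simp))

theorem segment_ac_subset_hull : segment ℝ a c ⊆ convexHull ℝ {a, b, c} :=
  (convex_convexHull ℝ _).segment_subset (subset_convexHull ℝ _ (by simp))
    (subset_convexHull ℝ _ (by simp))

theorem segment_cb_subset_hull : segment ℝ c b ⊆ convexHull ℝ {a, b, c} :=
  (convex_convexHull ℝ _).segment_subset (subset_convexHull ℝ _ (by simp))
    (subset_convexHull ℝ _ (by simp))

namespace TriangleClear

theorem not_mem_support (h : TriangleClear Q a b c) : c ∉ support Q := by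
  intro hc
  have := h.clear ⟨subset_convexHull ℝ _ (by simp), hc⟩
  rcases this with h1 | h1
  · exact h.ne_left h1.symm
  · exact h.ne_right h1

/-- Otherwise the midpoint of `a b` would be a third point of the support in the triangle. -/
theorem not_mem_ab (h : TriangleClear Q a b c) : (a, b) ∉ Q := by
  intro hc
  have hm : midpoint ℝ a b ∈ segment ℝ a b := midpoint_mem_segment a b
  have := h.clear ⟨segment_ab_subset_hull hm, mem_support.2 ⟨_, hc, hm⟩⟩
  rcases this with h1 | h1
  · exact h.ne ((midpoint_eq_left_iff ℝ).1 h1)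
  · exact h.ne ((midpoint_eq_right_iff ℝ).1 h1)

theorem fst_ne (h : TriangleClear Q a b c) {e : Edge} (he : e ∈ Q) : e.1 ≠ c := fun hc =>
  h.not_mem_support (mem_support.2 ⟨e, he, hc ▸ left_mem_segment ℝ _ _⟩)

theorem snd_ne (h : TriangleClear Q a b c) {e : Edge} (he : e ∈ Q) : e.2 ≠ c := fun hc =>
  h.not_mem_support (mem_support.2 ⟨e, he, hc ▸ right_mem_segment ℝ _ _⟩)

theorem right_not_mem (h : TriangleClear Q a b c) : b ∉ segment ℝ a c := fun hb =>
  h.ne_right (h.inter ⟨hb, right_mem_segment ℝ _ _⟩).symm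

theorem left_not_mem (h : TriangleClear Q a b c) : a ∉ segment ℝ c b := fun hb =>
  h.ne_left (h.inter ⟨left_mem_segment ℝ _ _, hb⟩)

/-- Another edge can meet the triangle only in `a` or `b`, and the polygon with the edge `a b`
already fixes which of its ends lies there. The only new vertex is `c`, which no edge of `Q`
touches. -/
theorem polygonal (h : TriangleClear Q a b c) (hK : IsOrientedPolygonal (insert (a, b) Q)) :
    IsOrientedPolygonal (insert (a, c) (insert (c, b) Q)) := by
  have hab : ∀ q ∈ Q, ∀ p ∈ segment ℝ q.1 q.2, p ∈ convexHull ℝ {a, b, c} →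
      (p = a ∧ p = q.2) ∨ (p = b ∧ p = q.1) := by
    intro q hq p hp hT
    have hne : ((a, b) : Edge) ≠ q := fun he => h.not_mem_ab (he ▸ hq)
    rcases h.clear ⟨hT, mem_support.2 ⟨q, hq, hp⟩⟩ with rfl | h1
    · rcases hK.inter (p, b) (by simp) q (by simp [hq]) hne p
        ⟨left_mem_segment ℝ _ _, hp⟩ with h2 | h2
      · exact absurd h2.1 h.ne
      · exact Or.inl h2
    · obtain rfl : p = b := h1
      rcases hK.inter (a, p) (by simp) q (by simp [hq]) hne p
        ⟨right_mem_segment ℝ _ _, hp⟩ with h2 | h2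
      · exact Or.inr h2
      · exact absurd h2.1.symm h.ne
  have h1 : ∀ q ∈ Q, ∀ p ∈ segment ℝ a c ∩ segment ℝ q.1 q.2, p = a ∧ p = q.2 := by
    rintro q hq p ⟨hp, hp'⟩
    rcases hab q hq p hp' (segment_ac_subset_hull hp) with h2 | h2
    · exact h2
    · exact absurd (h2.1 ▸ hp) h.right_not_mem
  have h2 : ∀ q ∈ Q, ∀ p ∈ segment ℝ c b ∩ segment ℝ q.1 q.2, p = b ∧ p = q.1 := by
    rintro q hq p ⟨hp, hp'⟩
    rcases hab q hq p hp' (segment_cb_subset_hull hp) with h2 | h2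
    · exact absurd (h2.1 ▸ hp) h.left_not_mem
    · exact h2
  refine ⟨((hK.finite.subset (Set.subset_insert _ _)).insert _).insert _, ?_, ?_⟩
  · rintro e (rfl | rfl | he)
    · exact h.ne_left
    · exact h.ne_right
    · exact hK.ne e (by simp [he])
  · rintro e (rfl | rfl | he) f (rfl | rfl | hf) hef p hp
    · exact absurd rfl hef
    · have := h.inter hp
      exact Or.inl ⟨this, this⟩
    · exact Or.inr (h1 f hf p hp)
    · have := h.inter hp.symm
      exact Or.inr ⟨this, this⟩
    · exact absurd rfl hef
    · exact Or.inl (h2 f hf p hp)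
    · exact Or.inl (h1 e he p hp.symm).symm
    · exact Or.inr (h2 e he p hp.symm).symm
    · exact hK.inter e (by simp [he]) f (by simp [hf]) hef p hp

theorem polygonal' (h : TriangleClear Q a b c)
    (hK : IsOrientedPolygonal (insert (a, c) (insert (c, b) Q))) :
    IsOrientedPolygonal (insert (a, b) Q) := by
  have h1 : ∀ q ∈ Q, ∀ p ∈ segment ℝ a b ∩ segment ℝ q.1 q.2,
      (p = a ∧ p = q.2) ∨ (p = b ∧ p = q.1) := by
    rintro q hq p ⟨hp, hp'⟩
    rcases h.clear ⟨segment_ab_subset_hull hp, mem_support.2 ⟨q, hq, hp'⟩⟩ with rfl | h1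
    · have hne : ((p, c) : Edge) ≠ q := fun he => h.snd_ne hq (by rw [← he])
      rcases hK.inter (p, c) (by simp) q (by simp [hq]) hne p
        ⟨left_mem_segment ℝ _ _, hp'⟩ with h2 | h2
      · exact absurd h2.1 h.ne_left
      · exact Or.inl h2
    · obtain rfl : p = b := h1
      have hne : ((c, p) : Edge) ≠ q := fun he => h.fst_ne hq (by rw [← he])
      rcases hK.inter (c, p) (by simp) q (by simp [hq]) hne p
        ⟨right_mem_segment ℝ _ _, hp'⟩ with h2 | h2
      · exact Or.inr h2
      · exact absurd h2.1.symm h.ne_right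
  refine ⟨(hK.finite.subset fun e he => Or.inr (Or.inr he)).insert _, ?_, ?_⟩
  · rintro e (rfl | he)
    · exact h.ne
    · exact hK.ne e (by simp [he])
  · rintro e (rfl | he) f (rfl | hf) hef p hp
    · exact absurd rfl hef
    · exact (h1 f hf p hp).symm
    · rcases h1 e he p hp.symm with h2 | h2
      · exact Or.inl h2.symm
      · exact Or.inr h2.symm
    · exact hK.inter e (by simp [he]) f (by simp [hf]) hef p hp

theorem exists_fst_iff (p : Pt) (hp : p ≠ c) :
    (∃ f ∈ insert (a, c) (insert (c, b) Q), f.1 = p) ↔ ∃ f ∈ insert (a, b) Q, f.1 = p := by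
  constructor
  · rintro ⟨f, (rfl | rfl | hf), h⟩
    · exact ⟨(a, b), by simp, h⟩
    · exact absurd h.symm hp
    · exact ⟨f, by simp [hf], h⟩
  · rintro ⟨f, (rfl | hf), h⟩
    · exact ⟨(a, c), by simp, h⟩
    · exact ⟨f, by simp [hf], h⟩

theorem exists_snd_iff (p : Pt) (hp : p ≠ c) :
    (∃ f ∈ insert (a, c) (insert (c, b) Q), f.2 = p) ↔ ∃ f ∈ insert (a, b) Q, f.2 = p := by
  constructor
  · rintro ⟨f, (rfl | rfl | hf), h⟩
    · exact absurd h.symm hp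
    · exact ⟨(a, b), by simp, h⟩
    · exact ⟨f, by simp [hf], h⟩
  · rintro ⟨f, (rfl | hf), h⟩
    · exact ⟨(c, b), by simp, h⟩
    · exact ⟨f, by simp [hf], h⟩

theorem link (h : TriangleClear Q a b c) :
    IsOrientedLink (insert (a, b) Q) ↔ IsOrientedLink (insert (a, c) (insert (c, b) Q)) := by
  constructor
  · intro hK
    refine ⟨h.polygonal hK.toIsOrientedPolygonal, ?_, ?_⟩
    · rintro e (rfl | rfl | he)
      · exact ⟨(c, b), by simp, rfl⟩
      · exact (exists_fst_iff b h.ne_right.symm).2 (hK.next (a, b) (by simp))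
      · exact (exists_fst_iff _ (h.snd_ne he)).2 (hK.next e (by simp [he]))
    · rintro e (rfl | rfl | he)
      · exact (exists_snd_iff a h.ne_left).2 (hK.prev (a, b) (by simp))
      · exact ⟨(a, c), by simp, rfl⟩
      · exact (exists_snd_iff _ (h.fst_ne he)).2 (hK.prev e (by simp [he]))
  · intro hK
    refine ⟨h.polygonal' hK.toIsOrientedPolygonal, ?_, ?_⟩
    · rintro e (rfl | he)
      · exact (exists_fst_iff b h.ne_right.symm).1 (hK.next (c, b) (by simp))
      · exact (exists_fst_iff _ (h.snd_ne he)).1 (hK.next e (by simp [he]))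
    · rintro e (rfl | he)
      · exact (exists_snd_iff a h.ne_left).1 (hK.prev (a, c) (by simp))
      · exact (exists_snd_iff _ (h.fst_ne he)).1 (hK.prev e (by simp [he]))

/-- The coordinate `y` of `r` is a nonnegative combination of the end values, so it can vanish only
if the weight of `q` does. -/
theorem y_segment {p q r : Pt} (hp : 0 ≤ p.2.1) (hq : 0 < q.2.1) (hr : r ∈ segment ℝ p q)
    (h : r.2.1 = 0) : r = p := by
  obtain ⟨s, t, hs, ht, hst, rfl⟩ := hr
  simp only [Prod.snd_add, Prod.smul_snd, Prod.fst_add, Prod.smul_fst, smul_eq_mul] at h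
  have ht0 : t = 0 := by
    have := mul_nonneg hs hp
    have := mul_nonneg ht hq.le
    have h3 : t * q.2.1 = 0 := by linarith
    rcases mul_eq_zero.1 h3 with h4 | h4
    · exact h4
    · exact absurd h4 hq.ne'
  have : s = 1 := by linarith
  simp [ht0, this]

/-- As `c` and one of `a`, `b` are off the boundary plane, the three sides of the triangle meet this
plane at most in `a` or `b`, and these points lie on both polygons. -/
theorem boundary_eq (hc : 0 < c.2.1) (ha : 0 ≤ a.2.1) (hb : 0 ≤ b.2.1)
    (hab : 0 < a.2.1 ∨ 0 < b.2.1) :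
    {p | p ∈ support (insert (a, c) (insert (c, b) Q)) ∧ p.2.1 = 0} =
      {p | p ∈ support (insert (a, b) Q) ∧ p.2.1 = 0} := by
  ext p
  simp only [support_insert, Set.mem_union, Set.mem_ofPred_eq]
  constructor
  · rintro ⟨hp | hp | hp, h0⟩
    · obtain rfl := y_segment ha hc hp h0
      exact ⟨Or.inl (left_mem_segment ℝ _ _), h0⟩
    · obtain rfl := y_segment hb hc (by rwa [segment_symm]) h0
      exact ⟨Or.inl (right_mem_segment ℝ _ _), h0⟩
    · exact ⟨Or.inr hp, h0⟩
  · rintro ⟨hp | hp, h0⟩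
    · rcases hab with h1 | h1
      · obtain rfl := y_segment hb h1 (by rwa [segment_symm]) h0
        exact ⟨Or.inr (Or.inl (right_mem_segment ℝ _ _)), h0⟩
      · obtain rfl := y_segment ha h1 hp h0
        exact ⟨Or.inl (left_mem_segment ℝ _ _), h0⟩
    · exact ⟨Or.inr (Or.inr hp), h0⟩

theorem tangle (h : TriangleClear Q a b c) (k : ℕ) (hc : 0 < c.2.1)
    (hab : 0 < a.2.1 ∨ 0 < b.2.1) :
    IsOrientedTangle k (insert (a, b) Q) ↔
      IsOrientedTangle k (insert (a, c) (insert (c, b) Q)) := by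
  constructor
  · intro hK
    have h0 := hK.nonneg (a, b) (by simp)
    have hB := boundary_eq (Q := Q) hc h0.1 h0.2 hab
    refine ⟨h.polygonal hK.toIsOrientedPolygonal, ?_, ?_, ?_, ?_, ?_, ?_⟩
    · rintro e (rfl | rfl | he)
      · exact ⟨h0.1, hc.le⟩
      · exact ⟨hc.le, h0.2⟩
      · exact hK.nonneg e (by simp [he])
    · rintro e (rfl | rfl | he)
      · exact Or.inr hc
      · exact Or.inl hc
      · exact hK.proper e (by simp [he])
    · rintro e (rfl | rfl | he)
      · exact ⟨fun _ => hc, fun _ => ⟨(c, b), by simp, rfl⟩⟩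
      · exact (exists_fst_iff b h.ne_right.symm).trans (hK.next (a, b) (by simp))
      · exact (exists_fst_iff _ (h.snd_ne he)).trans (hK.next e (by simp [he]))
    · rintro e (rfl | rfl | he)
      · exact (exists_snd_iff a h.ne_left).trans (hK.prev (a, b) (by simp))
      · exact ⟨fun _ => hc, fun _ => ⟨(a, c), by simp, rfl⟩⟩
      · exact (exists_snd_iff _ (h.fst_ne he)).trans (hK.prev e (by simp [he]))
    · intro p hp hp0
      have : p ∈ {p | p ∈ support (insert (a, b) Q) ∧ p.2.1 = 0} := hB ▸ ⟨hp, hp0⟩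
      exact hK.line p this.1 hp0
    · rw [hB]
      exact hK.card
  · intro hK
    have h1 := hK.nonneg (a, c) (by simp)
    have h2 := hK.nonneg (c, b) (by simp)
    have hB := boundary_eq (Q := Q) hc h1.1 h2.2 hab
    refine ⟨h.polygonal' hK.toIsOrientedPolygonal, ?_, ?_, ?_, ?_, ?_, ?_⟩
    · rintro e (rfl | he)
      · exact ⟨h1.1, h2.2⟩
      · exact hK.nonneg e (by simp [he])
    · rintro e (rfl | he)
      · exact hab
      · exact hK.proper e (by simp [he])
    · rintro e (rfl | he)
      · exact (exists_fst_iff b h.ne_right.symm).symm.trans (hK.next (c, b) (by simp))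
      · exact (exists_fst_iff _ (h.snd_ne he)).symm.trans (hK.next e (by simp [he]))
    · rintro e (rfl | he)
      · exact (exists_snd_iff a h.ne_left).symm.trans (hK.prev (a, c) (by simp))
      · exact (exists_snd_iff _ (h.fst_ne he)).symm.trans (hK.prev e (by simp [he]))
    · intro p hp hp0
      have : p ∈ {p | p ∈ support (insert (a, c) (insert (c, b) Q)) ∧ p.2.1 = 0} := hB ▸ ⟨hp, hp0⟩
      exact hK.line p this.1 hp0
    · rw [← hB]
      exact hK.card

/-- The conditions that a triangle move of tangles has to meet at the boundary. -/
def Admissible (κ : Option ℕ) (a b c : Pt) : Prop :=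
  κ ≠ none → 0 < c.2.1 ∧ (0 < a.2.1 ∨ 0 < b.2.1)

theorem isKind_iff (h : TriangleClear Q a b c) {κ : Option ℕ} (hκ : Admissible κ a b c) :
    IsKind κ (insert (a, b) Q) ↔ IsKind κ (insert (a, c) (insert (c, b) Q)) := by
  cases κ with
  | none => exact h.link
  | some k => exact h.tangle k (hκ (by simp)).1 (hκ (by simp)).2

theorem triangleMove (h : TriangleClear Q a b c) {Valid : Set Edge → Prop}
    (h1 : Valid (insert (a, b) Q)) (h2 : Valid (insert (a, c) (insert (c, b) Q))) :
    TriangleMove Valid (insert (a, b) Q) (insert (a, c) (insert (c, b) Q)) := by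
  refine ⟨h1, h2, a, b, c, by simp, ?_, ?_⟩
  · rw [support_insert]
    apply Set.Subset.antisymm
    · rintro p ⟨hp, hp' | hp'⟩
      · exact hp'
      · rcases h.clear ⟨hp, hp'⟩ with rfl | h1
        · exact left_mem_segment ℝ _ _
        · obtain rfl : p = b := h1
          exact right_mem_segment ℝ _ _
    · exact fun p hp => ⟨segment_ab_subset_hull hp, Or.inl hp⟩
  · rw [Set.insert_sdiff_self_of_notMem h.not_mem_ab]
    ext e
    simp only [Set.mem_insert_iff, Set.mem_union, Set.mem_singleton_iff]
    tauto

theorem isotopic (h : TriangleClear Q a b c) {κ : Option ℕ} (hκ : Admissible κ a b c)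
    (hK : IsKind κ (insert (a, b) Q)) :
    TriangleIsotopic κ (insert (a, b) Q) (insert (a, c) (insert (c, b) Q)) :=
  ⟨hK, (h.isKind_iff hκ).1 hK,
    Relation.EqvGen.rel _ _ (h.triangleMove hK ((h.isKind_iff hκ).1 hK))⟩

theorem isotopic' (h : TriangleClear Q a b c) {κ : Option ℕ} (hκ : Admissible κ a b c)
    (hK : IsKind κ (insert (a, c) (insert (c, b) Q))) :
    TriangleIsotopic κ (insert (a, c) (insert (c, b) Q)) (insert (a, b) Q) :=
  (h.isotopic hκ ((h.isKind_iff hκ).2 hK)).symm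

theorem symm (h : TriangleClear Q a b c) : TriangleClear Q b a c where
  ne := h.ne.symm
  ne_left := h.ne_right.symm
  ne_right := h.ne_left.symm
  inter := by
    rw [segment_symm ℝ b c, segment_symm ℝ c a, Set.inter_comm]
    exact h.inter
  clear := by
    rw [Set.insert_comm, Set.pair_comm b a]
    exact h.clear

theorem inter_of_openSegment (hab : a ≠ b) (hc : c ∈ openSegment ℝ a b) :
    segment ℝ a c ∩ segment ℝ c b ⊆ {c} := by
  obtain ⟨s, t, hs, ht, hst, rfl⟩ := hc
  rintro p ⟨⟨p1, p2, hp1, hp2, hp, rfl⟩, ⟨q1, q2, hq1, hq2, hq, h⟩⟩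
  have h1 : (1 - p2 * t - q1 * s) • (a - b) = 0 := by
    obtain rfl : p1 = 1 - p2 := by linarith
    obtain rfl : q2 = 1 - q1 := by linarith
    obtain rfl : s = 1 - t := by linarith
    have h2 := sub_eq_zero.2 h.symm
    rw [← h2]
    module
  have h3 : 1 - p2 * t - q1 * s = 0 :=
    (smul_eq_zero.1 h1).resolve_right (sub_ne_zero.2 hab)
  -- Here `p2 * t + q1 * s = 1` is a weighted mean, with positive weights of sum `1`, of two numbers
  -- that are at most `1`.
  have h4 : p2 = 1 := by nlinarith
  have h5 : p1 = 0 := by linarith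
  simp [h4, h5]

/-- The triangle is degenerate: its hull is the segment `a b`. -/
theorem of_openSegment (hab : a ≠ b) (hc : c ∈ openSegment ℝ a b)
    (h : segment ℝ a b ∩ support Q ⊆ {a, b}) : TriangleClear Q a b c where
  ne := hab
  ne_left := by
    rintro rfl
    exact hab (left_mem_openSegment_iff.1 hc)
  ne_right := by
    rintro rfl
    exact hab (right_mem_openSegment_iff.1 hc)
  inter := inter_of_openSegment hab hc
  clear := by
    refine Set.Subset.trans (Set.inter_subset_inter_left _ ?_) h
    refine convexHull_min ?_ (convex_segment a b)
    rintro p (rfl | rfl | hp)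
    · exact left_mem_segment ℝ _ _
    · exact right_mem_segment ℝ _ _
    · obtain rfl : p = c := hp
      exact openSegment_subset_segment ℝ _ _ hc

/-- Every edge can be subdivided. -/
theorem subdivide (hK : IsOrientedPolygonal (insert (a, b) Q)) (hQ : (a, b) ∉ Q)
    (hc : c ∈ openSegment ℝ a b) : TriangleClear Q a b c := by
  refine of_openSegment (hK.ne (a, b) (by simp)) hc ?_
  rintro p ⟨hp, hp'⟩
  obtain ⟨q, hq, hp'⟩ := mem_support.1 hp'
  rcases hK.inter (a, b) (by simp) q (by simp [hq]) (fun he => hQ (he ▸ hq)) p ⟨hp, hp'⟩ with h | h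
  · exact Or.inr h.1
  · exact Or.inl h.1

/-- A subdivided edge can be replaced by a single edge. -/
theorem merge (hab : a ≠ b) (hK : IsOrientedPolygonal (insert (a, c) (insert (c, b) Q)))
    (hQ : (a, c) ∉ Q) (hQ' : (c, b) ∉ Q) (hc : c ∈ openSegment ℝ a b) :
    TriangleClear Q a b c := by
  refine of_openSegment hab hc ?_
  rintro p ⟨hp, hp'⟩
  obtain ⟨q, hq, hp'⟩ := mem_support.1 hp'
  have h1 : (a, c) ≠ q := fun he => hQ (he ▸ hq)
  have h2 : (c, b) ≠ q := fun he => hQ' (he ▸ hq)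
  -- The cases are decided by comparing the weight of `b` in `p` with its weight in `c`.
  have hsplit : p ∈ segment ℝ a c ∨ p ∈ segment ℝ c b := by
    obtain ⟨s, t, hs, ht, hst, rfl⟩ := hc
    obtain ⟨u, v, hu, hv, huv, rfl⟩ := hp
    rcases le_total v t with hvt | hvt
    · left
      refine ⟨1 - v / t, v / t, ?_, by positivity, by ring, ?_⟩
      · rw [sub_nonneg, div_le_one ht]
        exact hvt
      · obtain rfl : s = 1 - t := by linarith
        obtain rfl : u = 1 - v := by linarith
        obtain ⟨w, rfl⟩ : ∃ w, v = w * t := ⟨v / t, by field_simp⟩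
        rw [mul_div_cancel_right₀ _ ht.ne']
        module
    · right
      refine ⟨u / s, 1 - u / s, by positivity, ?_, by ring, ?_⟩
      · rw [sub_nonneg, div_le_one hs]
        linarith
      · obtain rfl : t = 1 - s := by linarith
        obtain rfl : v = 1 - u := by linarith
        obtain ⟨w, rfl⟩ : ∃ w, u = w * s := ⟨u / s, by field_simp⟩
        rw [mul_div_cancel_right₀ _ hs.ne']
        module
  -- An edge through `c` would have to start there, because `a c` ends there, and to end there,
  -- because `c b` starts there.
  have hcq : c ∉ segment ℝ q.1 q.2 := by
    intro hcq
    have hne := hK.ne q (by simp [hq])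
    have hne1 := hK.ne (a, c) (by simp)
    have hne2 := hK.ne (c, b) (by simp)
    rcases hK.inter (a, c) (by simp) q (by simp [hq]) h1 c ⟨right_mem_segment ℝ _ _, hcq⟩
      with h3 | h3
    · rcases hK.inter (c, b) (by simp) q (by simp [hq]) h2 c ⟨left_mem_segment ℝ _ _, hcq⟩
        with h4 | h4
      · exact hne2 h4.1
      · exact hne (h3.2.symm.trans h4.2)
    · exact hne1 h3.1.symm
  rcases hsplit with h | h
  · rcases hK.inter (a, c) (by simp) q (by simp [hq]) h1 p ⟨h, hp'⟩ with h3 | h3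
    · obtain rfl : p = c := h3.1
      exact absurd hp' hcq
    · exact Or.inl h3.1
  · rcases hK.inter (c, b) (by simp) q (by simp [hq]) h2 p ⟨h, hp'⟩ with h3 | h3
    · exact Or.inr h3.1
    · obtain rfl : p = c := h3.1
      exact absurd hp' hcq

end TriangleClear

end TriangleClear

/-! ### Affine images of triangle moves -/

theorem mem_convexHull_triple {a b c p : Pt} :
    p ∈ convexHull ℝ {a, b, c} ↔
      ∃ α β γ : ℝ, 0 ≤ α ∧ 0 ≤ β ∧ 0 ≤ γ ∧ α + β + γ = 1 ∧ α • a + β • b + γ • c = p := by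
  constructor
  · intro hp
    rw [convexHull_insert (Set.insert_nonempty _ _), convexHull_pair, mem_convexJoin] at hp
    obtain ⟨x, rfl, s, ⟨u, v, hu, hv, huv, rfl⟩, ⟨r, w, hr, hw, hrw, rfl⟩⟩ := hp
    refine ⟨r, w * u, w * v, hr, by positivity, by positivity, ?_, by module⟩
    linear_combination hrw + w * huv
  · rintro ⟨α, β, γ, hα, hβ, hγ, h, rfl⟩
    have := (convex_convexHull ℝ ({a, b, c} : Set Pt)).sum_mem (t := Finset.univ)
      (w := ![α, β, γ]) (z := ![a, b, c]) (by intro i _; fin_cases i <;> simpa)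
      (by simpa [Fin.sum_univ_three] using h)
      (by intro i _; fin_cases i <;> exact subset_convexHull ℝ _ (by simp))
    simpa [Fin.sum_univ_three] using this

/-- Every triangle move comes from a triangle that is clear of the other edges. -/
theorem TriangleMove.clear {κ : Option ℕ} {K K' : Set Edge} (h : TriangleMove (IsKind κ) K K') :
    ∃ a b c R, TriangleClear R a b c ∧ K = insert (a, b) R ∧
      K' = insert (a, c) (insert (c, b) R) := by
  obtain ⟨h1, h2, a, b, c, hab, hT, rfl⟩ := h
  have hK := h1.polygonal
  have hK' := h2.polygonal
  have hne := hK.ne _ hab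
  -- A move does not ask for a nondegenerate path `a c b`; this follows from the validity of the
  -- resulting polygon.
  have hac := hK'.ne (a, c) (by simp)
  have hcb := hK'.ne (c, b) (by simp)
  refine ⟨a, b, c, K \ {(a, b)}, ⟨hne, hac, hcb, ?_, ?_⟩, ?_, ?_⟩
  · rintro p hp
    have hne' : ((a, c) : Edge) ≠ (c, b) := fun he => hac (congrArg Prod.fst he)
    rcases hK'.inter (a, c) (by simp) (c, b) (by simp) hne' p hp with h | h
    · exact h.1
    · exact absurd (h.1.symm.trans h.2) hne
  · rintro p ⟨hp, hp'⟩
    have hp1 : p ∈ segment ℝ a b := hT ▸ ⟨hp, support_mono Set.sdiff_subset hp'⟩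
    obtain ⟨q, hq, hp'⟩ := mem_support.1 hp'
    rcases hK.inter (a, b) hab q hq.1 (fun he => hq.2 he.symm) p ⟨hp1, hp'⟩ with h | h
    · exact Or.inr h.1
    · exact Or.inl h.1
  · rw [Set.insert_sdiff_singleton, Set.insert_eq_of_mem hab]
  · ext e
    simp only [Set.mem_insert_iff, Set.mem_union, Set.mem_singleton_iff]
    tauto

/-- The image of a directed edge under a map, reversed if `rev` is true. -/
def mapEdge (ψ : Pt → Pt) (rev : Bool) (e : Edge) : Edge :=
  if rev = true then (ψ e.2, ψ e.1) else (ψ e.1, ψ e.2)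

theorem support_mapEdge (ψ : Pt →ᵃ[ℝ] Pt) (rev : Bool) (K : Set Edge) :
    support (mapEdge ψ rev '' K) = ψ '' support K := by
  have h : ∀ e : Edge, segment ℝ (mapEdge ψ rev e).1 (mapEdge ψ rev e).2 =
      ψ '' segment ℝ e.1 e.2 := by
    intro e
    cases rev
    · simp [mapEdge, image_segment]
    · simp [mapEdge, image_segment, segment_symm ℝ (ψ e.2)]
  ext p
  simp only [mem_support, Set.mem_image, exists_exists_and_eq_and, h]
  constructor
  · rintro ⟨e, he, x, hx, rfl⟩
    exact ⟨x, ⟨e, he, hx⟩, rfl⟩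
  · rintro ⟨x, ⟨e, he, hx⟩, rfl⟩
    exact ⟨e, he, x, hx, rfl⟩

/-- An injective affine map preserves clearness from `R`. The additional edges `Q` can touch the
image only where `y ≤ 0`, and since `c` and one of `a`, `b` satisfy `y > 0`, the triangle has at
most the other one of these two vertices there. -/
theorem TriangleClear.map {R Q : Set Edge} {a b c : Pt} (h : TriangleClear R a b c)
    {ψ : Pt →ᵃ[ℝ] Pt} (hψ : Function.Injective ψ) (rev : Bool)
    (hQ : ∀ p, ψ p ∈ support Q → p.2.1 ≤ 0) (ha : 0 ≤ a.2.1) (hb : 0 ≤ b.2.1) (hc : 0 < c.2.1)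
    (hab : 0 < a.2.1 ∨ 0 < b.2.1) :
    TriangleClear (mapEdge ψ rev '' R ∪ Q) (ψ a) (ψ b) (ψ c) where
  ne := hψ.ne h.ne
  ne_left := hψ.ne h.ne_left
  ne_right := hψ.ne h.ne_right
  inter := by
    rw [← image_segment, ← image_segment, ← Set.image_inter hψ, ← Set.image_singleton]
    exact Set.image_mono h.inter
  clear := by
    have hT : ({ψ a, ψ b, ψ c} : Set Pt) = ψ '' {a, b, c} := by
      simp [Set.image_insert_eq]
    rw [hT, ← AffineMap.image_convexHull, support_union, support_mapEdge]
    rintro _ ⟨⟨p, hp, rfl⟩, ⟨p', hp', h2⟩ | h2⟩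
    · obtain rfl := hψ h2
      rcases h.clear ⟨hp, hp'⟩ with rfl | h3
      · exact Or.inl rfl
      · obtain rfl : p' = b := h3
        exact Or.inr rfl
    · have h0 := hQ p h2
      obtain ⟨α, β, γ, hα, hβ, hγ, hs, rfl⟩ := mem_convexHull_triple.1 hp
      simp only [Prod.snd_add, Prod.smul_snd, Prod.fst_add, Prod.smul_fst, smul_eq_mul] at h0
      have h1 := mul_nonneg hα ha
      have h2 := mul_nonneg hβ hb
      have h3 := mul_nonneg hγ hc.le
      have hγ0 : γ = 0 := by
        have h4 : γ * c.2.1 = 0 := by linarith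
        exact (mul_eq_zero.1 h4).resolve_right hc.ne'
      rcases hab with h5 | h5
      · have h4 : α * a.2.1 = 0 := by linarith
        have hα0 : α = 0 := (mul_eq_zero.1 h4).resolve_right h5.ne'
        obtain rfl : β = 1 := by linarith
        simp [hα0, hγ0]
      · have h4 : β * b.2.1 = 0 := by linarith
        have hβ0 : β = 0 := (mul_eq_zero.1 h4).resolve_right h5.ne'
        obtain rfl : α = 1 := by linarith
        simp [hβ0, hγ0]

/-- An isotopy of tangles relative to the boundary extends to every link that contains the tangle,
up to an affine map, such that the rest of the link does not enter the half-space of the tangle. -/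
theorem TriangleIsotopic.extend {k : ℕ} {K K' : Set Edge} (h : TriangleIsotopic (some k) K K')
    {ψ : Pt →ᵃ[ℝ] Pt} (hψ : Function.Injective ψ) (rev : Bool) {Q : Set Edge}
    (hQ : ∀ p, ψ p ∈ support Q → p.2.1 ≤ 0) (hK : IsKind none (mapEdge ψ rev '' K ∪ Q)) :
    TriangleIsotopic none (mapEdge ψ rev '' K ∪ Q) (mapEdge ψ rev '' K' ∪ Q) := by
  -- Validity of the extended link has to be an equivalence, since the generated equivalence
  -- relation runs through moves in both directions.
  have key : ∀ A B, TriangleMove (IsKind (some k)) A B →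
      (IsKind none (mapEdge ψ rev '' A ∪ Q) ↔ IsKind none (mapEdge ψ rev '' B ∪ Q)) ∧
      (IsKind none (mapEdge ψ rev '' A ∪ Q) →
        TriangleIsotopic none (mapEdge ψ rev '' A ∪ Q) (mapEdge ψ rev '' B ∪ Q)) := by
    intro A B hAB
    obtain ⟨a, b, c, R, hT, rfl, rfl⟩ := hAB.clear
    have hA : IsOrientedTangle k _ := hAB.1
    have hB : IsOrientedTangle k _ := hAB.2.1
    have hab := hA.nonneg (a, b) (by simp)
    have hab' := hA.proper (a, b) (by simp)
    -- The strand continues at the apex `c`, so `c` is not in the boundary plane.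
    have hc := (hB.next (a, c) (by simp)).1 ⟨(c, b), by simp, rfl⟩
    have hT' := hT.map hψ rev hQ hab.1 hab.2 hc hab'
    cases rev
    · have h1 : mapEdge ψ false '' insert (a, b) R ∪ Q =
          insert (ψ a, ψ b) (mapEdge ψ false '' R ∪ Q) := by
        simp [Set.image_insert_eq, Set.insert_union, mapEdge]
      have h2 : mapEdge ψ false '' insert (a, c) (insert (c, b) R) ∪ Q =
          insert (ψ a, ψ c) (insert (ψ c, ψ b) (mapEdge ψ false '' R ∪ Q)) := by
        simp [Set.image_insert_eq, Set.insert_union, mapEdge]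
      rw [h1, h2]
      exact ⟨hT'.isKind_iff (fun h => absurd rfl h), hT'.isotopic (fun h => absurd rfl h)⟩
    -- With reversed orientation the same triangle is used with `a` and `b` exchanged.
    · have h1 : mapEdge ψ true '' insert (a, b) R ∪ Q =
          insert (ψ b, ψ a) (mapEdge ψ true '' R ∪ Q) := by
        simp [Set.image_insert_eq, Set.insert_union, mapEdge]
      have h2 : mapEdge ψ true '' insert (a, c) (insert (c, b) R) ∪ Q =
          insert (ψ b, ψ c) (insert (ψ c, ψ a) (mapEdge ψ true '' R ∪ Q)) := by
        rw [Set.insert_comm (ψ b, ψ c)]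
        simp [Set.image_insert_eq, Set.insert_union, mapEdge]
      rw [h1, h2]
      exact ⟨hT'.symm.isKind_iff (fun h => absurd rfl h),
        hT'.symm.isotopic (fun h => absurd rfl h)⟩
  have key' : ∀ A B, Relation.EqvGen (TriangleMove (IsKind (some k))) A B →
      (IsKind none (mapEdge ψ rev '' A ∪ Q) ↔ IsKind none (mapEdge ψ rev '' B ∪ Q)) ∧
      (IsKind none (mapEdge ψ rev '' A ∪ Q) →
        TriangleIsotopic none (mapEdge ψ rev '' A ∪ Q) (mapEdge ψ rev '' B ∪ Q)) := by
    intro A B hAB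
    induction hAB with
    | rel A B h => exact key A B h
    | refl A => exact ⟨Iff.rfl, TriangleIsotopic.refl⟩
    | symm A B _ ih => exact ⟨ih.1.symm, fun h => (ih.2 (ih.1.2 h)).symm⟩
    | trans A B C _ _ ih1 ih2 =>
      exact ⟨ih1.1.trans ih2.1, fun h => (ih1.2 h).trans (ih2.2 (ih1.1.1 h))⟩
  exact (key' K K' h.2.2).2 hK

end ThompsonLink

namespace ThompsonLink

/-! ## Isotopies given by continuous families of embedded polygons -/

/-- The combinatorial type of an oriented polygonal link or tangle: `E v w` means that there is an
edge from the vertex `v` to the vertex `w`, and `B v` that `v` is a boundary vertex. -/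
structure IsPattern (κ : Option ℕ) {V : Type*} (E : V → V → Prop) (B : V → Prop) : Prop where
  out_unique : ∀ {v w w'}, E v w → E v w' → w = w'
  in_unique : ∀ {v v' w}, E v w → E v' w → v = v'
  next : ∀ {v w}, E v w → (¬ B w ↔ ∃ u, E w u)
  prev : ∀ {v w}, E v w → (¬ B v ↔ ∃ u, E u v)
  not_both : ∀ {v w}, E v w → ¬ (B v ∧ B w)
  incident : ∀ v, (∃ w, E v w) ∨ ∃ u, E u v
  no_boundary : κ = none → ∀ v, ¬ B v
  card_boundary : ∀ k, κ = some k → {v | B v}.ncard = k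

/-- The polygon of a pattern with vertices in given positions. -/
def polySet {V : Type*} (E : V → V → Prop) (f : V → Pt) : Set Edge :=
  {e | ∃ v w, E v w ∧ e = (f v, f w)}

/-- The positions `f` of the vertices of a pattern give an embedded polygon. -/
structure IsEmbedded (κ : Option ℕ) {V : Type*} (E : V → V → Prop) (B : V → Prop) (f : V → Pt) :
    Prop where
  inj : Function.Injective f
  disj : ∀ a b c d, E a b → E c d → a ≠ c → a ≠ d → b ≠ c → b ≠ d →
    Disjoint (segment ℝ (f a) (f b)) (segment ℝ (f c) (f d))
  -- Consecutive edges thus meet in their common vertex only. Stated by directions, the condition is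
  -- open in `f`, and it also excludes loops and cycles of length two.
  ray : ∀ a b c, E a b → E b c → ¬ SameRay ℝ (f a - f b) (f c - f b)
  bdry : ∀ v, B v → (f v).2 = (0, 0)
  pos : κ ≠ none → ∀ v, ¬ B v → 0 < (f v).2.1

/-- A common point other than `p` would equate positive multiples of `u - p` and `v - p`. -/
theorem eq_of_mem_segments_of_not_sameRay {u p v x : Pt} (h : ¬ SameRay ℝ (u - p) (v - p))
    (hx : x ∈ segment ℝ u p) (hx' : x ∈ segment ℝ p v) : x = p := by
  obtain ⟨a, b, ha, hb, hab, rfl⟩ := hx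
  obtain ⟨c, d, hc, hd, hcd, hx⟩ := hx'
  obtain rfl : b = 1 - a := by linarith
  obtain rfl : c = 1 - d := by linarith
  have h1 : a • (u - p) = d • (v - p) := by
    have h2 := sub_eq_zero.2 hx
    rw [← sub_eq_zero, ← neg_eq_zero, ← h2]
    module
  rcases ha.eq_or_lt with rfl | ha
  · simp
  rcases hd.eq_or_lt with rfl | hd
  · rw [← hx]
    simp
  · exact absurd (Or.inr (Or.inr ⟨a, d, ha, hd, h1⟩)) h

section

variable {κ : Option ℕ} {V : Type*} {E : V → V → Prop} {B : V → Prop} {f : V → Pt}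

namespace IsEmbedded

theorem irrefl (hf : IsEmbedded κ E B f) (v : V) : ¬ E v v := fun h =>
  hf.ray v v v h h (by simp)

/-- Two edges can share only the end of one and the start of the other, where `ray` applies; edges
without a common vertex are covered by `disj`. -/
theorem inter (hP : IsPattern κ E B) (hf : IsEmbedded κ E B f) {a b c d : V} (hab : E a b)
    (hcd : E c d) (hac : a ≠ c) {p : Pt} (hp : p ∈ segment ℝ (f a) (f b))
    (hp' : p ∈ segment ℝ (f c) (f d)) : (p = f b ∧ b = c) ∨ (p = f a ∧ a = d) := by
  by_cases had : a = d
  · subst had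
    exact Or.inr ⟨eq_of_mem_segments_of_not_sameRay (hf.ray _ _ _ hcd hab) hp' hp, rfl⟩
  by_cases hbc : b = c
  · subst hbc
    exact Or.inl ⟨eq_of_mem_segments_of_not_sameRay (hf.ray _ _ _ hab hcd) hp hp', rfl⟩
  have hbd : b ≠ d := by
    rintro rfl
    exact hac (hP.in_unique hab hcd)
  exact absurd hp' (Set.disjoint_left.1 (hf.disj a b c d hab hcd hac had hbc hbd) hp)

theorem polygonal [Finite V] (hP : IsPattern κ E B) (hf : IsEmbedded κ E B f) :
    IsOrientedPolygonal (polySet E f) where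
  finite := by
    refine (Set.finite_range fun q : V × V => (f q.1, f q.2)).subset ?_
    rintro e ⟨v, w, -, rfl⟩
    exact ⟨(v, w), rfl⟩
  ne := by
    rintro e ⟨v, w, h, rfl⟩ he
    obtain rfl : v = w := hf.inj he
    exact hf.irrefl _ h
  inter := by
    rintro e ⟨v, w, h, rfl⟩ e' ⟨v', w', h', rfl⟩ hne p ⟨hp, hp'⟩
    have hv : v ≠ v' := by
      rintro rfl
      exact hne (by rw [hP.out_unique h h'])
    rcases hf.inter hP h h' hv hp hp' with ⟨h1, rfl⟩ | ⟨h1, rfl⟩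
    · exact Or.inl ⟨h1, h1⟩
    · exact Or.inr ⟨h1, h1⟩

theorem exists_fst (hf : IsEmbedded κ E B f) (w : V) :
    (∃ e ∈ polySet E f, e.1 = f w) ↔ ∃ u, E w u := by
  constructor
  · rintro ⟨e, ⟨v, u, h, rfl⟩, he⟩
    obtain rfl := hf.inj he
    exact ⟨u, h⟩
  · rintro ⟨u, h⟩
    exact ⟨_, ⟨w, u, h, rfl⟩, rfl⟩

theorem exists_snd (hf : IsEmbedded κ E B f) (w : V) :
    (∃ e ∈ polySet E f, e.2 = f w) ↔ ∃ u, E u w := by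
  constructor
  · rintro ⟨e, ⟨v, u, h, rfl⟩, he⟩
    obtain rfl := hf.inj he
    exact ⟨v, h⟩
  · rintro ⟨u, h⟩
    exact ⟨_, ⟨u, w, h, rfl⟩, rfl⟩

theorem isKind [Finite V] (hP : IsPattern κ E B) (hf : IsEmbedded κ E B f) :
    IsKind κ (polySet E f) := by
  cases κ with
  | none =>
    have hB := hP.no_boundary rfl
    refine ⟨hf.polygonal hP, ?_, ?_⟩
    · rintro e ⟨v, w, h, rfl⟩
      exact (hf.exists_fst w).2 ((hP.next h).1 (hB w))
    · rintro e ⟨v, w, h, rfl⟩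
      exact (hf.exists_snd v).2 ((hP.prev h).1 (hB v))
  | some k =>
    have hpos := hf.pos (by simp)
    have hy : ∀ v, 0 < (f v).2.1 ↔ ¬ B v := fun v =>
      ⟨fun h hB => by simp [hf.bdry v hB] at h, hpos v⟩
    have hnonneg : ∀ v, 0 ≤ (f v).2.1 := fun v => by
      by_cases h : B v
      · simp [hf.bdry v h]
      · exact (hpos v h).le
    have hprop : ∀ v w, E v w → 0 < (f v).2.1 ∨ 0 < (f w).2.1 := fun v w h => by
      rw [hy, hy, ← not_and_or]
      exact hP.not_both h
    -- Every edge has an end with `y > 0`, so it can meet the boundary plane only in its other end.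
    have hb : {p | p ∈ support (polySet E f) ∧ p.2.1 = 0} = f '' {v | B v} := by
      ext p
      constructor
      · rintro ⟨hp, hp0⟩
        obtain ⟨e, ⟨v, w, h, rfl⟩, hp⟩ := mem_support.1 hp
        have key : ∃ x, p = f x := by
          rcases hprop v w h with h1 | h1
          · exact ⟨w, TriangleClear.y_segment (hnonneg w) h1 (by rwa [segment_symm]) hp0⟩
          · exact ⟨v, TriangleClear.y_segment (hnonneg v) h1 hp hp0⟩
        obtain ⟨x, rfl⟩ := key
        refine ⟨x, ?_, rfl⟩
        by_contra hx
        exact (hpos x hx).ne' hp0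
      · rintro ⟨v, hv, rfl⟩
        refine ⟨?_, by simp [hf.bdry v hv]⟩
        rcases hP.incident v with ⟨w, h⟩ | ⟨w, h⟩
        · exact mem_support.2 ⟨_, ⟨v, w, h, rfl⟩, left_mem_segment ℝ _ _⟩
        · exact mem_support.2 ⟨_, ⟨w, v, h, rfl⟩, right_mem_segment ℝ _ _⟩
    refine ⟨hf.polygonal hP, ?_, ?_, ?_, ?_, ?_, ?_⟩
    · rintro e ⟨v, w, h, rfl⟩
      exact ⟨hnonneg v, hnonneg w⟩
    · rintro e ⟨v, w, h, rfl⟩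
      exact hprop v w h
    · rintro e ⟨v, w, h, rfl⟩
      exact ((hf.exists_fst w).trans (hP.next h).symm).trans (hy w).symm
    · rintro e ⟨v, w, h, rfl⟩
      exact ((hf.exists_snd v).trans (hP.prev h).symm).trans (hy v).symm
    · intro p hp hp0
      have : p ∈ f '' {v | B v} := hb ▸ ⟨hp, hp0⟩
      obtain ⟨v, hv, rfl⟩ := this
      simp [hf.bdry v hv]
    · rw [hb, Set.ncard_image_of_injective _ hf.inj]
      exact hP.card_boundary k rfl

end IsEmbedded

/-- Positions with intersecting segments form the projection of a closed set along the compact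
square of the two segment parameters, which is closed. -/
theorem isOpen_disjoint_segment (a b c d : V) :
    IsOpen {g : V → Pt | Disjoint (segment ℝ (g a) (g b)) (segment ℝ (g c) (g d))} := by
  let C : Set ((unitInterval × unitInterval) × (V → Pt)) :=
    {q | (1 - (q.1.1 : ℝ)) • q.2 a + (q.1.1 : ℝ) • q.2 b =
      (1 - (q.1.2 : ℝ)) • q.2 c + (q.1.2 : ℝ) • q.2 d}
  have hC : IsClosed C := isClosed_eq (by fun_prop) (by fun_prop)
  have h := isClosedMap_snd_of_compactSpace _ hC
  have heq : {g : V → Pt | Disjoint (segment ℝ (g a) (g b)) (segment ℝ (g c) (g d))} =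
      (Prod.snd '' C)ᶜ := by
    ext g
    simp only [Set.mem_ofPred_eq, Set.mem_compl_iff, Set.disjoint_left, Set.mem_image, not_exists,
      not_and]
    constructor
    · rintro h ⟨⟨s, t⟩, g'⟩ hq rfl
      refine h (a := (1 - (s : ℝ)) • g' a + (s : ℝ) • g' b) ?_ ?_
      · exact ⟨1 - s, s, sub_nonneg.2 s.2.2, s.2.1, by ring, rfl⟩
      · refine ⟨1 - t, t, sub_nonneg.2 t.2.2, t.2.1, by ring, ?_⟩
        exact hq.symm
    · rintro h p ⟨s', s, hs', hs, hss, rfl⟩ ⟨t', t, ht', ht, htt, hp⟩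
      obtain rfl : s' = 1 - s := by linarith
      obtain rfl : t' = 1 - t := by linarith
      exact h ((⟨s, hs, by linarith⟩, ⟨t, ht, by linarith⟩), g) hp.symm rfl
  rw [heq]
  exact h.isOpen_compl

/-- Lying on the same ray is the closed condition `‖u‖ • v = ‖v‖ • u`. -/
theorem isOpen_not_sameRay (a b c : V) :
    IsOpen {g : V → Pt | ¬ SameRay ℝ (g a - g b) (g c - g b)} := by
  have : {g : V → Pt | ¬ SameRay ℝ (g a - g b) (g c - g b)} =
      {g : V → Pt | ‖g a - g b‖ • (g c - g b) = ‖g c - g b‖ • (g a - g b)}ᶜ := by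
    ext g
    simp only [Set.mem_ofPred_eq, Set.mem_compl_iff, sameRay_iff_norm_smul_eq]
  rw [this]
  exact (isClosed_eq (by fun_prop) (by fun_prop)).isOpen_compl

/-- Embeddedness is stable under small perturbations that respect the boundary. -/
theorem IsEmbedded.stable [Fintype V] (hf : IsEmbedded κ E B f) :
    ∃ ε > 0, ∀ g : V → Pt, (∀ v, dist (g v) (f v) < ε) → (∀ v, B v → (g v).2 = (0, 0)) →
      IsEmbedded κ E B g := by
  -- Finitely many open conditions. The boundary condition is closed and does not take part; it is a
  -- hypothesis on `g`.
  let U : Set (V → Pt) :=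
    (⋂ q : V × V, {g | q.1 ≠ q.2 → g q.1 ≠ g q.2}) ∩
    (⋂ q : (V × V) × (V × V), {g | (E q.1.1 q.1.2 ∧ E q.2.1 q.2.2 ∧ q.1.1 ≠ q.2.1 ∧
      q.1.1 ≠ q.2.2 ∧ q.1.2 ≠ q.2.1 ∧ q.1.2 ≠ q.2.2) →
        Disjoint (segment ℝ (g q.1.1) (g q.1.2)) (segment ℝ (g q.2.1) (g q.2.2))}) ∩
    (⋂ q : V × V × V, {g | (E q.1 q.2.1 ∧ E q.2.1 q.2.2) →
      ¬ SameRay ℝ (g q.1 - g q.2.1) (g q.2.2 - g q.2.1)}) ∩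
    (⋂ v : V, {g | (κ ≠ none ∧ ¬ B v) → 0 < (g v).2.1})
  have himp : ∀ (p : Prop) (S : Set (V → Pt)), IsOpen S → IsOpen {g | p → g ∈ S} := by
    intro p S hS
    by_cases hp : p
    · simpa [hp] using hS
    · simp [hp]
  have hU : IsOpen U := by
    refine ((IsOpen.inter ?_ ?_).inter ?_).inter ?_
    · refine isOpen_iInter_of_finite fun q => himp _ _ ?_
      exact isOpen_ne_fun (continuous_apply q.1) (continuous_apply q.2)
    · exact isOpen_iInter_of_finite fun q => himp _ _ (isOpen_disjoint_segment _ _ _ _)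
    · exact isOpen_iInter_of_finite fun q => himp _ _ (isOpen_not_sameRay _ _ _)
    · exact isOpen_iInter_of_finite fun q => himp _ {g : V → Pt | 0 < (g q).2.1}
        (isOpen_lt continuous_const (by fun_prop))
  have hfU : f ∈ U := by
    refine ⟨⟨⟨?_, ?_⟩, ?_⟩, ?_⟩
    · exact Set.mem_iInter.2 fun q h => hf.inj.ne h
    · exact Set.mem_iInter.2 fun q h => hf.disj _ _ _ _ h.1 h.2.1 h.2.2.1 h.2.2.2.1 h.2.2.2.2.1
        h.2.2.2.2.2
    · exact Set.mem_iInter.2 fun q h => hf.ray _ _ _ h.1 h.2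
    · exact Set.mem_iInter.2 fun v h => hf.pos h.1 v h.2
  obtain ⟨ε, hε, h⟩ := Metric.isOpen_iff.1 hU f hfU
  refine ⟨ε, hε, fun g hg hB => ?_⟩
  obtain ⟨⟨⟨h1, h2⟩, h3⟩, h4⟩ := h (show g ∈ Metric.ball f ε from (dist_pi_lt_iff hε).2 hg)
  refine ⟨?_, ?_, ?_, hB, ?_⟩
  · intro v w hvw
    by_contra hne
    exact Set.mem_iInter.1 h1 (v, w) hne hvw
  · intro a b c d hab hcd n1 n2 n3 n4
    exact Set.mem_iInter.1 h2 ((a, b), (c, d)) ⟨hab, hcd, n1, n2, n3, n4⟩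
  · intro a b c hab hbc
    exact Set.mem_iInter.1 h3 (a, b, c) ⟨hab, hbc⟩
  · intro hκ v hv
    exact Set.mem_iInter.1 h4 v ⟨hκ, hv⟩

end

/-! ### Points in general position -/

/-- If `δ` were not zero, the relation could be solved for `q` as an affine combination of the three
points. This compares the weights of `q` in two descriptions of the same point. -/
theorem eq_zero_of_not_mem_affineSpan {u p v q : Pt} (hq : q ∉ affineSpan ℝ {u, p, v})
    {α β γ δ : ℝ} (hs : α + β + γ + δ = 0) (h : α • u + β • p + γ • v + δ • q = 0) : δ = 0 := by
  by_contra hδ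
  apply hq
  have hu : u ∈ affineSpan ℝ {u, p, v} := subset_affineSpan ℝ _ (by simp)
  have hp : p ∈ affineSpan ℝ {u, p, v} := subset_affineSpan ℝ _ (by simp)
  have hv : v ∈ affineSpan ℝ {u, p, v} := subset_affineSpan ℝ _ (by simp)
  have h1 : q = ((-(β / δ)) • (p -ᵥ u) + (-(γ / δ)) • (v -ᵥ u)) +ᵥ u := by
    simp only [vsub_eq_sub, vadd_eq_add]
    have h2 : δ • q = -(α • u + β • p + γ • v) := (neg_eq_of_add_eq_zero_right h).symm
    have h3 : q = δ⁻¹ • (δ • q) := by rw [smul_smul, inv_mul_cancel₀ hδ, one_smul]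
    obtain rfl : α = -(β + γ + δ) := by linarith
    rw [h3, h2, div_eq_inv_mul, div_eq_inv_mul]
    have h4 : u = (δ⁻¹ * δ) • u := by rw [inv_mul_cancel₀ hδ, one_smul]
    nth_rw 4 [h4]
    module
  rw [h1]
  refine AffineSubspace.vadd_mem_of_mem_direction ?_ hu
  exact Submodule.add_mem _ (Submodule.smul_mem _ _ (AffineSubspace.vsub_mem_direction hp hu))
    (Submodule.smul_mem _ _ (AffineSubspace.vsub_mem_direction hv hu))

/-- The direction of the span has dimension at most two, collinear or not, and the space has
dimension three. -/
theorem affineSpan_triple_ne_top (u p v : Pt) : affineSpan ℝ {u, p, v} ≠ ⊤ := by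
  intro h
  have h1 : vectorSpan ℝ ({u, p, v} : Set Pt) = ⊤ := by
    rw [← direction_affineSpan, h, AffineSubspace.direction_top]
  have h2 : Module.finrank ℝ (vectorSpan ℝ (Set.range ![u, p, v])) ≤ 2 :=
    finrank_vectorSpan_range_le ℝ _ (by simp)
  have h3 : Set.range ![u, p, v] = {u, p, v} := by
    ext x
    constructor
    · rintro ⟨i, rfl⟩
      fin_cases i <;> simp
    · rintro (rfl | rfl | hx)
      · exact ⟨0, rfl⟩
      · exact ⟨1, rfl⟩
      · exact ⟨2, hx.symm⟩
  rw [h3, h1, finrank_top] at h2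
  simp at h2

/-- Close to every point there are points outside two given planes. -/
theorem exists_generic_point (p : Pt) {r : ℝ} (hr : 0 < r) (u v u' p' v' : Pt) :
    ∃ q, dist q p < r ∧ q ∉ affineSpan ℝ {u, p, v} ∧ q ∉ affineSpan ℝ {u', p', v'} := by
  by_contra! h
  have hsub : Metric.ball p r ⊆
      (affineSpan ℝ {u, p, v} : Set Pt) ∪ (affineSpan ℝ {u', p', v'} : Set Pt) := by
    intro q hq
    by_cases h1 : q ∈ affineSpan ℝ {u, p, v}
    · exact Or.inl h1
    · exact Or.inr (h q hq h1)
  -- Two proper affine subspaces form a null set, so they cannot cover a ball.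
  have h0 : (MeasureTheory.Measure.addHaar : MeasureTheory.Measure Pt) (Metric.ball p r) = 0 := by
    refine MeasureTheory.measure_mono_null hsub (MeasureTheory.measure_union_null ?_ ?_)
    · exact MeasureTheory.Measure.addHaar_affineSubspace _ _ (affineSpan_triple_ne_top _ _ _)
    · exact MeasureTheory.Measure.addHaar_affineSubspace _ _ (affineSpan_triple_ne_top _ _ _)
  exact (Metric.measure_ball_pos _ p hr).ne' h0

/-- The triangle is swept out by segments from `a` to the opposite side. If a vertex moves along
that side and `a` is its neighbour, these segments are edges of the intermediate polygons, whose
embeddedness makes the triangle clear. -/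
theorem exists_segment_of_mem_convexHull {a b c x : Pt} (hx : x ∈ convexHull ℝ {a, b, c}) :
    ∃ s ∈ segment ℝ b c, x ∈ segment ℝ a s := by
  rw [convexHull_insert (Set.insert_nonempty _ _), convexHull_pair, mem_convexJoin] at hx
  obtain ⟨_, rfl, s, hs, hx⟩ := hx
  exact ⟨s, hs, hx⟩

end ThompsonLink

namespace ThompsonLink

/-! ### Moving one vertex at a time -/

section

variable {κ : Option ℕ} {V : Type*} {E : V → V → Prop} {B : V → Prop}

theorem polySet_update [DecidableEq V] (hP : IsPattern κ E B) (h : V → Pt) {u w v : V}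
    (huw : E u w) (hwv : E w v) (hirr : ∀ x, ¬ E x x) (q : Pt) :
    polySet E (Function.update h w q) = insert (h u, q) (insert (q, h v)
      {e | ∃ a b, E a b ∧ a ≠ w ∧ b ≠ w ∧ e = (h a, h b)}) := by
  have hu : u ≠ w := by rintro rfl; exact hirr _ huw
  have hv : v ≠ w := by rintro rfl; exact hirr _ hwv
  ext e
  constructor
  · rintro ⟨a, b, hab, rfl⟩
    by_cases ha : a = w
    · subst ha
      obtain rfl := hP.out_unique hab hwv
      simp [Function.update_of_ne hv]
    · by_cases hb : b = w
      · subst hb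
        obtain rfl := hP.in_unique hab huw
        simp [Function.update_of_ne hu]
      · exact Or.inr (Or.inr ⟨a, b, hab, ha, hb, by
          rw [Function.update_of_ne ha, Function.update_of_ne hb]⟩)
  · rintro (rfl | rfl | ⟨a, b, hab, ha, hb, rfl⟩)
    · exact ⟨u, w, huw, by rw [Function.update_of_ne hu, Function.update_self]⟩
    · exact ⟨w, v, hwv, by rw [Function.update_of_ne hv, Function.update_self]⟩
    · exact ⟨a, b, hab, by rw [Function.update_of_ne ha, Function.update_of_ne hb]⟩

/-- Moving an interior vertex out of the plane of the two edges at this vertex. -/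
theorem IsEmbedded.isotopic_update_of_generic [Finite V] [DecidableEq V] (hP : IsPattern κ E B)
    {h : V → Pt} {u w v : V} (huw : E u w) (hwv : E w v) {q : Pt}
    (hq : q ∉ affineSpan ℝ {h u, h w, h v})
    (hemb : ∀ s ∈ segment ℝ (h w) q, IsEmbedded κ E B (Function.update h w s)) :
    KindIsotopic κ (polySet E h) (polySet E (Function.update h w q)) := by
  have h0 : IsEmbedded κ E B h := by
    simpa using hemb _ (left_mem_segment ℝ _ _)
  have hq0 := hemb _ (right_mem_segment ℝ _ _)
  have hu : u ≠ w := by rintro rfl; exact h0.irrefl _ huw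
  have hv : v ≠ w := by rintro rfl; exact h0.irrefl _ hwv
  have hwB : ¬ B w := (hP.next huw).2 ⟨v, hwv⟩
  have hpw : κ ≠ none → 0 < (h w).2.1 := fun hκ => h0.pos hκ w hwB
  have hpq : κ ≠ none → 0 < q.2.1 := fun hκ => by simpa using hq0.pos hκ w hwB
  set R : Set Edge := {e | ∃ a b, E a b ∧ a ≠ w ∧ b ≠ w ∧ e = (h a, h b)} with hR
  have e0 : polySet E h = insert (h u, h w) (insert (h w, h v) R) := by
    have := polySet_update hP h huw hwv h0.irrefl (h w)
    rwa [Function.update_eq_self] at this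
  have e1 := polySet_update hP h huw hwv h0.irrefl q
  rw [← hR] at e1
  have hne : ∀ {x}, x ∈ affineSpan ℝ {h u, h w, h v} → x ≠ q := by
    rintro x hx rfl
    exact hq hx
  have hqu : h u ≠ q := hne (subset_affineSpan ℝ _ (by simp))
  have hqw : h w ≠ q := hne (subset_affineSpan ℝ _ (by simp))
  have hqv : h v ≠ q := hne (subset_affineSpan ℝ _ (by simp))
  -- The first move replaces the edge `w v` by the path `w q v`. The edge `u w` stays away because
  -- `q` is outside its plane with `v`, and the other edges because the triangle is swept out by the
  -- edges from `s` to `v`.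
  have T1 : TriangleClear (insert (h u, h w) R) (h w) (h v) q := by
    refine ⟨h0.inj.ne hv.symm, hqw, hqv.symm, ?_, ?_⟩
    · rintro x ⟨⟨a, b, ha, hb, hab, rfl⟩, ⟨c, d, hc, hd, hcd, hx⟩⟩
      have h1 := eq_zero_of_not_mem_affineSpan hq (α := 0) (β := a) (γ := -d) (δ := b - c)
        (by linarith) (by rw [← sub_eq_zero] at hx; rw [← neg_eq_zero, ← hx]; module)
      obtain rfl : c = b := by linarith
      obtain rfl : d = a := by linarith
      have h2 : d • (h v - h w) = 0 := by
        rw [← sub_eq_zero] at hx; rw [← hx]; module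
      have h3 := (smul_eq_zero.1 h2).resolve_right (sub_ne_zero.2 (h0.inj.ne hv))
      obtain rfl : c = 1 := by linarith
      simp [h3]
    · rintro x ⟨hx, hx'⟩
      rw [support_insert] at hx'
      rcases hx' with hx' | hx'
      · obtain ⟨a, b, c, ha, hb, hc, habc, rfl⟩ := mem_convexHull_triple.1 hx
        obtain ⟨d, e, hd, he, hde, hx⟩ := id hx'
        have h1 := eq_zero_of_not_mem_affineSpan hq (α := -d) (β := a - e) (γ := b) (δ := c)
          (by linarith) (by rw [← sub_eq_zero] at hx; rw [← neg_eq_zero, ← hx]; module)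
        subst h1
        have h2 : a • h w + b • h v + (0 : ℝ) • q ∈ segment ℝ (h w) (h v) :=
          ⟨a, b, ha, hb, by linarith, by simp⟩
        rcases h0.inter hP huw hwv hu hx' h2 with h3 | h3
        · exact Or.inl h3.1
        · exact Or.inr (by rw [h3.1, h3.2]; rfl)
      · obtain ⟨_, ⟨a, b, hab, ha, hb, rfl⟩, hx'⟩ := mem_support.1 hx'
        have hx1 : x ∈ convexHull ℝ {h v, h w, q} := by rwa [Set.insert_comm]
        obtain ⟨s, hs, hx1⟩ := exists_segment_of_mem_convexHull hx1
        have hg := hemb s hs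
        rcases hg.inter hP hwv hab ha.symm (p := x)
          (by rw [Function.update_self, Function.update_of_ne hv, segment_symm]; exact hx1)
          (by rw [Function.update_of_ne ha, Function.update_of_ne hb]; exact hx') with h3 | h3
        · rw [Function.update_of_ne hv] at h3
          exact Or.inr h3.1
        · exact absurd h3.2.symm hb
  -- The second move replaces the path `u w q` by the edge `u q`, across the triangle swept out by
  -- the edges from `u` to `s`.
  have T2 : TriangleClear (insert (q, h v) R) (h u) q (h w) := by
    refine ⟨hqu, h0.inj.ne hu, hqw, ?_, ?_⟩
    · rintro x ⟨⟨a, b, ha, hb, hab, rfl⟩, ⟨c, d, hc, hd, hcd, hx⟩⟩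
      have h1 := eq_zero_of_not_mem_affineSpan hq (α := -a) (β := c - b) (γ := 0) (δ := d)
        (by linarith) (by rw [← sub_eq_zero] at hx; rw [← hx]; module)
      subst h1
      obtain rfl : c = 1 := by linarith
      rw [← hx]
      simp
    · rintro x ⟨hx, hx'⟩
      rw [support_insert] at hx'
      rcases hx' with hx' | hx'
      · obtain ⟨a, b, c, ha, hb, hc, habc, rfl⟩ := mem_convexHull_triple.1 hx
        obtain ⟨d, e, hd, he, hde, hx⟩ := id hx'
        have h1 := eq_zero_of_not_mem_affineSpan hq (α := a) (β := c) (γ := -e) (δ := b - d)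
          (by linarith) (by rw [← sub_eq_zero] at hx; rw [← neg_eq_zero, ← hx]; module)
        obtain rfl : d = b := by linarith
        rcases he.eq_or_lt with rfl | he
        · obtain rfl : a = 0 := by linarith
          obtain rfl : c = 0 := by linarith
          obtain rfl : d = 1 := by linarith
          exact Or.inr (by simp)
        -- A positive weight of `h v` would place `h v` on the edge from `h u` to `h w`.
        · exfalso
          have h2 : h v ∈ segment ℝ (h u) (h w) := by
            refine ⟨a / e, c / e, by positivity, by positivity, ?_, ?_⟩
            · rw [← add_div]
              rw [div_eq_one_iff_eq he.ne']
              linarith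
            · have h3 : e • h v = a • h u + c • h w := by
                rw [← sub_eq_zero] at hx ⊢
                rw [← hx]; module
              have h4 : h v = e⁻¹ • (e • h v) := by
                rw [smul_smul, inv_mul_cancel₀ he.ne', one_smul]
              rw [h4, h3, div_eq_inv_mul, div_eq_inv_mul]
              module
          rcases h0.inter hP huw hwv hu h2 (right_mem_segment ℝ _ _) with h3 | h3
          · exact hv (h0.inj h3.1)
          · obtain rfl := h3.2
            exact h0.ray _ _ _ huw hwv (SameRay.refl _)
      · obtain ⟨_, ⟨a, b, hab, ha, hb, rfl⟩, hx'⟩ := mem_support.1 hx'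
        obtain ⟨s, hs, hx1⟩ := exists_segment_of_mem_convexHull hx
        have hg := hemb s (by rwa [segment_symm])
        have hua : u ≠ a := by
          rintro rfl
          exact hb (hP.out_unique hab huw)
        rcases hg.inter hP huw hab hua (p := x)
          (by rw [Function.update_self, Function.update_of_ne hu]; exact hx1)
          (by rw [Function.update_of_ne ha, Function.update_of_ne hb]; exact hx') with h3 | h3
        · exact absurd h3.2.symm ha
        · rw [Function.update_of_ne hu] at h3
          exact Or.inl h3.1
  have hK := h0.isKind hP
  rw [e0, Set.insert_comm] at hK
  have i1 := T1.isotopic (fun hκ => ⟨hpq hκ, Or.inl (hpw hκ)⟩) hK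
  have e2 : insert (h w, q) (insert (q, h v) (insert (h u, h w) R)) =
      insert (h u, h w) (insert (h w, q) (insert (q, h v) R)) := by
    rw [Set.insert_comm (q, h v), Set.insert_comm (h w, q)]
  rw [e2] at i1
  have i2 := T2.isotopic' (fun hκ => ⟨hpw hκ, Or.inr (hpq hκ)⟩) i1.2.1
  rw [e0, e1, Set.insert_comm]
  exact (i1.trans i2).kindIsotopic

/-- Moving a boundary vertex. -/
theorem IsEmbedded.isotopic_update_of_boundary [Finite V] [DecidableEq V] (hP : IsPattern κ E B)
    {h : V → Pt} {w : V} (hw : B w) {q : Pt}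
    (hemb : ∀ s ∈ segment ℝ (h w) q, IsEmbedded κ E B (Function.update h w s)) :
    KindIsotopic κ (polySet E h) (polySet E (Function.update h w q)) := by
  have h0 : IsEmbedded κ E B h := by
    simpa using hemb _ (left_mem_segment ℝ _ _)
  have hq0 := hemb _ (right_mem_segment ℝ _ _)
  cases κ with
  | none => exact absurd hw (hP.no_boundary rfl w)
  | some k =>
  refine ⟨h0.isKind hP, hq0.isKind hP, Relation.EqvGen.rel _ _ (Or.inr ?_)⟩
  refine ⟨h0.isKind hP, hq0.isKind hP, ?_⟩
  have hqB : q.2 = (0, 0) := by simpa using hq0.bdry w hw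
  rcases hP.incident w with ⟨u, hu⟩ | ⟨u, hu⟩
  · have hin : ∀ x, ¬ E x w := fun x hx => (hP.prev hu).2 ⟨x, hx⟩ hw
    have huw : u ≠ w := by rintro rfl; exact hin _ hu
    have hmem : (h w, h u) ∈ polySet E h := ⟨w, u, hu, rfl⟩
    refine ⟨h u, h w, q, h0.bdry w hw, hqB, ?_, Or.inr ⟨hmem, ?_⟩⟩
    · apply Set.Subset.antisymm
      · rintro x ⟨hx, hx'⟩
        obtain ⟨_, ⟨a, b, hab, rfl⟩, hx'⟩ := mem_support.1 hx'
        by_cases ha : a = w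
        · subst ha
          obtain rfl := hP.out_unique hab hu
          rwa [segment_symm]
        have hb : b ≠ w := by rintro rfl; exact hin _ hab
        obtain ⟨s, hs, hx⟩ := exists_segment_of_mem_convexHull hx
        rcases (hemb s hs).inter hP hu hab (fun he => ha he.symm) (p := x)
          (by rw [Function.update_self, Function.update_of_ne huw, segment_symm]; exact hx)
          (by rw [Function.update_of_ne ha, Function.update_of_ne hb]; exact hx') with h3 | h3
        · rw [Function.update_of_ne huw] at h3
          rw [h3.1]
          exact left_mem_segment ℝ _ _
        · exact absurd h3.2.symm hb
      · exact fun x hx => ⟨segment_ab_subset_hull hx,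
          mem_support.2 ⟨_, hmem, by rwa [segment_symm]⟩⟩
    · ext e
      constructor
      · rintro ⟨a, b, hab, rfl⟩
        have hb : b ≠ w := by rintro rfl; exact hin _ hab
        by_cases ha : a = w
        · subst ha
          obtain rfl := hP.out_unique hab hu
          exact Or.inr (by simp [Function.update_of_ne hb])
        · rw [Function.update_of_ne ha, Function.update_of_ne hb]
          exact Or.inl ⟨⟨a, b, hab, rfl⟩, fun he => ha (h0.inj (congrArg Prod.fst he))⟩
      · rintro (⟨⟨a, b, hab, rfl⟩, hne⟩ | he)
        · have hb : b ≠ w := by rintro rfl; exact hin _ hab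
          have ha : a ≠ w := by
            rintro rfl
            obtain rfl := hP.out_unique hab hu
            exact hne rfl
          exact ⟨a, b, hab, by rw [Function.update_of_ne ha, Function.update_of_ne hb]⟩
        · obtain rfl : e = (q, h u) := he
          exact ⟨w, u, hu, by rw [Function.update_self, Function.update_of_ne huw]⟩
  · have hout : ∀ x, ¬ E w x := fun x hx => (hP.next hu).2 ⟨x, hx⟩ hw
    have huw : u ≠ w := by rintro rfl; exact hout _ hu
    have hmem : (h u, h w) ∈ polySet E h := ⟨u, w, hu, rfl⟩
    refine ⟨h u, h w, q, h0.bdry w hw, hqB, ?_, Or.inl ⟨hmem, ?_⟩⟩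
    · apply Set.Subset.antisymm
      · rintro x ⟨hx, hx'⟩
        obtain ⟨_, ⟨a, b, hab, rfl⟩, hx'⟩ := mem_support.1 hx'
        by_cases hb : b = w
        · subst hb
          obtain rfl := hP.in_unique hab hu
          exact hx'
        have ha : a ≠ w := by rintro rfl; exact hout _ hab
        obtain ⟨s, hs, hx⟩ := exists_segment_of_mem_convexHull hx
        have hua : u ≠ a := by rintro rfl; exact hb (hP.out_unique hab hu)
        rcases (hemb s hs).inter hP hu hab hua (p := x)
          (by rw [Function.update_self, Function.update_of_ne huw]; exact hx)
          (by rw [Function.update_of_ne ha, Function.update_of_ne hb]; exact hx') with h3 | h3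
        · exact absurd h3.2.symm ha
        · rw [Function.update_of_ne huw] at h3
          rw [h3.1]
          exact left_mem_segment ℝ _ _
      · exact fun x hx => ⟨segment_ab_subset_hull hx, mem_support.2 ⟨_, hmem, hx⟩⟩
    · ext e
      constructor
      · rintro ⟨a, b, hab, rfl⟩
        have ha : a ≠ w := by rintro rfl; exact hout _ hab
        by_cases hb : b = w
        · subst hb
          obtain rfl := hP.in_unique hab hu
          exact Or.inr (by simp [Function.update_of_ne ha])
        · rw [Function.update_of_ne ha, Function.update_of_ne hb]
          exact Or.inl ⟨⟨a, b, hab, rfl⟩, fun he => hb (h0.inj (congrArg Prod.snd he))⟩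
      · rintro (⟨⟨a, b, hab, rfl⟩, hne⟩ | he)
        · have ha : a ≠ w := by rintro rfl; exact hout _ hab
          have hb : b ≠ w := by
            rintro rfl
            obtain rfl := hP.in_unique hab hu
            exact hne rfl
          exact ⟨a, b, hab, by rw [Function.update_of_ne ha, Function.update_of_ne hb]⟩
        · obtain rfl : e = (h u, q) := he
          exact ⟨u, w, hu, by rw [Function.update_self, Function.update_of_ne huw]⟩

theorem dist_lt_of_mem_segment {p a b s : Pt} {r : ℝ} (ha : dist a p < r) (hb : dist b p < r)
    (hs : s ∈ segment ℝ a b) : dist s p < r :=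
  (convex_ball p r).segment_subset ha hb hs

/-- Small perturbations of embedded polygons are isotopies. -/
theorem IsEmbedded.isotopic_of_close [Fintype V] (hP : IsPattern κ E B) {f : V → Pt}
    (hf : IsEmbedded κ E B f) :
    ∃ ε > 0, ∀ g : V → Pt, (∀ v, dist (g v) (f v) < ε) → (∀ v, B v → (g v).2 = (0, 0)) →
      KindIsotopic κ (polySet E f) (polySet E g) := by
  classical
  obtain ⟨ε, hε, hst⟩ := hf.stable
  refine ⟨ε, hε, fun g hg hgB => ?_⟩
  have step : ∀ (h : V → Pt) (w : V) (q : Pt), (∀ v, dist (h v) (f v) < ε) →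
      (∀ v, B v → (h v).2 = (0, 0)) → dist q (f w) < ε → (B w → q.2 = (0, 0)) →
      IsEmbedded κ E B (Function.update h w q) := by
    intro h w q hh hhB hq hqB
    refine hst _ (fun v => ?_) (fun v hv => ?_)
    · by_cases hvw : v = w
      · subst hvw; simpa using hq
      · simpa [Function.update_of_ne hvw] using hh v
    · by_cases hvw : v = w
      · subst hvw; simpa using hqB hv
      · simpa [Function.update_of_ne hvw] using hhB v hv
  have move : ∀ (h : V → Pt) (w : V) (q : Pt), (∀ v, dist (h v) (f v) < ε) →
      (∀ v, B v → (h v).2 = (0, 0)) → dist q (f w) < ε → (B w → q.2 = (0, 0)) →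
      KindIsotopic κ (polySet E h) (polySet E (Function.update h w q)) := by
    intro h w q hh hhB hq hqB
    by_cases hw : B w
    · refine IsEmbedded.isotopic_update_of_boundary hP hw fun s hs => ?_
      refine step h w s hh hhB (dist_lt_of_mem_segment (hh w) hq hs) fun _ => ?_
      obtain ⟨a, b, -, -, -, rfl⟩ := hs
      simp [hhB w hw, hqB hw]
    · obtain ⟨u, v, huw, hwv⟩ : ∃ u v, E u w ∧ E w v := by
        rcases hP.incident w with ⟨v, hv⟩ | ⟨u, hu⟩
        · obtain ⟨u, hu⟩ := (hP.prev hv).1 hw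
          exact ⟨u, v, hu, hv⟩
        · obtain ⟨v, hv⟩ := (hP.next hu).1 hw
          exact ⟨u, v, hu, hv⟩
      have hu : u ≠ w := by rintro rfl; exact hf.irrefl _ huw
      have hv : v ≠ w := by rintro rfl; exact hf.irrefl _ hwv
      -- The old and the new position may lie in one plane with the neighbours, so the vertex goes
      -- through a point `q'` off both planes that it spans with its neighbours. The radius is the
      -- distance by which `h w` stays inside the `ε`-ball around `f w`.
      obtain ⟨q', hq', h1, h2⟩ := exists_generic_point (h w)
        (sub_pos.2 (hh w)) (h u) (h v) (h u) q (h v)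
      have hq'' : dist q' (f w) < ε := by
        have := dist_triangle q' (h w) (f w)
        linarith
      have i1 := IsEmbedded.isotopic_update_of_generic hP huw hwv h1 fun s hs =>
        step h w s hh hhB (dist_lt_of_mem_segment (hh w) hq'' hs) fun h => absurd h hw
      have i2 := IsEmbedded.isotopic_update_of_generic hP (h := Function.update h w q) huw hwv
        (q := q') (by rwa [Function.update_self, Function.update_of_ne hu,
          Function.update_of_ne hv]) fun s hs => by
            rw [Function.update_idem]
            rw [Function.update_self] at hs
            exact step h w s hh hhB (dist_lt_of_mem_segment hq hq'' hs) fun h => absurd h hw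
      rw [Function.update_idem] at i2
      exact i1.trans i2.symm
  -- The vertices in `S` have moved already; every such mixture is still within `ε` of `f`.
  have key : ∀ S : Finset V, KindIsotopic κ (polySet E f) (polySet E (S.piecewise g f)) := by
    intro S
    induction S using Finset.induction_on with
    | empty =>
      rw [Finset.piecewise_empty]
      exact KindIsotopic.refl (hf.isKind hP)
    | insert w S hw ih =>
      rw [Finset.piecewise_insert]
      refine ih.trans (move _ w (g w) (fun v => ?_) (fun v hv => ?_) (hg w) (hgB w))
      · by_cases hvS : v ∈ S
        · rw [Finset.piecewise_eq_of_mem _ _ _ hvS]; exact hg v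
        · rw [Finset.piecewise_eq_of_notMem _ _ _ hvS]; simpa using hε
      · by_cases hvS : v ∈ S
        · rw [Finset.piecewise_eq_of_mem _ _ _ hvS]; exact hgB v hv
        · rw [Finset.piecewise_eq_of_notMem _ _ _ hvS]; exact hf.bdry v hv
  simpa using key Finset.univ

/-- A continuous family of embedded polygons is an isotopy. -/
theorem isotopic_of_family [Fintype V] (hP : IsPattern κ E B) (F : ℝ → V → Pt)
    (hF : Continuous F) (hemb : ∀ t ∈ Set.Icc (0 : ℝ) 1, IsEmbedded κ E B (F t)) :
    KindIsotopic κ (polySet E (F 0)) (polySet E (F 1)) := by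
  -- Isotopy is symmetric and transitive and relates each parameter to all nearby ones, so
  -- connectedness of the interval relates the two ends.
  refine isPreconnected_Icc.induction₂ (s := Set.Icc (0 : ℝ) 1)
    (fun s t => KindIsotopic κ (polySet E (F s)) (polySet E (F t))) ?_ ?_ ?_
    (by simp) (by simp)
  · intro t ht
    obtain ⟨ε, hε, h⟩ := (hemb t ht).isotopic_of_close hP
    have h1 : ∀ᶠ s in nhdsWithin t (Set.Icc 0 1), dist (F s) (F t) < ε :=
      (Metric.continuous_iff'.1 hF t ε hε).filter_mono nhdsWithin_le_nhds
    filter_upwards [h1, self_mem_nhdsWithin] with s hs hs'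
    exact h _ (fun v => lt_of_le_of_lt (dist_le_pi_dist _ _ v) hs) (hemb s hs').bdry
  · exact fun _ _ _ _ _ _ h h' => h.trans h'
  · exact fun _ _ _ _ h => h.symm

end

end ThompsonLink

namespace ThompsonLink

/-! ## Arch diagrams

An arch diagram consists of vertical strands that are joined in pairs by horizontal segments. -/

/-- The vertices of an arch diagram: the lower end of the `i`-th vertical strand, its upper end at
height `0`, and its upper end at height `1`. -/
inductive ArchVertex (ι : Type*) : Type _
  | bot : ι → ArchVertex ι
  | low : ι → ArchVertex ι
  | top : ι → ArchVertex ι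

open ArchVertex

instance {ι : Type*} [Finite ι] : Finite (ArchVertex ι) := by
  refine Finite.of_surjective (α := ι ⊕ ι ⊕ ι)
    (Sum.elim bot (Sum.elim low top)) ?_
  rintro (i | i | i)
  · exact ⟨Sum.inl i, rfl⟩
  · exact ⟨Sum.inr (Sum.inl i), rfl⟩
  · exact ⟨Sum.inr (Sum.inr i), rfl⟩

/-- The directed edges of an arch diagram whose `i`-th vertical strand is directed upwards if `up i`
is true, and is joined to the `π i`-th one. -/
inductive ArchEdge {ι : Type*} (up : ι → Bool) (π : ι → ι) : ArchVertex ι → ArchVertex ι → Prop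
  | vup (i : ι) : up i = true → ArchEdge up π (bot i) (low i)
  | zup (i : ι) : up i = true → ArchEdge up π (low i) (top i)
  | row (i : ι) : up i = true → ArchEdge up π (top i) (top (π i))
  | zdown (i : ι) : up i = false → ArchEdge up π (top i) (low i)
  | vdown (i : ι) : up i = false → ArchEdge up π (low i) (bot i)

/-- The boundary vertices of an arch diagram. -/
def ArchVertex.IsFoot {ι : Type*} : ArchVertex ι → Prop
  | bot _ => True
  | _ => False

/-- The positions of the vertices of an arch diagram with strands over `x` and of height `h`. -/
def archPos {ι : Type*} (x h : ι → ℝ) : ArchVertex ι → Pt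
  | bot i => (x i, 0, 0)
  | low i => (x i, h i, 0)
  | top i => (x i, h i, 1)

theorem continuous_archPos {ι T : Type*} [TopologicalSpace T] {x h : T → ι → ℝ}
    (hx : ∀ i, Continuous fun t => x t i) (hh : ∀ i, Continuous fun t => h t i) :
    Continuous fun t => archPos (x t) (h t) := by
  refine continuous_pi ?_
  rintro (i | i | i)
  · exact (hx i).prodMk continuous_const
  · exact (hx i).prodMk ((hh i).prodMk continuous_const)
  · exact (hx i).prodMk ((hh i).prodMk continuous_const)

/-- The partner of a vertical strand is directed oppositely. -/
structure IsPairing {ι : Type*} (up : ι → Bool) (π : ι → ι) : Prop where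
  invol : ∀ i, π (π i) = i
  up_partner : ∀ i, up (π i) = !up i

section

variable {ι : Type*} {up : ι → Bool} {π : ι → ι}

/-- Partners have opposite directions, so a path that ascends one strand crosses its arch and
descends the partner. In particular `π` has no fixed point. -/
theorem IsPairing.isPattern (hπ : IsPairing up π) [Finite ι] :
    IsPattern (some (Nat.card ι)) (ArchEdge up π) IsFoot where
  out_unique := by
    rintro v w w' (_ | _ | _ | _ | _) (_ | _ | _ | _ | _) <;> simp_all
  in_unique := by
    intro v v' w h h'
    cases h with
    | vup i hi => cases h' <;> simp_all
    | zup i hi =>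
      generalize hw : top i = w at h'
      cases h' with
      | row j hj =>
        obtain rfl : i = π j := by simpa using hw
        simp [hπ.up_partner, hj] at hi
      | _ => simp_all
    | row i hi =>
      generalize hw : top (π i) = w at h'
      cases h' with
      | row j hj =>
        have h1 : π i = π j := by simpa using hw
        rw [← hπ.invol i, h1, hπ.invol]
      | zup j hj =>
        obtain rfl : π i = j := by simpa using hw
        simp [hπ.up_partner, hi] at hj
      | _ => simp_all
    | zdown i hi => cases h' <;> simp_all
    | vdown i hi => cases h'; simp_all
  next := by
    rintro v w (⟨i, hi⟩ | ⟨i, hi⟩ | ⟨i, hi⟩ | ⟨i, hi⟩ | ⟨i, hi⟩)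
    · exact iff_of_true id ⟨_, .zup i hi⟩
    · exact iff_of_true id ⟨_, .row i hi⟩
    · exact iff_of_true id ⟨_, .zdown (π i) (by simp [hπ.up_partner, hi])⟩
    · exact iff_of_true id ⟨_, .vdown i hi⟩
    · refine iff_of_false (fun h => h trivial) ?_
      rintro ⟨u, hu⟩
      cases hu
      simp_all
  prev := by
    rintro v w (⟨i, hi⟩ | ⟨i, hi⟩ | ⟨i, hi⟩ | ⟨i, hi⟩ | ⟨i, hi⟩)
    · refine iff_of_false (fun h => h trivial) ?_
      rintro ⟨u, hu⟩
      cases hu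
      simp_all
    · exact iff_of_true id ⟨_, .vup i hi⟩
    · exact iff_of_true id ⟨_, .zup i hi⟩
    · refine iff_of_true id ⟨top (π i), ?_⟩
      have := ArchEdge.row (π := π) (up := up) (π i) (by simp [hπ.up_partner, hi])
      rwa [hπ.invol] at this
    · exact iff_of_true id ⟨_, .zdown i hi⟩
  not_both := by
    rintro v w (_ | _ | _ | _ | _) <;> simp [IsFoot]
  incident := by
    rintro (i | i | i) <;> rcases hi : up i with _ | _
    · exact Or.inr ⟨_, .vdown i hi⟩
    · exact Or.inl ⟨_, .vup i hi⟩
    · exact Or.inl ⟨_, .vdown i hi⟩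
    · exact Or.inl ⟨_, .zup i hi⟩
    · exact Or.inl ⟨_, .zdown i hi⟩
    · exact Or.inl ⟨_, .row i hi⟩
  no_boundary := by simp
  card_boundary := by
    rintro k hk
    obtain rfl : Nat.card ι = k := by simpa using hk
    have h : {v : ArchVertex ι | v.IsFoot} = Set.range bot := by
      ext (i | i | i) <;> simp [IsFoot]
    rw [h, ← Set.image_univ, Set.ncard_image_of_injective _ (fun i j hij => by simpa using hij),
      Set.ncard_univ]

/-- The strands of an arch diagram are over different points, and horizontal segments of the same
height are disjoint. -/
structure IsSeparated (π : ι → ι) (x h : ι → ℝ) : Prop where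
  inj : Function.Injective x
  pos : ∀ i, 0 < h i
  height : ∀ i, h (π i) = h i
  sep : ∀ i j, j ≠ i → j ≠ π i → h i = h j →
    max (x i) (x (π i)) < min (x j) (x (π j)) ∨ max (x j) (x (π j)) < min (x i) (x (π i))

/-- A nonzero `2 × 2` minor shows that the vectors are linearly independent. -/
theorem not_sameRay_of_mul_ne {u v : Pt} (φ ψ : Pt →ₗ[ℝ] ℝ) (h : φ u * ψ v ≠ ψ u * φ v) :
    ¬ SameRay ℝ u v := by
  rintro (rfl | rfl | ⟨r, s, hr, hs, hrs⟩)
  · simp at h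
  · simp at h
  · have h1 : r * φ u = s * φ v := by simpa using congrArg φ hrs
    have h2 : r * ψ u = s * ψ v := by simpa using congrArg ψ hrs
    apply h
    have h3 : r * s * (φ u * ψ v) = r * s * (ψ u * φ v) := by
      calc r * s * (φ u * ψ v) = (r * φ u) * (s * ψ v) := by ring
        _ = (r * ψ u) * (s * φ v) := by rw [h1, ← h2]; ring
        _ = _ := by ring
    exact mul_left_cancel₀ (mul_pos hr hs).ne' h3

theorem not_sameRay_of_mul_neg {u v : Pt} (φ : Pt →ₗ[ℝ] ℝ) (h : φ u * φ v < 0) :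
    ¬ SameRay ℝ u v := by
  rintro (rfl | rfl | ⟨r, s, hr, hs, hrs⟩)
  · simp at h
  · simp at h
  · have h1 : r * φ u = s * φ v := by simpa using congrArg φ hrs
    have h2 : 0 ≤ r * φ u * (s * φ v) := by
      rw [h1]; exact mul_self_nonneg _
    have h3 : r * φ u * (s * φ v) = r * s * (φ u * φ v) := by ring
    have := mul_pos hr hs
    nlinarith

/-- The coordinate `x`. -/
def coordX : Pt →ₗ[ℝ] ℝ := LinearMap.fst ℝ ℝ (ℝ × ℝ)

/-- The coordinate `y`. -/
def coordY : Pt →ₗ[ℝ] ℝ := LinearMap.fst ℝ ℝ ℝ ∘ₗ LinearMap.snd ℝ ℝ (ℝ × ℝ)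

/-- The coordinate `z`. -/
def coordZ : Pt →ₗ[ℝ] ℝ := LinearMap.snd ℝ ℝ ℝ ∘ₗ LinearMap.snd ℝ ℝ (ℝ × ℝ)

@[simp] theorem coordX_apply (p : Pt) : coordX p = p.1 := rfl

@[simp] theorem coordY_apply (p : Pt) : coordY p = p.2.1 := rfl

@[simp] theorem coordZ_apply (p : Pt) : coordZ p = p.2.2 := rfl

/-- The points of the edges of an arch diagram. -/
theorem ArchEdge.mem_segment {x h : ι → ℝ} (hπ : ∀ i, h (π i) = h i)
    {a b : ArchVertex ι} (hab : ArchEdge up π a b) {p : Pt}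
    (hp : p ∈ segment ℝ (archPos x h a) (archPos x h b)) :
    (∃ i, (a = bot i ∧ b = low i ∨ a = low i ∧ b = bot i) ∧ p.1 = x i ∧ p.2.2 = 0) ∨
    (∃ i, (a = low i ∧ b = top i ∨ a = top i ∧ b = low i) ∧ p.1 = x i ∧ p.2.1 = h i) ∨
    (∃ i, (a = top i ∧ b = top (π i)) ∧ min (x i) (x (π i)) ≤ p.1 ∧ p.1 ≤ max (x i) (x (π i)) ∧
      p.2.1 = h i ∧ p.2.2 = 1) := by
  obtain ⟨s, t, hs, ht, hst, rfl⟩ := hp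
  obtain rfl : s = 1 - t := by linarith
  rcases hab with ⟨i, hi⟩ | ⟨i, hi⟩ | ⟨i, hi⟩ | ⟨i, hi⟩ | ⟨i, hi⟩
  · refine Or.inl ⟨i, by simp, ?_, ?_⟩ <;> simp [archPos]; ring
  · refine Or.inr (Or.inl ⟨i, by simp, ?_, ?_⟩) <;> simp [archPos] <;> ring
  · refine Or.inr (Or.inr ⟨i, by simp, ?_, ?_, ?_, ?_⟩)
    · simp only [archPos, Prod.smul_mk, Prod.mk_add_mk, smul_eq_mul]
      nlinarith [min_le_left (x i) (x (π i)), min_le_right (x i) (x (π i))]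
    · simp only [archPos, Prod.smul_mk, Prod.mk_add_mk, smul_eq_mul]
      nlinarith [le_max_left (x i) (x (π i)), le_max_right (x i) (x (π i))]
    · simp [archPos, hπ]; ring
    · simp [archPos]
  · refine Or.inr (Or.inl ⟨i, by simp, ?_, ?_⟩) <;> simp [archPos] <;> ring
  · refine Or.inl ⟨i, by simp, ?_, ?_⟩ <;> simp [archPos]; ring

/-- Vertical edges have `z = 0` and arches have `z = 1`, so they never meet. Vertical edges and
steps of different strands have different abscissas. A step or an arch meets another arch only at
the same height, where `sep` leaves only the two strands of that arch. -/
theorem IsSeparated.isEmbedded (hπ : IsPairing up π) {x h : ι → ℝ} (hs : IsSeparated π x h)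
    (k : ℕ) : IsEmbedded (some k) (ArchEdge up π) IsFoot (archPos x h) where
  inj := by
    rintro (i | i | i) (j | j | j) hij <;>
      simp only [archPos, Prod.mk.injEq, hs.inj.eq_iff, (hs.pos _).ne', (hs.pos _).ne,
        zero_ne_one, one_ne_zero, and_false, false_and] at hij <;> rw [hij.1]
  disj := by
    intro a b c d hab hcd n1 n2 n3 n4
    rw [Set.disjoint_left]
    intro p hp hp'
    have hvz : ∀ i j : ι, p.1 = x i → p.1 = x j → i = j := fun i j h1 h2 =>
      hs.inj (h1.symm.trans h2)
    have hzr : ∀ i j : ι, p.1 = x i → p.2.1 = h i → min (x j) (x (π j)) ≤ p.1 →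
        p.1 ≤ max (x j) (x (π j)) → p.2.1 = h j → i = j ∨ i = π j := by
      intro i j h1 h2 h3 h4 h5
      by_contra! hne
      rcases hs.sep j i hne.1 hne.2 (h5.symm.trans h2) with h6 | h6
      · have := min_le_left (x i) (x (π i)); linarith
      · have := le_max_left (x i) (x (π i)); linarith
    rcases hab.mem_segment hs.height hp with ⟨i, h1, h2, h3⟩ | ⟨i, h1, h2, h3⟩ |
      ⟨i, h1, h2, h3, h4, h5⟩ <;>
    rcases hcd.mem_segment hs.height hp' with ⟨j, g1, g2, g3⟩ | ⟨j, g1, g2, g3⟩ |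
      ⟨j, g1, g2, g3, g4, g5⟩
    · obtain rfl := hvz i j h2 g2
      rcases h1 with ⟨rfl, rfl⟩ | ⟨rfl, rfl⟩ <;> rcases g1 with ⟨rfl, rfl⟩ | ⟨rfl, rfl⟩ <;>
        first | exact n1 rfl | exact n2 rfl
    · obtain rfl := hvz i j h2 g2
      rcases h1 with ⟨rfl, rfl⟩ | ⟨rfl, rfl⟩ <;> rcases g1 with ⟨rfl, rfl⟩ | ⟨rfl, rfl⟩ <;>
        first | exact n1 rfl | exact n2 rfl | exact n3 rfl | exact n4 rfl
    · linarith
    · obtain rfl := hvz i j h2 g2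
      rcases h1 with ⟨rfl, rfl⟩ | ⟨rfl, rfl⟩ <;> rcases g1 with ⟨rfl, rfl⟩ | ⟨rfl, rfl⟩ <;>
        first | exact n1 rfl | exact n2 rfl | exact n3 rfl | exact n4 rfl
    · obtain rfl := hvz i j h2 g2
      rcases h1 with ⟨rfl, rfl⟩ | ⟨rfl, rfl⟩ <;> rcases g1 with ⟨rfl, rfl⟩ | ⟨rfl, rfl⟩ <;>
        first | exact n1 rfl | exact n2 rfl
    · obtain ⟨rfl, rfl⟩ := g1
      rcases hzr i j h2 h3 g2 g3 g4 with rfl | rfl <;>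
        rcases h1 with ⟨rfl, rfl⟩ | ⟨rfl, rfl⟩ <;>
          first | exact n1 rfl | exact n2 rfl | exact n3 rfl | exact n4 rfl
    · linarith
    · obtain ⟨rfl, rfl⟩ := h1
      rcases hzr j i g2 g3 h2 h3 h4 with rfl | rfl <;>
        rcases g1 with ⟨rfl, rfl⟩ | ⟨rfl, rfl⟩ <;>
          first | exact n1 rfl | exact n2 rfl | exact n3 rfl | exact n4 rfl
    · obtain ⟨rfl, rfl⟩ := h1
      obtain ⟨rfl, rfl⟩ := g1
      rcases hs.sep i j (by rintro rfl; simp at n1) (by rintro rfl; simp at n3)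
        (h4.symm.trans g4) with h6 | h6 <;> linarith
  ray := by
    intro a b c hab hbc
    rcases hab with ⟨i, hi⟩ | ⟨i, hi⟩ | ⟨i, hi⟩ | ⟨i, hi⟩ | ⟨i, hi⟩
    · cases hbc with
      | zup _ _ =>
        refine not_sameRay_of_mul_ne coordY coordZ ?_
        simp [archPos, (hs.pos i).ne']
      | vdown _ hi' => simp [hi] at hi'
    · cases hbc with
      | row _ _ =>
        refine not_sameRay_of_mul_ne coordZ coordX ?_
        have : π i ≠ i := fun he => by
          have := hπ.up_partner i
          rw [he] at this
          simp at this
        simp [archPos, sub_eq_zero, hs.inj.eq_iff, Ne.symm this]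
      | zdown _ hi' => simp [hi] at hi'
    · have hne : π i ≠ i := fun he => by
        have := hπ.up_partner i
        rw [he] at this
        simp at this
      have hup := hπ.up_partner i
      generalize π i = j at *
      cases hbc with
      | row _ hi' => simp [hi, hi'] at hup
      | zdown _ hi' =>
        refine not_sameRay_of_mul_ne coordX coordZ ?_
        simp [archPos, sub_eq_zero, hs.inj.eq_iff, hne]
    · cases hbc with
      | zup _ hi' => simp [hi] at hi'
      | vdown _ _ =>
        refine not_sameRay_of_mul_ne coordZ coordY ?_
        simp [archPos, (hs.pos i).ne']
    · cases hbc with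
      | vup _ hi' => simp [hi] at hi'
  bdry := by
    rintro (i | i | i) hi
    · rfl
    · exact hi.elim
    · exact hi.elim
  pos := by
    rintro - (i | i | i) hi
    · exact absurd trivial hi
    · exact hs.pos i
    · exact hs.pos i

/-- Two arch diagrams with the same combinatorics are isotopic if they are separated all along the
straight line between them. -/
theorem isotopic_arch (hπ : IsPairing up π) [Finite ι] (x h : ℝ → ι → ℝ)
    (hx : ∀ i, Continuous fun t => x t i) (hh : ∀ i, Continuous fun t => h t i)
    (hs : ∀ t ∈ Set.Icc (0 : ℝ) 1, IsSeparated π (x t) (h t)) :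
    KindIsotopic (some (Nat.card ι)) (polySet (ArchEdge up π) (archPos (x 0) (h 0)))
      (polySet (ArchEdge up π) (archPos (x 1) (h 1))) := by
  classical
  have : Fintype (ArchVertex ι) := Fintype.ofFinite _
  exact isotopic_of_family hπ.isPattern (fun t => archPos (x t) (h t))
    (continuous_archPos hx hh) fun t ht => (hs t ht).isEmbedded hπ _

end

end ThompsonLink

namespace ThompsonLink

open ArchVertex

/-! ## Gluing two arch diagrams -/

/-- Translation in the direction of `y`. -/
def raiseMap (c : ℝ) : Pt →ᵃ[ℝ] Pt :=
  (LinearMap.id : Pt →ₗ[ℝ] Pt).toAffineMap + AffineMap.const ℝ Pt (0, c, 0)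

/-- Reflection in the direction of `y`. -/
def mirrorMap (c : ℝ) : Pt →ᵃ[ℝ] Pt :=
  (LinearMap.prodMap (LinearMap.id : ℝ →ₗ[ℝ] ℝ)
    (LinearMap.prodMap (-LinearMap.id : ℝ →ₗ[ℝ] ℝ) (LinearMap.id : ℝ →ₗ[ℝ] ℝ))).toAffineMap +
    AffineMap.const ℝ Pt (0, c, 0)

@[simp] theorem raiseMap_apply (c : ℝ) (p : Pt) : raiseMap c p = (p.1, p.2.1 + c, p.2.2) := by
  simp [raiseMap, Prod.ext_iff]

@[simp] theorem mirrorMap_apply (c : ℝ) (p : Pt) : mirrorMap c p = (p.1, c - p.2.1, p.2.2) := by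
  simp [mirrorMap, Prod.ext_iff]
  ring

theorem raiseMap_injective (c : ℝ) : Function.Injective (raiseMap c) := by
  intro p q h
  simpa [Prod.ext_iff] using h

theorem mirrorMap_injective (c : ℝ) : Function.Injective (mirrorMap c) := by
  intro p q h
  simpa [Prod.ext_iff] using h

section

variable {κ : Option ℕ} {V : Type*} {E : V → V → Prop} {B : V → Prop} {f : V → Pt}

/-- Every vertex is an end of some edge, and different edges meet only in common vertices. -/
theorem IsEmbedded.vertex_mem (hP : IsPattern κ E B) (hf : IsEmbedded κ E B f) {a b v : V}
    (hab : E a b) (hv : f v ∈ segment ℝ (f a) (f b)) : v = a ∨ v = b := by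
  by_contra! hne
  rcases hP.incident v with ⟨w, h⟩ | ⟨w, h⟩
  · rcases hf.inter hP h hab hne.1 (left_mem_segment ℝ _ _) hv with h1 | h1
    · obtain rfl := hf.inj h1.1
      exact hf.irrefl _ h
    · exact hne.2 h1.2
  · have hwa : w ≠ a := by
      rintro rfl
      exact hne.2 (hP.out_unique h hab)
    rcases hf.inter hP h hab hwa (right_mem_segment ℝ _ _) hv with h1 | h1
    · exact hne.1 h1.2
    · obtain rfl := hf.inj h1.1
      exact hf.irrefl _ h

theorem not_sameRay_map {ψ : Pt →ᵃ[ℝ] Pt} (hψ : Function.Injective ψ) {a b c : Pt}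
    (h : ¬ SameRay ℝ (a - b) (c - b)) : ¬ SameRay ℝ (ψ a - ψ b) (ψ c - ψ b) := by
  have h1 : Function.Injective ψ.linear := (AffineMap.linear_injective_iff _).2 hψ
  have h2 : ∀ p q, ψ p - ψ q = ψ.linear (p - q) := fun p q => (ψ.linearMap_vsub p q).symm
  rw [h2, h2]
  rintro (h3 | h3 | ⟨r, s, hr, hs, h3⟩)
  · exact h (Or.inl (h1 (by rw [h3, map_zero])))
  · exact h (Or.inr (Or.inl (h1 (by rw [h3, map_zero]))))
  · refine h (Or.inr (Or.inr ⟨r, s, hr, hs, h1 ?_⟩))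
    rw [map_smul, map_smul, h3]

end

/-- The directed edges of the link that is obtained by gluing an arch diagram and the mirror image,
with reversed orientation, of another one along straight connecting lines. -/
inductive GlueEdge {ι ι' : Type*} (up : ι → Bool) (π : ι → ι) (up' : ι' → Bool) (π' : ι' → ι')
    (β : ι ≃ ι') : ArchVertex ι ⊕ ArchVertex ι' → ArchVertex ι ⊕ ArchVertex ι' → Prop
  | upper (a b) : ArchEdge up π a b → GlueEdge up π up' π' β (Sum.inl a) (Sum.inl b)
  | lower (a b) : ArchEdge up' π' a b → GlueEdge up π up' π' β (Sum.inr b) (Sum.inr a)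
  | cup (i) : up i = true → GlueEdge up π up' π' β (Sum.inr (bot (β i))) (Sum.inl (bot i))
  | cdown (i) : up i = false → GlueEdge up π up' π' β (Sum.inl (bot i)) (Sum.inr (bot (β i)))

/-- The positions of the vertices of two glued arch diagrams, the first one above `y = c` and the
second one below `y = d`. -/
def gluePos {V V' : Type*} (c d : ℝ) (f : V → Pt) (f' : V' → Pt) : V ⊕ V' → Pt
  | Sum.inl v => raiseMap c (f v)
  | Sum.inr v => mirrorMap d (f' v)

theorem continuous_gluePos {V V' T : Type*} [TopologicalSpace T] {c d : T → ℝ} {f : T → V → Pt}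
    {f' : T → V' → Pt} (hc : Continuous c) (hd : Continuous d) (hf : Continuous f)
    (hf' : Continuous f') : Continuous fun t => gluePos (c t) (d t) (f t) (f' t) := by
  refine continuous_pi ?_
  rintro (v | v)
  · have : Continuous fun t => f t v := (continuous_apply v).comp hf
    simp only [gluePos, raiseMap_apply]
    fun_prop
  · have : Continuous fun t => f' t v := (continuous_apply v).comp hf'
    simp only [gluePos, mirrorMap_apply]
    fun_prop

section

variable {ι ι' : Type*} {up : ι → Bool} {π : ι → ι} {up' : ι' → Bool} {π' : ι' → ι'} {β : ι ≃ ι'}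

/-- A foot lies on one vertical edge and one connecting line. The reversal of the lower diagram and
the agreement of the directions under `β` make one of the two incoming and the other outgoing. -/
theorem isPattern_glue [Finite ι] [Finite ι'] (hπ : IsPairing up π) (hπ' : IsPairing up' π')
    (hβ : ∀ i, up' (β i) = up i) : IsPattern none (GlueEdge up π up' π' β) fun _ => False where
  out_unique := by
    rintro v w w' (⟨a, b, h⟩ | ⟨a, b, h⟩ | ⟨i, hi⟩ | ⟨i, hi⟩) h'
    · cases h' with
      | upper _ _ h' => rw [hπ.isPattern.out_unique h h']
      | cdown i hi =>
        cases h
        simp_all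
    · cases h' with
      | lower _ _ h' => rw [hπ'.isPattern.in_unique h h']
      | cup i hi =>
        generalize hj : bot (β i) = j at h
        cases h with
        | vdown k hk =>
          obtain rfl : β i = k := by simpa using hj
          simp_all
        | _ => simp_all
    · generalize hj : Sum.inr (bot (β i)) = j at h'
      cases h' with
      | upper => simp_all
      | lower a b h =>
        obtain rfl : bot (β i) = b := by simpa using hj
        cases h
        simp_all
      | cup k hk => simp_all
      | cdown => simp_all
    · cases h' with
      | upper _ _ h =>
        cases h
        simp_all
      | cdown => rfl
  in_unique := by
    rintro v v' w (⟨a, b, h⟩ | ⟨a, b, h⟩ | ⟨i, hi⟩ | ⟨i, hi⟩) h'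
    · cases h' with
      | upper _ _ h' => rw [hπ.isPattern.in_unique h h']
      | cup i hi =>
        generalize hj : bot i = j at h
        cases h with
        | vdown k hk =>
          obtain rfl : i = k := by simpa using hj
          simp_all
        | _ => simp_all
    · cases h' with
      | lower _ _ h' => rw [hπ'.isPattern.out_unique h h']
      | cdown i hi =>
        generalize hj : bot (β i) = j at h
        cases h with
        | vup k hk =>
          obtain rfl : β i = k := by simpa using hj
          simp_all
        | _ => simp_all
    · cases h' with
      | upper _ _ h =>
        cases h
        simp_all
      | cup => rfl
    · generalize hj : Sum.inr (bot (β i)) = j at h'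
      cases h' with
      | upper => simp_all
      | lower a b h =>
        obtain rfl : bot (β i) = a := by simpa using hj
        cases h
        simp_all
      | cup k hk => simp_all
      | cdown => simp_all
  next := by
    rintro v w (⟨a, b, h⟩ | ⟨a, b, h⟩ | ⟨i, hi⟩ | ⟨i, hi⟩) <;>
      refine iff_of_true not_false ?_
    · by_cases hb : b.IsFoot
      · cases h with
        | vdown i hi => exact ⟨_, .cdown i hi⟩
        | _ => exact hb.elim
      · obtain ⟨u, hu⟩ := (hπ.isPattern.next h).1 hb
        exact ⟨_, .upper _ _ hu⟩
    · by_cases ha : a.IsFoot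
      · cases h with
        | vup i hi =>
          refine ⟨Sum.inl (bot (β.symm i)), ?_⟩
          have := GlueEdge.cup (up := up) (π := π) (up' := up') (π' := π') (β := β) (β.symm i)
            (by rw [← hβ, β.apply_symm_apply, hi])
          rwa [β.apply_symm_apply] at this
        | _ => exact ha.elim
      · obtain ⟨u, hu⟩ := (hπ'.isPattern.prev h).1 ha
        exact ⟨_, .lower _ _ hu⟩
    · exact ⟨_, .upper _ _ (.vup i hi)⟩
    · exact ⟨_, .lower _ _ (.vdown (β i) (by rw [hβ, hi]))⟩
  prev := by
    rintro v w (⟨a, b, h⟩ | ⟨a, b, h⟩ | ⟨i, hi⟩ | ⟨i, hi⟩) <;>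
      refine iff_of_true not_false ?_
    · by_cases ha : a.IsFoot
      · cases h with
        | vup i hi => exact ⟨_, .cup i hi⟩
        | _ => exact ha.elim
      · obtain ⟨u, hu⟩ := (hπ.isPattern.prev h).1 ha
        exact ⟨_, .upper _ _ hu⟩
    · by_cases hb : b.IsFoot
      · cases h with
        | vdown i hi =>
          refine ⟨Sum.inl (bot (β.symm i)), ?_⟩
          have := GlueEdge.cdown (up := up) (π := π) (up' := up') (π' := π') (β := β) (β.symm i)
            (by rw [← hβ, β.apply_symm_apply, hi])
          rwa [β.apply_symm_apply] at this
        | _ => exact hb.elim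
      · obtain ⟨u, hu⟩ := (hπ'.isPattern.next h).1 hb
        exact ⟨_, .lower _ _ hu⟩
    · exact ⟨_, .lower _ _ (.vup (β i) (by rw [hβ, hi]))⟩
    · exact ⟨_, .upper _ _ (.vdown i hi)⟩
  not_both := by simp
  incident := by
    rintro (v | v)
    · rcases hπ.isPattern.incident v with ⟨w, h⟩ | ⟨w, h⟩
      · exact Or.inl ⟨_, .upper _ _ h⟩
      · exact Or.inr ⟨_, .upper _ _ h⟩
    · rcases hπ'.isPattern.incident v with ⟨w, h⟩ | ⟨w, h⟩
      · exact Or.inr ⟨_, .lower _ _ h⟩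
      · exact Or.inl ⟨_, .lower _ _ h⟩
  no_boundary := by simp
  card_boundary := by simp

theorem IsSeparated.archPos_nonneg {x h : ι → ℝ} (hs : IsSeparated π x h) (v : ArchVertex ι) :
    0 ≤ (archPos x h v).2.1 := by
  rcases v with i | i | i
  · exact le_rfl
  · exact (hs.pos i).le
  · exact (hs.pos i).le

theorem segment_y_nonneg {a b p : Pt} (ha : 0 ≤ a.2.1) (hb : 0 ≤ b.2.1)
    (hp : p ∈ segment ℝ a b) : 0 ≤ p.2.1 := by
  obtain ⟨s, t, hs, ht, -, rfl⟩ := hp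
  have := mul_nonneg hs ha
  have := mul_nonneg ht hb
  simp only [Prod.snd_add, Prod.smul_snd, Prod.fst_add, Prod.smul_fst, smul_eq_mul]
  linarith

/-- A strict inequality at both ends of a linear interpolation holds throughout; all interpolation
arguments use it in this form. -/
theorem convex_comb_pos {a b t : ℝ} (ha : 0 < a) (hb : 0 < b) (h0 : 0 ≤ t) (h1 : t ≤ 1) :
    0 < (1 - t) * a + t * b := by
  rcases h0.eq_or_lt with rfl | h0
  · simpa using ha
  · have := mul_pos h0 hb
    have := mul_nonneg (sub_nonneg.2 h1) ha.le
    linarith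

/-- The points of the edges of two glued arch diagrams. -/
theorem GlueEdge.mem_segment {c d : ℝ} {x h : ι → ℝ} {x' h' : ι' → ℝ}
    {a b : ArchVertex ι ⊕ ArchVertex ι'} (hab : GlueEdge up π up' π' β a b) {p : Pt}
    (hp : p ∈ segment ℝ (gluePos c d (archPos x h) (archPos x' h') a)
      (gluePos c d (archPos x h) (archPos x' h') b)) :
    (∃ v w, a = Sum.inl v ∧ b = Sum.inl w ∧ ArchEdge up π v w ∧
      ∃ q ∈ segment ℝ (archPos x h v) (archPos x h w), p = raiseMap c q) ∨
    (∃ v w, a = Sum.inr w ∧ b = Sum.inr v ∧ ArchEdge up' π' v w ∧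
      ∃ q ∈ segment ℝ (archPos x' h' v) (archPos x' h' w), p = mirrorMap d q) ∨
    (∃ i, (a = Sum.inl (bot i) ∧ b = Sum.inr (bot (β i)) ∨
        a = Sum.inr (bot (β i)) ∧ b = Sum.inl (bot i)) ∧
      ∃ t, 0 ≤ t ∧ t ≤ 1 ∧ p = ((1 - t) * x' (β i) + t * x i, (1 - t) * d + t * c, 0)) := by
  rcases hab with ⟨v, w, h⟩ | ⟨v, w, h⟩ | ⟨i, hi⟩ | ⟨i, hi⟩
  · rw [gluePos, gluePos, ← image_segment] at hp
    obtain ⟨q, hq, rfl⟩ := hp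
    exact Or.inl ⟨v, w, rfl, rfl, h, q, hq, rfl⟩
  · rw [gluePos, gluePos, ← image_segment, segment_symm] at hp
    obtain ⟨q, hq, rfl⟩ := hp
    exact Or.inr (Or.inl ⟨v, w, rfl, rfl, h, q, hq, rfl⟩)
  · obtain ⟨s, t, hs, ht, hst, rfl⟩ := hp
    refine Or.inr (Or.inr ⟨i, Or.inr ⟨rfl, rfl⟩, t, ht, by linarith, ?_⟩)
    obtain rfl : s = 1 - t := by linarith
    simp [gluePos, archPos]
  · obtain ⟨s, t, hs, ht, hst, rfl⟩ := hp
    refine Or.inr (Or.inr ⟨i, Or.inl ⟨rfl, rfl⟩, s, hs, by linarith, ?_⟩)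
    obtain rfl : t = 1 - s := by linarith
    simp [gluePos, archPos]
    constructor <;> ring

/-- The two diagrams lie in `y ≥ c` and `y ≤ d`, and the connecting lines lie in between and touch
them only at the feet. Connecting lines do not cross because `β` preserves the order of the
abscissas. -/
theorem isEmbedded_glue [Finite ι] [Finite ι'] (hπ : IsPairing up π) (hπ' : IsPairing up' π')
    {x h : ι → ℝ} {x' h' : ι' → ℝ} (hs : IsSeparated π x h) (hs' : IsSeparated π' x' h')
    (hx : ∀ i j, x i < x j → x' (β i) < x' (β j)) {c d : ℝ} (hdc : d < c) :
    IsEmbedded none (GlueEdge up π up' π' β) (fun _ => False)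
      (gluePos c d (archPos x h) (archPos x' h')) := by
  have e := hs.isEmbedded hπ (Nat.card ι)
  have e' := hs'.isEmbedded hπ' (Nat.card ι')
  have hn := hs.archPos_nonneg
  have hn' := hs'.archPos_nonneg
  refine ⟨?_, ?_, ?_, fun _ h => h.elim, fun h => absurd rfl h⟩
  · rintro (v | v) (w | w) hvw
    · rw [e.inj (raiseMap_injective c hvw)]
    · have := congrArg (fun p : Pt => p.2.1) hvw
      simp only [gluePos, raiseMap_apply, mirrorMap_apply] at this
      linarith [hn v, hn' w]
    · have := congrArg (fun p : Pt => p.2.1) hvw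
      simp only [gluePos, raiseMap_apply, mirrorMap_apply] at this
      linarith [hn w, hn' v]
    · rw [e'.inj (mirrorMap_injective d hvw)]
  · -- disjointness of non-adjacent edges
    have upper_conn : ∀ v w i, ArchEdge up π v w → ∀ q ∈ segment ℝ (archPos x h v) (archPos x h w),
        ∀ t, t ≤ 1 → raiseMap c q = ((1 - t) * x' (β i) + t * x i, (1 - t) * d + t * c, 0) →
        bot i = v ∨ bot i = w := by
      intro v w i hvw q hq t ht heq
      have hq0 := segment_y_nonneg (hn v) (hn w) hq
      simp only [raiseMap_apply, Prod.mk.injEq] at heq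
      have ht1 : t = 1 := by nlinarith
      subst ht1
      have : q = archPos x h (bot i) := by
        refine Prod.ext ?_ (Prod.ext ?_ ?_)
        · simp [archPos, heq.1]
        · simp [archPos]; linarith
        · simp [archPos, heq.2.2]
      exact e.vertex_mem hπ.isPattern hvw (this ▸ hq)
    have lower_conn : ∀ v w i, ArchEdge up' π' v w →
        ∀ q ∈ segment ℝ (archPos x' h' v) (archPos x' h' w),
        ∀ t, 0 ≤ t → mirrorMap d q = ((1 - t) * x' (β i) + t * x i, (1 - t) * d + t * c, 0) →
        bot (β i) = v ∨ bot (β i) = w := by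
      intro v w i hvw q hq t ht heq
      have hq0 := segment_y_nonneg (hn' v) (hn' w) hq
      simp only [mirrorMap_apply, Prod.mk.injEq] at heq
      have ht1 : t = 0 := by nlinarith
      subst ht1
      have : q = archPos x' h' (bot (β i)) := by
        refine Prod.ext ?_ (Prod.ext ?_ ?_)
        · simp [archPos, heq.1]
        · simp [archPos]; linarith
        · simp [archPos, heq.2.2]
      exact e'.vertex_mem hπ'.isPattern hvw (this ▸ hq)
    intro a b a' b' hab hab' n1 n2 n3 n4
    rw [Set.disjoint_left]
    intro p hp hp'
    rcases hab.mem_segment hp with ⟨v, w, rfl, rfl, hvw, q, hq, hpq⟩ |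
      ⟨v, w, rfl, rfl, hvw, q, hq, hpq⟩ | ⟨i, hi, t, ht0, ht1, hpq⟩ <;>
    rcases hab'.mem_segment hp' with ⟨v', w', rfl, rfl, hvw', q', hq', hpq'⟩ |
      ⟨v', w', rfl, rfl, hvw', q', hq', hpq'⟩ | ⟨j, hj, s, hs0, hs1, hpq'⟩
    · obtain rfl := raiseMap_injective c (hpq.symm.trans hpq')
      exact Set.disjoint_left.1 (e.disj _ _ _ _ hvw hvw' (by simpa using n1) (by simpa using n2)
        (by simpa using n3) (by simpa using n4)) hq hq'
    · have := congrArg (fun p : Pt => p.2.1) (hpq.symm.trans hpq')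
      simp only [raiseMap_apply, mirrorMap_apply] at this
      linarith [segment_y_nonneg (hn v) (hn w) hq, segment_y_nonneg (hn' v') (hn' w') hq']
    · rcases upper_conn v w j hvw q hq s hs1 (hpq.symm.trans hpq') with rfl | rfl <;>
        rcases hj with ⟨rfl, rfl⟩ | ⟨rfl, rfl⟩ <;>
        first | exact n1 rfl | exact n2 rfl | exact n3 rfl | exact n4 rfl
    · have := congrArg (fun p : Pt => p.2.1) (hpq.symm.trans hpq')
      simp only [raiseMap_apply, mirrorMap_apply] at this
      linarith [segment_y_nonneg (hn' v) (hn' w) hq, segment_y_nonneg (hn v') (hn w') hq']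
    · obtain rfl := mirrorMap_injective d (hpq.symm.trans hpq')
      exact Set.disjoint_left.1 (e'.disj _ _ _ _ hvw hvw' (by simpa using n4)
        (by simpa using n3) (by simpa using n2) (by simpa using n1)) hq hq'
    · rcases lower_conn v w j hvw q hq s hs0 (hpq.symm.trans hpq') with rfl | rfl <;>
        rcases hj with ⟨rfl, rfl⟩ | ⟨rfl, rfl⟩ <;>
        first | exact n1 rfl | exact n2 rfl | exact n3 rfl | exact n4 rfl
    · rcases upper_conn v' w' i hvw' q' hq' t ht1 (hpq'.symm.trans hpq) with rfl | rfl <;>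
        rcases hi with ⟨rfl, rfl⟩ | ⟨rfl, rfl⟩ <;>
        first | exact n1 rfl | exact n2 rfl | exact n3 rfl | exact n4 rfl
    · rcases lower_conn v' w' i hvw' q' hq' t ht0 (hpq'.symm.trans hpq) with rfl | rfl <;>
        rcases hi with ⟨rfl, rfl⟩ | ⟨rfl, rfl⟩ <;>
        first | exact n1 rfl | exact n2 rfl | exact n3 rfl | exact n4 rfl
    · have heq := hpq.symm.trans hpq'
      simp only [Prod.mk.injEq] at heq
      have hts : t = s := by
        have h1 : (t - s) * (c - d) = 0 := by linarith [heq.2.1]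
        rcases mul_eq_zero.1 h1 with h2 | h2 <;> linarith
      subst hts
      have hij : i = j := by
        by_contra hij
        rcases lt_or_gt_of_ne (hs.inj.ne hij) with hlt | hlt
        · have := hx i j hlt
          have h1 : (1 - t) * (x' (β j) - x' (β i)) + t * (x j - x i) = 0 := by linarith [heq.1]
          exact (convex_comb_pos (sub_pos.2 this) (sub_pos.2 hlt) ht0 ht1).ne' h1
        · have := hx j i hlt
          have h1 : (1 - t) * (x' (β i) - x' (β j)) + t * (x i - x j) = 0 := by linarith [heq.1]
          exact (convex_comb_pos (sub_pos.2 this) (sub_pos.2 hlt) ht0 ht1).ne' h1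
      subst hij
      rcases hi with ⟨rfl, rfl⟩ | ⟨rfl, rfl⟩ <;> rcases hj with ⟨rfl, rfl⟩ | ⟨rfl, rfl⟩ <;>
        first | exact n1 rfl | exact n2 rfl
  · rintro v w u (⟨a, b, hab⟩ | ⟨a, b, hab⟩ | ⟨i, hi⟩ | ⟨i, hi⟩) h2
    · cases h2 with
      | upper _ _ h2 => exact not_sameRay_map (raiseMap_injective c) (e.ray _ _ _ hab h2)
      | cdown i hi =>
        cases hab
        -- At a foot, the vertical edge and the connecting line leave to opposite sides in the
        -- direction of `y`.
        refine not_sameRay_of_mul_neg coordY ?_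
        simp only [gluePos, archPos, raiseMap_apply, mirrorMap_apply, coordY_apply, Prod.snd_sub,
          Prod.fst_sub]
        have := hs.pos i
        nlinarith
    · cases h2 with
      | lower _ _ h2 =>
        refine not_sameRay_map (mirrorMap_injective d) ?_
        exact fun h3 => e'.ray _ _ _ h2 hab h3.symm
      | cup i hi =>
        generalize hj : bot (β i) = j at hab
        cases hab with
        | vup k hk =>
          obtain rfl : β i = k := by simpa using hj
          refine not_sameRay_of_mul_neg coordY ?_
          simp only [gluePos, archPos, raiseMap_apply, mirrorMap_apply, coordY_apply, Prod.snd_sub,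
            Prod.fst_sub]
          have := hs'.pos (β i)
          nlinarith
        | _ => simp_all
    · cases h2 with
      | upper _ _ h2 =>
        cases h2
        refine not_sameRay_of_mul_neg coordY ?_
        simp only [gluePos, archPos, raiseMap_apply, mirrorMap_apply, coordY_apply, Prod.snd_sub,
          Prod.fst_sub]
        have := hs.pos i
        nlinarith
      | cdown _ hi' => simp [hi] at hi'
    · generalize hj : Sum.inr (bot (β i)) = j at h2
      cases h2 with
      | upper => simp_all
      | lower a b h2 =>
        obtain rfl : bot (β i) = b := by simpa using hj
        cases h2
        refine not_sameRay_of_mul_neg coordY ?_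
        simp only [gluePos, archPos, raiseMap_apply, mirrorMap_apply, coordY_apply, Prod.snd_sub,
          Prod.fst_sub]
        have := hs'.pos (β i)
        nlinarith
      | cup k hk =>
        obtain rfl : i = k := by simpa using hj
        simp [hi] at hk
      | cdown => simp_all

end

end ThompsonLink

namespace ThompsonLink

/-! ## Standard dyadic intervals -/

namespace SDInterval

theorem right_eq (A : SDInterval) : A.right = A.left + A.length := by
  simp only [left, right, length]; ring

theorem length_pos (A : SDInterval) : 0 < A.length := by
  simp only [length]; positivity

theorem mid_eq (A : SDInterval) : A.mid = A.left + A.length / 2 := by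
  rw [mid, right_eq]; ring

theorem left_lt_mid (A : SDInterval) : A.left < A.mid := by
  have := A.length_pos
  rw [mid_eq]; linarith

theorem mid_lt_right (A : SDInterval) : A.mid < A.right := by
  have := A.length_pos
  rw [mid_eq, right_eq]; linarith

theorem left_lt_right (A : SDInterval) : A.left < A.right := A.left_lt_mid.trans A.mid_lt_right

theorem left_nonneg (A : SDInterval) : 0 ≤ A.left := by
  simp only [left]; positivity

theorem right_le_one (A : SDInterval) : A.right ≤ 1 := by
  have h : A.idx + 1 ≤ 2 ^ A.lvl := A.idx_lt
  have h' : ((A.idx : ℝ) + 1) ≤ 2 ^ A.lvl := by exact_mod_cast h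
  rw [right, div_le_one (by positivity)]
  exact h'

theorem length_lt_iff {A B : SDInterval} : A.length < B.length ↔ B.lvl < A.lvl := by
  rw [length, length, one_div_lt_one_div (by positivity) (by positivity),
    pow_lt_pow_iff_right₀ (by norm_num)]

theorem length_le_iff {A B : SDInterval} : A.length ≤ B.length ↔ B.lvl ≤ A.lvl := by
  rw [← not_lt, length_lt_iff, not_lt]

theorem length_eq_iff {A B : SDInterval} : A.length = B.length ↔ A.lvl = B.lvl := by
  rw [le_antisymm_iff, length_le_iff, length_le_iff, le_antisymm_iff, and_comm]

theorem eq_of_left_of_lvl {A B : SDInterval} (h : A.left = B.left) (hl : A.lvl = B.lvl) :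
    A = B := by
  refine SDInterval.ext hl ?_
  rw [left, left, hl, div_left_inj' (by positivity)] at h
  exact_mod_cast h

theorem eq_of_left_of_right {A B : SDInterval} (h : A.left = B.left) (h' : A.right = B.right) :
    A = B := by
  refine eq_of_left_of_lvl h (length_eq_iff.1 ?_)
  rw [right_eq, right_eq] at h'
  linarith

/-- Two standard dyadic intervals are nested or have disjoint interiors. -/
theorem nested_or_disjoint {A B : SDInterval} (h : A.lvl ≤ B.lvl) :
    B.right ≤ A.left ∨ A.right ≤ B.left ∨ (A.left ≤ B.left ∧ B.right ≤ A.right) := by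
  -- Over the common denominator `2 ^ B.lvl`, the interval `A` is a block of `2 ^ d` consecutive
  -- cells and `B` is a single cell.
  obtain ⟨d, hd⟩ := Nat.exists_eq_add_of_le h
  have hA : A.left = ((A.idx * 2 ^ d : ℕ) : ℝ) / 2 ^ B.lvl := by
    rw [left, hd, pow_add]; push_cast; field_simp
  have hA' : A.right = (((A.idx + 1) * 2 ^ d : ℕ) : ℝ) / 2 ^ B.lvl := by
    rw [right, hd, pow_add]; push_cast; field_simp
  have hB : B.right = ((B.idx + 1 : ℕ) : ℝ) / 2 ^ B.lvl := by
    rw [right]; push_cast; rfl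
  rw [hA, hA', hB, left]
  have key : ∀ a b : ℕ, a ≤ b → (a : ℝ) / 2 ^ B.lvl ≤ (b : ℝ) / 2 ^ B.lvl := by
    intro a b hab
    gcongr
  rcases lt_or_ge B.idx (A.idx * 2 ^ d) with h1 | h1
  · exact Or.inl (key _ _ h1)
  · rcases lt_or_ge B.idx ((A.idx + 1) * 2 ^ d) with h2 | h2
    · exact Or.inr (Or.inr ⟨key _ _ h1, key _ _ h2⟩)
    · exact Or.inr (Or.inl (key _ _ h2))

/-- The left half of an interval. -/
def leftHalf (A : SDInterval) : SDInterval where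
  lvl := A.lvl + 1
  idx := 2 * A.idx
  idx_lt := by
    have := A.idx_lt
    rw [pow_succ]; omega

theorem leftHalf_left (A : SDInterval) : A.leftHalf.left = A.left := by
  simp only [left, leftHalf, pow_succ]; push_cast; field_simp

theorem leftHalf_right (A : SDInterval) : A.leftHalf.right = A.mid := by
  simp only [left, right, mid, leftHalf, pow_succ]; push_cast; field_simp; ring

/-- The left half of `A` is still at least as long as `B`, so `B` lies on one side of its right end,
which is the midpoint of `A`. -/
theorem mid_not_interior {A B : SDInterval} (h : A.lvl < B.lvl) :
    B.right ≤ A.mid ∨ A.mid ≤ B.left := by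
  rcases nested_or_disjoint (A := A.leftHalf) (B := B) h with h1 | h1 | h1
  · rw [leftHalf_left] at h1
    exact Or.inl (h1.trans A.left_lt_mid.le)
  · rw [leftHalf_right] at h1
    exact Or.inr h1
  · rw [leftHalf_right] at h1
    exact Or.inl h1.2

/-- If the levels differed, the common midpoint would be interior to the shorter interval, contrary
to `mid_not_interior`. This puts different strands over different points. -/
theorem mid_injective {A B : SDInterval} (h : A.mid = B.mid) : A = B := by
  have key : ∀ A B : SDInterval, A.mid = B.mid → ¬ A.lvl < B.lvl := by
    intro A B h hl
    have h1 := B.left_lt_mid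
    have h2 := B.mid_lt_right
    rcases mid_not_interior hl with h3 | h3 <;> linarith
  have hl : A.lvl = B.lvl :=
    le_antisymm (not_lt.1 (key B A h.symm)) (not_lt.1 (key A B h))
  refine eq_of_left_of_lvl ?_ hl
  rw [mid_eq, mid_eq, length_eq_iff.2 hl] at h
  linarith

/-- The interval `[0, 1]`. -/
def root : SDInterval := ⟨0, 0, by simp⟩

theorem eq_root {A : SDInterval} (h : A.lvl = 0) : A = root := by
  refine SDInterval.ext h ?_
  have := A.idx_lt
  rw [h] at this
  simpa [root] using this

@[simp] theorem root_left : root.left = 0 := by simp [root, left]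
@[simp] theorem root_right : root.right = 1 := by simp [root, right]
@[simp] theorem root_length : root.length = 1 := by simp [root, length]
@[simp] theorem root_mid : root.mid = 1 / 2 := by simp [mid]

theorem length_conj (A : SDInterval) : A.conj.length = A.length := rfl

theorem parent_length {A : SDInterval} (h : A.lvl ≠ 0) : A.parent.length = 2 * A.length := by
  obtain ⟨l, hl⟩ := Nat.exists_eq_succ_of_ne_zero h
  simp only [length, parent, hl, Nat.succ_eq_add_one, Nat.add_sub_cancel, pow_succ]
  field_simp

theorem conj_conj (A : SDInterval) : A.conj.conj = A := by
  refine SDInterval.ext rfl ?_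
  simp only [conj]
  split_ifs <;> omega

theorem parent_conj (A : SDInterval) : A.conj.parent = A.parent := by
  refine SDInterval.ext rfl ?_
  by_cases h : A.lvl = 0
  · simp [parent, conj, h]
  · simp only [parent, conj, h, if_false]
    split_ifs <;> omega

/-- An interval other than `[0, 1]` is the left or the right half of its parent. -/
theorem half_cases {A : SDInterval} (h : A.lvl ≠ 0) :
    (A.left = A.parent.left ∧ A.right = A.parent.mid ∧ A.conj.left = A.parent.mid ∧
      A.conj.right = A.parent.right ∧ A.sign = A.parent.sign ∧ A.conj.sign = !A.parent.sign) ∨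
    (A.left = A.parent.mid ∧ A.right = A.parent.right ∧ A.conj.left = A.parent.left ∧
      A.conj.right = A.parent.mid ∧ A.sign = !A.parent.sign ∧ A.conj.sign = A.parent.sign) := by
  obtain ⟨l, hl⟩ := Nat.exists_eq_succ_of_ne_zero h
  rcases Nat.mod_two_eq_zero_or_one A.idx with h2 | h2
  · left
    obtain ⟨k, hk⟩ : ∃ k, A.idx = 2 * k := ⟨A.idx / 2, by omega⟩
    have h3 : (2 * k + 1) / 2 = k := by omega
    refine ⟨?_, ?_, ?_, ?_, ?_, ?_⟩ <;>
      simp [left, right, mid, parent, conj, sign, signAux, hl, hk, pow_succ, h3] <;> field_simp <;>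
      ring
  · right
    obtain ⟨k, hk⟩ : ∃ k, A.idx = 2 * k + 1 := ⟨A.idx / 2, by omega⟩
    have h3 : (2 * k + 1) / 2 = k := by omega
    have h4 : (2 * k + 1) % 2 = 1 := by omega
    refine ⟨?_, ?_, ?_, ?_, ?_, ?_⟩ <;>
      simp [left, right, mid, parent, conj, sign, signAux, hl, hk, pow_succ, h3, h4] <;>
      field_simp <;> ring

theorem sign_conj {A : SDInterval} (h : A.lvl ≠ 0) : A.conj.sign = !A.sign := by
  rcases half_cases h with h1 | h1
  · rw [h1.2.2.2.2.1, h1.2.2.2.2.2]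
  · rw [h1.2.2.2.2.1, h1.2.2.2.2.2, Bool.not_not]

@[simp] theorem sign_root : root.sign = true := rfl

theorem leLen_total (A B : SDInterval) : A.LeLen B ∨ B.LeLen A := by
  rcases lt_trichotomy A.length B.length with h | h | h
  · exact Or.inl (Or.inl h)
  · rcases le_total A.mid B.mid with h' | h'
    · exact Or.inl (Or.inr ⟨h, h'⟩)
    · exact Or.inr (Or.inr ⟨h.symm, h'⟩)
  · exact Or.inr (Or.inl h)

theorem leLen_trans {A B C : SDInterval} (h : A.LeLen B) (h' : B.LeLen C) : A.LeLen C := by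
  rcases h with h | ⟨h1, h2⟩ <;> rcases h' with h' | ⟨h3, h4⟩
  · exact Or.inl (h.trans h')
  · exact Or.inl (h3 ▸ h)
  · exact Or.inl (h1 ▸ h')
  · exact Or.inr ⟨h1.trans h3, le_trans h2 h4⟩

theorem leLen_antisymm {A B : SDInterval} (h : A.LeLen B) (h' : B.LeLen A) : A = B := by
  rcases h with h | ⟨h1, h2⟩ <;> rcases h' with h' | ⟨h3, h4⟩
  · exact absurd h' h.not_gt
  · exact absurd h3 h.ne'
  · exact absurd h1 h'.ne'
  · exact mid_injective (le_antisymm h2 h4)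

theorem leLen_refl (A : SDInterval) : A.LeLen A := Or.inr ⟨rfl, le_rfl⟩

theorem leLen_root (A : SDInterval) : A.LeLen root := by
  rcases Nat.eq_zero_or_pos A.lvl with h | h
  · rw [eq_root h]; exact leLen_refl _
  · exact Or.inl (length_lt_iff.2 h)

end SDInterval

/-! ## Signs of dyadic numbers -/

open SDPartition SDInterval

theorem signAux_eq_regionSign (m k : ℕ) : signAux m k = regionSign m k := by
  induction m generalizing k with
  | zero => rfl
  | succ m ih => simp only [signAux, regionSign, ih]

theorem sign_eq_edgeSign (A : SDInterval) : A.sign = edgeSign A := signAux_eq_regionSign _ _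

theorem regionSign_mul_pow (m k d : ℕ) : regionSign (m + d) (k * 2 ^ d) = regionSign m k := by
  induction d with
  | zero => simp
  | succ d ih =>
    have h1 : k * 2 ^ (d + 1) % 2 = 0 := by rw [pow_succ, ← mul_assoc]; omega
    have h2 : k * 2 ^ (d + 1) / 2 = k * 2 ^ d := by rw [pow_succ, ← mul_assoc]; omega
    rw [← add_assoc, regionSign, if_pos h1, h2, ih]

/-- The sign of the region above a dyadic number only depends on the number. -/
theorem regionSign_congr {m k m' k' : ℕ} (h : (k : ℝ) / 2 ^ m = (k' : ℝ) / 2 ^ m') :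
    regionSign m k = regionSign m' k' := by
  have key : ∀ m k m' k' : ℕ, m ≤ m' → (k : ℝ) / 2 ^ m = (k' : ℝ) / 2 ^ m' →
      regionSign m k = regionSign m' k' := by
    intro m k m' k' hm h
    obtain ⟨d, rfl⟩ := Nat.exists_eq_add_of_le hm
    have h1 : (k' : ℝ) = ((k * 2 ^ d : ℕ) : ℝ) := by
      rw [pow_add] at h
      push_cast
      field_simp at h
      linarith
    have h2 : k' = k * 2 ^ d := by exact_mod_cast h1
    rw [h2, regionSign_mul_pow]
  rcases le_total m m' with hm | hm
  · exact key _ _ _ _ hm h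
  · exact (key _ _ _ _ hm h.symm).symm

theorem regionSign_zero (m : ℕ) : regionSign m 0 = true := by
  have := regionSign_mul_pow 0 0 m
  simpa [regionSign] using this

/-- The region above the midpoint of an interval has the sign opposite to that of the interval. -/
theorem edgeSign_of_left_eq_mid {A B : SDInterval} (h : B.left = A.mid) :
    edgeSign B = !A.sign := by
  have h1 : (B.idx : ℝ) / 2 ^ B.lvl = ((2 * A.idx + 1 : ℕ) : ℝ) / 2 ^ (A.lvl + 1) := by
    have h2 : (B.idx : ℝ) / 2 ^ B.lvl = B.left := rfl
    rw [h2, h, mid, left, right, pow_succ]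
    push_cast
    field_simp
    ring
  rw [edgeSign, regionSign_congr h1, regionSign, if_neg (by omega), sign_eq_edgeSign, edgeSign]
  congr 2
  omega

/-- Every dyadic number in `(0, 1)` is the midpoint of a standard dyadic interval. -/
theorem exists_mid_eq (m k : ℕ) (h0 : 0 < k) (h1 : k < 2 ^ m) :
    ∃ A : SDInterval, A.mid = (k : ℝ) / 2 ^ m := by
  induction m generalizing k with
  | zero => simp at h1; omega
  | succ m ih =>
    rw [pow_succ] at h1
    rcases Nat.even_or_odd' k with ⟨l, rfl | rfl⟩
    · obtain ⟨A, hA⟩ := ih l (by omega) (by omega)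
      refine ⟨A, ?_⟩
      rw [hA, pow_succ]
      push_cast
      field_simp
    · refine ⟨⟨m, l, by omega⟩, ?_⟩
      simp only [mid, left, right, pow_succ]
      push_cast
      field_simp
      ring

/-! ## Standard dyadic partitions -/

namespace SDPartition

variable {n : ℕ}

theorem pos_n (I : SDPartition n) : 0 < n := by
  rcases Nat.eq_zero_or_pos n with rfl | h
  · have h1 := I.zero
    have h2 := I.one
    rw [show (Fin.last 0) = (0 : Fin (0 + 1)) from rfl, h1] at h2
    norm_num at h2
  · exact h

theorem sub_left (I : SDPartition n) (i : Fin n) : (I.sub i).left = I.pt i.castSucc :=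
  (I.sub_spec i).1

theorem sub_right (I : SDPartition n) (i : Fin n) : (I.sub i).right = I.pt i.succ :=
  (I.sub_spec i).2

theorem zero_mem (I : SDPartition n) : (0 : ℝ) ∈ I.breakpoints := ⟨0, I.zero⟩

theorem one_mem (I : SDPartition n) : (1 : ℝ) ∈ I.breakpoints := ⟨Fin.last n, I.one⟩

theorem sub_left_mem (I : SDPartition n) (i : Fin n) : (I.sub i).left ∈ I.breakpoints :=
  ⟨_, (I.sub_left i).symm⟩

theorem sub_right_mem (I : SDPartition n) (i : Fin n) : (I.sub i).right ∈ I.breakpoints :=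
  ⟨_, (I.sub_right i).symm⟩

theorem sub_mem (I : SDPartition n) (i : Fin n) : I.sub i ∈ I.intervals :=
  ⟨I.sub_left_mem i, I.sub_right_mem i⟩

theorem breakpoint_cases (I : SDPartition n) (i : Fin n) {b : ℝ} (hb : b ∈ I.breakpoints) :
    b ≤ (I.sub i).left ∨ (I.sub i).right ≤ b := by
  obtain ⟨j, rfl⟩ := hb
  rw [sub_left, sub_right, I.strictMono.le_iff_le, I.strictMono.le_iff_le]
  rcases le_or_gt j i.castSucc with h | h
  · exact Or.inl h
  · exact Or.inr (Fin.castSucc_lt_iff_succ_le.1 h)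

theorem exists_sub (I : SDPartition n) {x : ℝ} (h0 : 0 ≤ x) (h1 : x < 1) :
    ∃ i, (I.sub i).left ≤ x ∧ x < (I.sub i).right := by
  classical
  let S : Finset (Fin (n + 1)) := Finset.univ.filter fun j => I.pt j ≤ x
  have hS : S.Nonempty := ⟨0, by simp [S, I.zero, h0]⟩
  have hj : I.pt (S.max' hS) ≤ x := by
    have := S.max'_mem hS
    simpa [S] using this
  have hne : S.max' hS ≠ Fin.last n := by
    intro h
    rw [h, I.one] at hj
    linarith
  obtain ⟨i, hi⟩ := Fin.exists_castSucc_eq.2 hne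
  refine ⟨i, ?_, ?_⟩
  · rw [sub_left, hi]; exact hj
  · rw [sub_right]
    by_contra! h
    have h2 : i.succ ∈ S := by simp [S, h]
    have h3 := S.le_max' _ h2
    rw [← hi] at h3
    exact absurd (Fin.castSucc_lt_succ (i := i)) (not_lt.2 h3)

theorem exists_sub_of_not_breakpoint (I : SDPartition n) {x : ℝ} (h0 : 0 ≤ x) (h1 : x < 1)
    (hx : x ∉ I.breakpoints) : ∃ i, (I.sub i).left < x ∧ x < (I.sub i).right := by
  obtain ⟨i, hi, hi'⟩ := I.exists_sub h0 h1
  refine ⟨i, lt_of_le_of_ne hi ?_, hi'⟩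
  rintro rfl
  exact hx (I.sub_left_mem i)

theorem root_mem (I : SDPartition n) : root ∈ I.intervals := by
  refine ⟨?_, ?_⟩
  · rw [root_left]; exact I.zero_mem
  · rw [root_right]; exact I.one_mem

/-- Every standard dyadic interval whose midpoint is a breakpoint belongs to the tree. -/
theorem mem_of_mid (I : SDPartition n) {A : SDInterval} (h : A.mid ∈ I.breakpoints) :
    A ∈ I.intervals := by
  have h1 := A.left_lt_mid
  have h2 := A.mid_lt_right
  have h3 := A.left_nonneg
  have h4 := A.right_le_one
  -- No end of `A` is interior to a subinterval: if the subinterval contains `A`, then the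
  -- breakpoint `A.mid` would be interior to it, and if it is contained in `A`, its interior misses
  -- the ends of `A`.
  have key : ∀ i, ∀ x, A.left ≤ x → x ≤ A.right → (I.sub i).left < x → x < (I.sub i).right →
      (x = A.left ∨ x = A.right) → False := by
    intro i x hx hx' hi hi' hxe
    have h5 := I.breakpoint_cases i h
    rcases le_or_gt (I.sub i).lvl A.lvl with hl | hl
    · rcases nested_or_disjoint hl with h6 | h6 | h6
      · linarith
      · linarith
      · rcases h5 with h5 | h5 <;> linarith
    · rcases nested_or_disjoint hl.le with h6 | h6 | h6
      · linarith
      · linarith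
      · rcases hxe with rfl | rfl <;> linarith
  constructor
  · by_contra hx
    obtain ⟨i, hi, hi'⟩ := I.exists_sub_of_not_breakpoint h3 (by linarith) hx
    exact key i _ le_rfl (by linarith) hi hi' (Or.inl rfl)
  · by_contra hx
    have h5 : A.right < 1 := lt_of_le_of_ne h4 fun h6 => hx (h6 ▸ I.one_mem)
    obtain ⟨i, hi, hi'⟩ := I.exists_sub_of_not_breakpoint (by linarith) h5 hx
    exact key i _ (by linarith) le_rfl hi hi' (Or.inr rfl)

/-- The subintervals are the intervals of the tree whose midpoint is not a breakpoint. -/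
theorem isSub_iff (I : SDPartition n) {A : SDInterval} (hA : A ∈ I.intervals) :
    I.IsSub A ↔ A.mid ∉ I.breakpoints := by
  have h1 := A.left_lt_mid
  have h2 := A.mid_lt_right
  have h3 := A.left_nonneg
  have h4 := A.right_le_one
  constructor
  · rintro ⟨i, rfl⟩ h
    rcases I.breakpoint_cases i h with h | h <;> linarith
  · intro h
    obtain ⟨i, hi, hi'⟩ := I.exists_sub_of_not_breakpoint (by linarith) (by linarith) h
    refine ⟨i, ?_⟩
    -- If `sub i` is at least as long as `A`, it contains `A`, and the ends of `A`, being
    -- breakpoints, are its own ends. A shorter `sub i` cannot have `A.mid` in its interior.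
    rcases le_or_gt (I.sub i).lvl A.lvl with hl | hl
    · have h5 := I.breakpoint_cases i hA.1
      have h6 := I.breakpoint_cases i hA.2
      have h7 : (I.sub i).left ≤ A.left ∧ A.right ≤ (I.sub i).right := by
        rcases nested_or_disjoint hl with h7 | h7 | h7
        · linarith
        · linarith
        · exact h7
      refine eq_of_left_of_right ?_ ?_
      · rcases h5 with h5 | h5 <;> linarith
      · rcases h6 with h6 | h6 <;> linarith
    · rcases mid_not_interior hl with h7 | h7 <;> linarith

/-- The midpoint of the parent is an end of `A`, hence a breakpoint. -/
theorem parent_mem (I : SDPartition n) {A : SDInterval} (hA : A ∈ I.intervals) (h : A.lvl ≠ 0) :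
    A.parent ∈ I.intervals := by
  rcases half_cases h with h1 | h1
  · exact I.mem_of_mid (h1.2.1 ▸ hA.2)
  · exact I.mem_of_mid (h1.1 ▸ hA.1)

theorem parent_not_isSub (I : SDPartition n) {A : SDInterval} (hA : A ∈ I.intervals)
    (h : A.lvl ≠ 0) : ¬ I.IsSub A.parent := by
  rw [I.isSub_iff (I.parent_mem hA h), not_not]
  rcases half_cases h with h1 | h1
  · exact h1.2.1 ▸ hA.2
  · exact h1.1 ▸ hA.1

theorem conj_mem (I : SDPartition n) {A : SDInterval} (hA : A ∈ I.intervals) (h : A.lvl ≠ 0) :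
    A.conj ∈ I.intervals := by
  have hP := I.parent_mem hA h
  rcases half_cases h with h1 | h1
  · exact ⟨h1.2.2.1 ▸ h1.2.1 ▸ hA.2, h1.2.2.2.1 ▸ hP.2⟩
  · exact ⟨h1.2.2.1 ▸ hP.1, h1.2.2.2.1 ▸ h1.1 ▸ hA.1⟩

theorem intervals_finite (I : SDPartition n) : I.intervals.Finite := by
  have hb : I.breakpoints.Finite := Set.finite_range _
  refine Set.Finite.of_finite_image (f := fun A : SDInterval => (A.left, A.right))
    ((hb.prod hb).subset ?_) ?_
  · rintro _ ⟨A, hA, rfl⟩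
    exact hA
  · intro A _ B _ h
    exact eq_of_left_of_right (congrArg Prod.fst h) (congrArg Prod.snd h)

instance (I : SDPartition n) : Finite I.intervals := I.intervals_finite.to_subtype

end SDPartition

end ThompsonLink

namespace ThompsonLink

open SDInterval

namespace SDPartition

variable {n : ℕ}

/-! ## The vertical strands of a partition -/

/-- The vertical strands of the tangle of a partition: one for every interval of the tree, and the
strand over `0` that is added in the cap-off. -/
abbrev Strand (I : SDPartition n) : Type := Option I.intervals

namespace Strand

variable {I : SDPartition n}

/-- The position of a strand in Jones' tangle. -/
noncomputable def mid : I.Strand → ℝ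
  | none => 0
  | some A => A.1.mid

/-- The height of the upper end of a strand. -/
noncomputable def len : I.Strand → ℝ
  | none => 1
  | some A => A.1.length

/-- The direction of a strand. -/
noncomputable def up : I.Strand → Bool
  | none => false
  | some A => A.1.sign

open Classical in
/-- The strand that is joined to a given strand by a horizontal segment. -/
noncomputable def partner : I.Strand → I.Strand
  | none => some ⟨root, I.root_mem⟩
  | some A => if h : A.1.lvl = 0 then none else some ⟨A.1.conj, I.conj_mem A.2 h⟩

theorem partner_root (h : root ∈ I.intervals) : partner (some ⟨root, h⟩ : I.Strand) = none := by
  rw [partner]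
  exact dif_pos rfl

theorem partner_some {A : I.intervals} (h : A.1.lvl ≠ 0) :
    partner (some A : I.Strand) = some ⟨A.1.conj, I.conj_mem A.2 h⟩ := by
  rw [partner, dif_neg h]

/-- Strands are the outer strand, the root strand, or the strand of one half of an interval. -/
theorem cases' {P : I.Strand → Prop} (h0 : P none) (h1 : P (some ⟨root, I.root_mem⟩))
    (h2 : ∀ A : I.intervals, A.1.lvl ≠ 0 → P (some A)) (k : I.Strand) : P k := by
  rcases k with _ | ⟨A, hA⟩
  · exact h0
  · by_cases h : A.lvl = 0
    · obtain rfl := eq_root h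
      exact h1
    · exact h2 ⟨A, hA⟩ h

theorem isPairing : IsPairing (up (I := I)) partner where
  invol := by
    refine cases' ?_ ?_ ?_
    · rw [partner, partner_root]
    · rw [partner_root, partner]
    · intro A h
      rw [partner_some h, partner_some (A := ⟨A.1.conj, _⟩) h]
      simp only [conj_conj]
  up_partner := by
    refine cases' ?_ ?_ ?_
    · simp [partner, up]
    · simp [partner_root, up]
    · intro A h
      rw [partner_some h]
      exact sign_conj h

theorem len_partner (k : I.Strand) : len (partner k) = len k := by
  revert k
  refine cases' ?_ ?_ ?_
  · simp [partner, len]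
  · simp [partner_root, len]
  · intro A h
    rw [partner_some h]
    rfl

theorem len_pos (k : I.Strand) : 0 < len k := by
  rcases k with _ | A
  · exact one_pos
  · exact A.1.length_pos

theorem mid_some_pos (A : I.intervals) : 0 < mid (some A : I.Strand) :=
  lt_of_le_of_lt A.1.left_nonneg A.1.left_lt_mid

theorem mid_injective : Function.Injective (mid (I := I)) := by
  rintro (_ | A) (_ | B) h
  · rfl
  · exact absurd h (mid_some_pos B).ne
  · exact absurd h (mid_some_pos A).ne'
  · rw [Subtype.ext (SDInterval.mid_injective h)]

/-- Different pairs of strands of the same height are over disjoint segments. -/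
theorem mid_separated (k l : I.Strand) (h1 : l ≠ k) (h2 : l ≠ partner k) (h : len k = len l) :
    (max (mid k) (mid (partner k)) < min (mid l) (mid (partner l))) ∨
      (max (mid l) (mid (partner l)) < min (mid k) (mid (partner k))) := by
  -- The root and the outer strand form the only pair of height `1`.
  have key : ∀ A : I.intervals, A.1.lvl ≠ 0 → len (some A : I.Strand) ≠ 1 := by
    intro A hA hl
    have : A.1.length = root.length := by rw [root_length]; exact hl
    exact hA (length_eq_iff.1 this)
  revert k l
  refine cases' ?_ ?_ ?_
  · refine cases' ?_ ?_ ?_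
    · exact fun h => absurd rfl h
    · exact fun _ h => absurd rfl h
    · intro A hA _ _ h
      exact absurd h.symm (key A hA)
  · refine cases' ?_ ?_ ?_
    · intro _ h
      rw [partner_root] at h
      exact absurd rfl h
    · exact fun h => absurd rfl h
    · intro A hA _ _ h
      refine absurd ?_ (key A hA)
      rw [← h]
      exact root_length
  · intro A hA
    refine cases' ?_ ?_ ?_
    · exact fun _ _ h => absurd h (key A hA)
    · intro _ _ h
      exact absurd (h.trans root_length) (key A hA)
    · intro B hB h1 h2 h
      rw [partner_some hA] at h2
      rw [partner_some hA, partner_some hB]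
      -- Different pairs of the same length have different parents of the same level. These parents
      -- have disjoint interiors, in which the midpoints of both halves lie.
      have hne : A.1.parent ≠ B.1.parent := by
        intro hP
        have hl : A.1.lvl = B.1.lvl := length_eq_iff.1 h
        rcases half_cases hA with a | a <;> rcases half_cases hB with b | b
        · exact h1 (congrArg some (Subtype.ext (eq_of_left_of_lvl
            (by rw [a.1, b.1, hP]) hl).symm))
        · exact h2 (congrArg some (Subtype.ext (eq_of_left_of_lvl (A := B.1) (B := A.1.conj)
            (by rw [a.2.2.1, b.1, hP]) hl.symm)))
        · exact h2 (congrArg some (Subtype.ext (eq_of_left_of_lvl (A := B.1) (B := A.1.conj)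
            (by rw [a.2.2.1, b.1, hP]) hl.symm)))
        · exact h1 (congrArg some (Subtype.ext (eq_of_left_of_lvl
            (by rw [a.1, b.1, hP]) hl).symm))
      have bound : ∀ C : I.intervals, C.1.lvl ≠ 0 →
          C.1.parent.left < min (C.1.mid) (C.1.conj.mid) ∧
            max (C.1.mid) (C.1.conj.mid) < C.1.parent.right := by
        intro C hC
        have c1 := C.1.left_lt_mid
        have c2 := C.1.mid_lt_right
        have c3 := C.1.conj.left_lt_mid
        have c4 := C.1.conj.mid_lt_right
        have c5 := C.1.parent.left_lt_mid
        have c6 := C.1.parent.mid_lt_right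
        rw [lt_min_iff, max_lt_iff]
        rcases half_cases hC with ⟨d1, d2, d3, d4, -⟩ | ⟨d1, d2, d3, d4, -⟩ <;>
          refine ⟨⟨?_, ?_⟩, ?_, ?_⟩ <;> linarith
      have hl : A.1.parent.lvl = B.1.parent.lvl := by
        rw [← length_eq_iff, parent_length hA, parent_length hB]
        exact congrArg _ h
      obtain ⟨a1, a2⟩ := bound A hA
      obtain ⟨b1, b2⟩ := bound B hB
      have hlen := length_eq_iff.2 hl
      rcases nested_or_disjoint hl.le with h3 | h3 | h3
      · exact Or.inr (by simp only [mid]; linarith)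
      · exact Or.inl (by simp only [mid]; linarith)
      · refine absurd (eq_of_left_of_lvl ?_ hl) hne
        have := h3.2
        rw [right_eq, right_eq] at this
        linarith [h3.1]

/-! ### The columns of the strands -/

/-- The position of the `j`-th strand from the left. -/
noncomputable def columnPos (I : SDPartition n) (j : Fin (2 * n)) : ℝ :=
  if j.1 % 2 = 0 then (I.sub ⟨j.1 / 2, by omega⟩).left else (I.sub ⟨j.1 / 2, by omega⟩).mid

/-- The positions run through left ends and midpoints of consecutive subintervals alternately. -/
theorem columnPos_strictMono (I : SDPartition n) : StrictMono (columnPos I) := by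
  intro j j' h
  have lb : ∀ j : Fin (2 * n), (I.sub ⟨j.1 / 2, by omega⟩).left ≤ columnPos I j := by
    intro j
    rw [columnPos]
    split_ifs
    · exact le_rfl
    · exact (left_lt_mid _).le
  have ub : ∀ j : Fin (2 * n), columnPos I j < (I.sub ⟨j.1 / 2, by omega⟩).right := by
    intro j
    rw [columnPos]
    split_ifs
    · exact left_lt_right _
    · exact mid_lt_right _
  have h' : j.1 < j'.1 := h
  rcases lt_or_ge (j.1 / 2) (j'.1 / 2) with h1 | h1
  · refine (ub j).trans_le (le_trans ?_ (lb j'))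
    rw [sub_right, sub_left, I.strictMono.le_iff_le]
    exact h1
  · have h2 : j.1 / 2 = j'.1 / 2 := by omega
    have h3 : j.1 % 2 = 0 := by omega
    have h4 : ¬ j'.1 % 2 = 0 := by omega
    rw [columnPos, columnPos, if_pos h3, if_neg h4]
    simp only [h2]
    exact left_lt_mid _

/-- If the midpoint of an interval is a breakpoint, it is not `1`, hence is the left end of a
subinterval. Otherwise the interval is itself a subinterval. -/
theorem exists_columnPos (k : I.Strand) : ∃ j, columnPos I j = mid k := by
  have hn := I.pos_n
  rcases k with _ | ⟨A, hA⟩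
  · refine ⟨⟨0, by omega⟩, ?_⟩
    simp only [columnPos, if_true, sub_left, mid]
    exact I.zero
  · by_cases hm : A.mid ∈ I.breakpoints
    · obtain ⟨i, hi⟩ := hm
      have hne : i ≠ Fin.last n := by
        rintro rfl
        rw [I.one] at hi
        have := A.mid_lt_right
        have := A.right_le_one
        linarith
      obtain ⟨i, rfl⟩ := Fin.exists_castSucc_eq.2 hne
      refine ⟨⟨2 * i.1, by omega⟩, ?_⟩
      have h1 : 2 * i.1 % 2 = 0 := by omega
      have h2 : 2 * i.1 / 2 = i.1 := by omega
      simp only [columnPos, h1, h2, if_true, sub_left, mid]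
      exact hi
    · obtain ⟨i, rfl⟩ := (I.isSub_iff hA).2 hm
      refine ⟨⟨2 * i.1 + 1, by omega⟩, ?_⟩
      have h1 : ¬ (2 * i.1 + 1) % 2 = 0 := by omega
      have h2 : (2 * i.1 + 1) / 2 = i.1 := by omega
      simp only [columnPos, h1, h2, if_false, mid]

/-- A breakpoint strictly between `0` and `1` is dyadic, so it is the midpoint of a standard dyadic
interval, which belongs to the tree by `mem_of_mid`. Together with `exists_columnPos` this counts
the strands. -/
theorem exists_mid (j : Fin (2 * n)) : ∃ k : I.Strand, columnPos I j = mid k := by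
  by_cases h : j.1 % 2 = 0
  · rcases Nat.eq_zero_or_pos (j.1 / 2) with h0 | h0
    · refine ⟨none, ?_⟩
      simp only [columnPos, h, if_true, sub_left, mid]
      rw [← I.zero]
      congr 1
      exact Fin.ext h0
    · set B := I.sub ⟨j.1 / 2, by omega⟩ with hB
      have hpos : 0 < B.left := by
        rw [hB, sub_left, ← I.zero]
        exact I.strictMono h0
      have h1 : 0 < B.idx := by
        rw [SDInterval.left] at hpos
        by_contra h2
        have : B.idx = 0 := by omega
        simp [this] at hpos
      obtain ⟨A, hA⟩ := exists_mid_eq B.lvl B.idx h1 B.idx_lt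
      have hA' : A.mid = B.left := hA
      refine ⟨some ⟨A, I.mem_of_mid ?_⟩, ?_⟩
      · rw [hA', hB]
        exact I.sub_left_mem _
      · simp only [columnPos, h, if_true, mid]
        exact hA'.symm
  · refine ⟨some ⟨I.sub ⟨j.1 / 2, by omega⟩, I.sub_mem _⟩, ?_⟩
    simp only [columnPos, h, if_false, mid]

/-- The strands, in order. -/
noncomputable def colEquiv (I : SDPartition n) : I.Strand ≃ Fin (2 * n) :=
  Equiv.ofBijective (fun k => (exists_columnPos k).choose) <| by
    have h : ∀ k : I.Strand, columnPos I (exists_columnPos k).choose = mid k := fun k =>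
      (exists_columnPos k).choose_spec
    constructor
    · intro k l hkl
      apply mid_injective
      rw [← h k, ← h l]
      exact congrArg _ hkl
    · intro j
      obtain ⟨k, hk⟩ := exists_mid (I := I) j
      exact ⟨k, (columnPos_strictMono I).injective ((h k).trans hk.symm)⟩

theorem columnPos_colEquiv (k : I.Strand) : columnPos I (colEquiv I k) = mid k :=
  (exists_columnPos k).choose_spec

theorem colEquiv_lt_iff {k l : I.Strand} : colEquiv I k < colEquiv I l ↔ mid k < mid l := by
  rw [← columnPos_colEquiv, ← columnPos_colEquiv, (columnPos_strictMono I).lt_iff_lt]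

theorem colEquiv_le_iff {k l : I.Strand} : colEquiv I k ≤ colEquiv I l ↔ mid k ≤ mid l := by
  rw [← columnPos_colEquiv, ← columnPos_colEquiv, (columnPos_strictMono I).le_iff_le]

theorem card_strand (I : SDPartition n) : Nat.card I.Strand = 2 * n := by
  rw [Nat.card_congr (colEquiv I), Nat.card_fin]

/-- The `n`-sign determines the directions of the strands. -/
theorem up_eq {k : I.Strand} {j : Fin (2 * n)} (hj : colEquiv I k = j) : up k =
    if j.1 % 2 = 0 then !I.nSign ⟨j.1 / 2, by omega⟩ else I.nSign ⟨j.1 / 2, by omega⟩ := by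
  have hk := columnPos_colEquiv k
  rw [hj, columnPos] at hk
  split_ifs with h
  · rw [if_pos h] at hk
    rcases k with _ | A
    · have h1 : (I.sub ⟨j.1 / 2, by omega⟩).left = 0 := hk
      have h2 : (I.sub ⟨j.1 / 2, by omega⟩).idx = 0 := by
        rw [SDInterval.left, div_eq_zero_iff] at h1
        rcases h1 with h1 | h1
        · exact_mod_cast h1
        · exact absurd h1 (by positivity)
      rw [nSign, edgeSign, h2, regionSign_zero]
      rfl
    · rw [nSign, edgeSign_of_left_eq_mid (A := A.1) hk, Bool.not_not]
      rfl
  · rw [if_neg h] at hk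
    rcases k with _ | A
    · have h1 : (I.sub ⟨j.1 / 2, by omega⟩).mid = 0 := hk
      have h2 := left_lt_mid (I.sub ⟨j.1 / 2, by omega⟩)
      have h3 := left_nonneg (I.sub ⟨j.1 / 2, by omega⟩)
      linarith
    · have h1 := SDInterval.mid_injective hk
      rw [nSign, h1]
      exact sign_eq_edgeSign _

/-- The column of a strand in the half grid diagram. -/
noncomputable def gridX : I.Strand → ℕ
  | none => 1
  | some A => I.px A

theorem colEquiv_none (I : SDPartition n) : (colEquiv I none).1 = 0 := by
  have hn := I.pos_n
  have h : columnPos I ⟨0, by omega⟩ = mid (none : I.Strand) := by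
    simp only [columnPos, if_true, sub_left, mid]
    exact I.zero
  have := (columnPos_strictMono I).injective (h.trans (columnPos_colEquiv none).symm)
  rw [← this]

theorem gridX_eq (k : I.Strand) : gridX k = colEquiv I k + 1 := by
  rcases k with _ | A
  · rw [colEquiv_none]
    rfl
  · have h1 : {B | B ∈ I.intervals ∧ B.LeMid A} = Subtype.val ''
        {B : I.intervals | colEquiv I (some B) ≤ colEquiv I (some A)} := by
      ext B
      simp only [Set.mem_ofPred_eq, Set.mem_image, Subtype.exists, exists_and_right,
        exists_eq_right, colEquiv_le_iff]
      exact ⟨fun h => ⟨h.1, h.2⟩, fun ⟨h, h'⟩ => ⟨h, h'⟩⟩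
    -- `colEquiv` counts from `0`, and the index `0` belongs to the outer strand, so the intervals
    -- up to `A` occupy the indices from `1` on.
    have h2 : (fun B : I.intervals => (colEquiv I (some B)).1) ''
        {B : I.intervals | colEquiv I (some B) ≤ colEquiv I (some A)} =
        (Finset.Icc 1 (colEquiv I (some A)).1 : Finset ℕ) := by
      ext c
      simp only [Set.mem_image, Set.mem_ofPred_eq, Finset.coe_Icc, Set.mem_Icc]
      constructor
      · rintro ⟨B, hB, rfl⟩
        refine ⟨?_, hB⟩
        by_contra h
        have h3 : (colEquiv I (some B)).1 = (colEquiv I none).1 := by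
          rw [colEquiv_none]; omega
        have := (colEquiv I).injective (Fin.ext h3)
        simp at this
      · rintro ⟨hc1, hc2⟩
        obtain ⟨k, hk⟩ := (colEquiv I).surjective
          ⟨c, lt_of_le_of_lt hc2 (colEquiv I (some A)).2⟩
        rcases k with _ | B
        · have := congrArg Fin.val hk
          rw [colEquiv_none] at this
          simp at this
          omega
        · refine ⟨B, ?_, congrArg Fin.val hk⟩
          rw [hk]
          exact hc2
    rw [gridX, px, h1, Set.ncard_image_of_injective _ Subtype.val_injective,
      ← Set.ncard_image_of_injective (f := fun B : I.intervals => (colEquiv I (some B)).1), h2,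
      Set.ncard_coe_finset, Nat.card_Icc]
    · rfl
    · intro B C h
      have := (colEquiv I).injective (Fin.ext h)
      simpa using this

theorem gridX_lt_iff {k l : I.Strand} : gridX k < gridX l ↔ mid k < mid l := by
  rw [gridX_eq, gridX_eq, ← colEquiv_lt_iff, Fin.lt_def]
  omega

/-! ### The rows of the strands -/

/-- The row of a strand in the half grid diagram. -/
noncomputable def gridY : I.Strand → ℕ
  | none => n
  | some A => I.py A

/-- `partner` exchanges the upward and the downward strands, so half of the `2 * n` strands go
upwards. -/
theorem card_up (I : SDPartition n) : {k : I.Strand | up k = true}.ncard = n := by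
  have h1 : {k : I.Strand | up k = true}ᶜ = partner '' {k : I.Strand | up k = true} := by
    ext k
    simp only [Set.mem_compl_iff, Set.mem_ofPred_eq, Set.mem_image]
    constructor
    · intro h
      refine ⟨partner k, ?_, isPairing.invol k⟩
      rw [isPairing.up_partner]
      simpa using h
    · rintro ⟨l, hl, rfl⟩
      rw [isPairing.up_partner, hl]
      simp
  have h2 := Set.ncard_add_ncard_compl {k : I.Strand | up k = true}
  rw [h1, Set.ncard_image_of_injective _
    (Function.LeftInverse.injective (g := partner) isPairing.invol), card_strand] at h2
  omega

theorem posRank_eq (I : SDPartition n) (A : I.intervals) : I.posRank A =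
    {k : I.Strand | up k = true ∧ ∃ B, k = some B ∧ B.1.LeLen A}.ncard := by
  have h : {B | B ∈ I.intervals ∧ B.sign = true ∧ B.LeLen A} =
      Subtype.val '' {B : I.intervals | B.1.sign = true ∧ B.1.LeLen A} := by
    ext B
    constructor
    · rintro ⟨h1, h2, h3⟩
      exact ⟨⟨B, h1⟩, ⟨h2, h3⟩, rfl⟩
    · rintro ⟨C, ⟨h2, h3⟩, rfl⟩
      exact ⟨C.2, h2, h3⟩
  have h' : {k : I.Strand | up k = true ∧ ∃ B, k = some B ∧ B.1.LeLen A} =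
      some '' {B : I.intervals | B.1.sign = true ∧ B.1.LeLen A} := by
    ext k
    simp only [Set.mem_ofPred_eq, Set.mem_image]
    constructor
    · rintro ⟨h1, B, rfl, h2⟩
      exact ⟨B, ⟨h1, h2⟩, rfl⟩
    · rintro ⟨B, ⟨h1, h2⟩, rfl⟩
      exact ⟨h1, B, rfl, h2⟩
  rw [posRank, h, h', Set.ncard_image_of_injective _ Subtype.val_injective,
    Set.ncard_image_of_injective _ (Option.some_injective _)]

theorem posRank_le (I : SDPartition n) (A : I.intervals) : I.posRank A ≤ n := by
  rw [posRank_eq]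
  conv_rhs => rw [← card_up I]
  exact Set.ncard_le_ncard (fun k hk => hk.1) (Set.toFinite _)

theorem posRank_pos (A : I.intervals) (h : A.1.sign = true) : 1 ≤ I.posRank A := by
  rw [posRank_eq]
  exact (Set.ncard_pos (Set.toFinite _)).2 ⟨some A, h, A, rfl, leLen_refl _⟩

/-- The root is last in the length order, and the outer strand goes downwards, so all upward strands
are counted. Hence the extra `O` in row `n` shares its row with the root. -/
theorem posRank_root (I : SDPartition n) : I.posRank root = n := by
  rw [posRank_eq I ⟨root, I.root_mem⟩]
  conv_rhs => rw [← card_up I]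
  congr 1
  ext k
  refine ⟨fun h => h.1, fun h => ⟨h, ?_⟩⟩
  rcases k with _ | A
  · simp [up] at h
  · exact ⟨A, rfl, leLen_root _⟩

theorem posRank_lt {A B : I.intervals} (hB : B.1.sign = true) (hne : A ≠ B)
    (h : A.1.LeLen B) : I.posRank A < I.posRank B := by
  rw [posRank_eq, posRank_eq]
  refine Set.ncard_lt_ncard ⟨?_, ?_⟩ (Set.toFinite _)
  · rintro k ⟨h1, C, rfl, h2⟩
    exact ⟨h1, C, rfl, leLen_trans h2 h⟩
  · intro hsub
    obtain ⟨-, C, h1, h2⟩ := hsub (a := some B) ⟨hB, B, rfl, leLen_refl _⟩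
    obtain rfl : B = C := by simpa using h1
    exact hne (Subtype.ext (leLen_antisymm h h2))

theorem gridY_of_up {A : I.intervals} (h : up (some A : I.Strand) = true) :
    gridY (some A : I.Strand) = I.posRank A := by
  rw [gridY, py, if_pos (show A.1.sign = true from h)]

theorem gridY_partner (k : I.Strand) : gridY (partner k) = gridY k := by
  revert k
  refine cases' ?_ ?_ ?_
  · rw [partner, gridY_of_up rfl, posRank_root]
    rfl
  · rw [partner_root, gridY_of_up rfl, posRank_root]
    rfl
  · intro A h
    rw [partner_some h]
    simp only [gridY, py]
    rw [sign_conj h, conj_conj]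
    cases A.1.sign <;> simp

/-- The strand directed upwards in the pair of a given strand. -/
theorem exists_up (k : I.Strand) : ∃ l : I.Strand, up l = true ∧ (k = l ∨ k = partner l) := by
  rcases h : up k with _ | _
  · refine ⟨partner k, ?_, Or.inr (isPairing.invol k).symm⟩
    rw [isPairing.up_partner, h]
    rfl
  · exact ⟨k, h, Or.inl rfl⟩

theorem gridY_mem (k : I.Strand) : 1 ≤ gridY k ∧ gridY k ≤ n := by
  obtain ⟨l, hl, h⟩ := exists_up k
  have hk : gridY k = gridY l := by
    rcases h with rfl | rfl
    · rfl
    · exact gridY_partner l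
  rw [hk]
  rcases l with _ | A
  · simp [up] at hl
  · rw [gridY_of_up hl]
    exact ⟨posRank_pos A hl, posRank_le I A⟩

/-- Both rows and lengths are the same for partners, so upward strands suffice, and there the rank
is strictly increasing in the length order. This monotonicity is what the interpolation of the
heights needs. -/
theorem gridY_lt {k l : I.Strand} (h : len k < len l) : gridY k < gridY l := by
  obtain ⟨k', hk', h1⟩ := exists_up k
  obtain ⟨l', hl', h2⟩ := exists_up l
  have e1 : gridY k = gridY k' ∧ len k = len k' := by
    rcases h1 with rfl | rfl
    · exact ⟨rfl, rfl⟩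
    · exact ⟨gridY_partner _, len_partner _⟩
  have e2 : gridY l = gridY l' ∧ len l = len l' := by
    rcases h2 with rfl | rfl
    · exact ⟨rfl, rfl⟩
    · exact ⟨gridY_partner _, len_partner _⟩
  rw [e1.2, e2.2] at h
  rw [e1.1, e2.1]
  rcases k' with _ | A
  · simp [up] at hk'
  rcases l' with _ | B
  · simp [up] at hl'
  rw [gridY_of_up hk', gridY_of_up hl']
  refine posRank_lt hl' ?_ (Or.inl h)
  rintro rfl
  exact lt_irrefl _ h

theorem gridY_injOn {k l : I.Strand} (hk : up k = true) (hl : up l = true)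
    (h : gridY k = gridY l) : k = l := by
  rcases k with _ | A
  · simp [up] at hk
  rcases l with _ | B
  · simp [up] at hl
  rw [gridY_of_up hk, gridY_of_up hl] at h
  by_contra hne
  have hne' : A ≠ B := fun h => hne (congrArg some h)
  rcases leLen_total A.1 B.1 with h1 | h1
  · exact absurd h (posRank_lt hl hne' h1).ne
  · exact absurd h (posRank_lt hk hne'.symm h1).ne'

theorem eq_or_eq_partner_of_gridY {k l : I.Strand} (h : gridY k = gridY l) :
    l = k ∨ l = partner k := by
  obtain ⟨k', hk', h1⟩ := exists_up k
  obtain ⟨l', hl', h2⟩ := exists_up l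
  have h3 : k' = l' := by
    apply gridY_injOn hk' hl'
    rcases h1 with rfl | rfl <;> rcases h2 with rfl | rfl <;>
      simpa only [gridY_partner] using h
  subst h3
  rcases h1 with rfl | rfl <;> rcases h2 with rfl | rfl <;> simp [isPairing.invol]

/-- The `n` upward strands are in `n` different rows between `1` and `n`. -/
theorem exists_gridY {j : ℕ} (h1 : 1 ≤ j) (h2 : j ≤ n) :
    ∃ k : I.Strand, up k = true ∧ gridY k = j := by
  have h : gridY '' {k : I.Strand | up k = true} = (Finset.Icc 1 n : Finset ℕ) := by
    refine Set.eq_of_subset_of_ncard_le ?_ ?_ (Set.toFinite _)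
    · rintro _ ⟨k, -, rfl⟩
      simpa using gridY_mem k
    · rw [Set.ncard_coe_finset, Nat.card_Icc, Set.InjOn.ncard_image, card_up]
      · omega
      · exact fun k hk l hl hkl => gridY_injOn hk hl hkl
  have : j ∈ gridY '' {k : I.Strand | up k = true} := by
    rw [h]
    simpa using ⟨h1, h2⟩
  obtain ⟨k, hk, hj⟩ := this
  exact ⟨k, hk, hj⟩

/-- The marking of a strand. -/
noncomputable def mark (k : I.Strand) : Mark := if up k = true then Mark.X else Mark.O

theorem mem_halfGrid {q : ℕ × ℕ × Mark} :
    q ∈ I.halfGrid ↔ ∃ k : I.Strand, q = (gridX k, gridY k, mark k) := by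
  constructor
  · rintro (h | ⟨A, hA, rfl⟩)
    · exact ⟨none, h⟩
    · exact ⟨some ⟨A, hA⟩, rfl⟩
  · rintro ⟨_ | A, rfl⟩
    · exact Or.inl rfl
    · exact Or.inr ⟨A.1, A.2, rfl⟩

theorem gridX_injective : Function.Injective (gridX (I := I)) := by
  intro k l h
  rw [gridX_eq, gridX_eq] at h
  exact (colEquiv I).injective (Fin.ext (by omega))

theorem mark_eq_X {k : I.Strand} : mark k = Mark.X ↔ up k = true := by
  rw [mark]
  split_ifs with h <;> simp [h]

theorem mark_eq_O {k : I.Strand} : mark k = Mark.O ↔ up k = false := by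
  rw [mark]
  split_ifs with h <;> simp [h]

/-- The columns correspond to the strands. Each row holds one pair of partners, whose upward strand
carries the `X` and whose downward strand the `O`. -/
theorem isHalfGridDiagram (I : SDPartition n) : IsHalfGridDiagram n I.halfGrid where
  range := by
    intro i j μ h
    obtain ⟨k, hk⟩ := mem_halfGrid.1 h
    simp only [Prod.mk.injEq] at hk
    obtain ⟨rfl, rfl, rfl⟩ := hk
    refine ⟨?_, gridY_mem k⟩
    rw [gridX_eq]
    have := (colEquiv I k).2
    omega
  row := by
    intro j h1 h2 μ
    obtain ⟨k, hk, rfl⟩ := exists_gridY (I := I) h1 h2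
    cases μ with
    | X =>
      refine ⟨gridX k, mem_halfGrid.2 ⟨k, by rw [mark_eq_X.2 hk]⟩, ?_⟩
      intro i hi
      obtain ⟨l, hl⟩ := mem_halfGrid.1 hi
      simp only [Prod.mk.injEq] at hl
      rw [hl.1, gridY_injOn hk (mark_eq_X.1 hl.2.2.symm) hl.2.1]
    | O =>
      have hk' : up (partner k) = false := by rw [isPairing.up_partner, hk]; rfl
      refine ⟨gridX (partner k), mem_halfGrid.2 ⟨partner k, by
        rw [mark_eq_O.2 hk', gridY_partner]⟩, ?_⟩
      intro i hi
      obtain ⟨l, hl⟩ := mem_halfGrid.1 hi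
      simp only [Prod.mk.injEq] at hl
      rw [hl.1]
      rcases eq_or_eq_partner_of_gridY hl.2.1 with rfl | rfl
      · have := mark_eq_O.1 hl.2.2.symm
        simp [hk] at this
      · rfl
  col := by
    intro i h1 h2
    obtain ⟨k, hk⟩ := (colEquiv I).surjective ⟨i - 1, by omega⟩
    have hki : gridX k = i := by
      rw [gridX_eq, hk]
      simp only
      omega
    refine ⟨(gridY k, mark k), mem_halfGrid.2 ⟨k, by rw [hki]⟩, ?_⟩
    intro q hq
    obtain ⟨l, hl⟩ := mem_halfGrid.1 hq
    simp only [Prod.mk.injEq] at hl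
    obtain rfl := gridX_injective (hki.trans hl.1)
    exact Prod.ext hl.2.1 hl.2.2

end Strand

end SDPartition

end ThompsonLink

namespace ThompsonLink

open ArchVertex SDPartition SDPartition.Strand

variable {n : ℕ}

/-! ## The tangle of the half grid diagram as an arch diagram -/

theorem gridTangle_halfGrid (I : SDPartition n) :
    gridTangle I.halfGrid = polySet (ArchEdge (up (I := I)) partner)
      (archPos (fun k => (gridX k : ℝ)) (fun k => (gridY k : ℝ))) := by
  ext e
  constructor
  · rintro ((⟨i, i', j, h1, h2, rfl⟩ | ⟨i, j, h, rfl⟩ | ⟨i, j, h, rfl⟩) | ⟨i, j, h, rfl⟩ |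
      ⟨i, j, h, rfl⟩)
    · obtain ⟨k, hk⟩ := mem_halfGrid.1 h1
      obtain ⟨l, hl⟩ := mem_halfGrid.1 h2
      simp only [Prod.mk.injEq] at hk hl
      obtain ⟨rfl, rfl, hk⟩ := hk
      obtain ⟨rfl, hkl, hl⟩ := hl
      have hk' := mark_eq_X.1 hk.symm
      have hl' := mark_eq_O.1 hl.symm
      rcases eq_or_eq_partner_of_gridY hkl with rfl | rfl
      · simp [hk'] at hl'
      · exact ⟨_, _, .row k hk', by simp [archPos, gridPt, gridY_partner]⟩
    · obtain ⟨k, hk⟩ := mem_halfGrid.1 h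
      simp only [Prod.mk.injEq] at hk
      obtain ⟨rfl, rfl, hk⟩ := hk
      exact ⟨_, _, .zup k (mark_eq_X.1 hk.symm), rfl⟩
    · obtain ⟨k, hk⟩ := mem_halfGrid.1 h
      simp only [Prod.mk.injEq] at hk
      obtain ⟨rfl, rfl, hk⟩ := hk
      exact ⟨_, _, .zdown k (mark_eq_O.1 hk.symm), rfl⟩
    · obtain ⟨k, hk⟩ := mem_halfGrid.1 h
      simp only [Prod.mk.injEq] at hk
      obtain ⟨rfl, rfl, hk⟩ := hk
      exact ⟨_, _, .vup k (mark_eq_X.1 hk.symm), by simp [archPos, gridPt]⟩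
    · obtain ⟨k, hk⟩ := mem_halfGrid.1 h
      simp only [Prod.mk.injEq] at hk
      obtain ⟨rfl, rfl, hk⟩ := hk
      exact ⟨_, _, .vdown k (mark_eq_O.1 hk.symm), by simp [archPos, gridPt]⟩
  · rintro ⟨_, _, ⟨k, hk⟩ | ⟨k, hk⟩ | ⟨k, hk⟩ | ⟨k, hk⟩ | ⟨k, hk⟩, rfl⟩
    · exact Or.inr (Or.inl ⟨gridX k, gridY k, mem_halfGrid.2 ⟨k, by rw [mark_eq_X.2 hk]⟩,
        by simp [archPos, gridPt]⟩)
    · exact Or.inl (Or.inr (Or.inl ⟨gridX k, gridY k,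
        mem_halfGrid.2 ⟨k, by rw [mark_eq_X.2 hk]⟩, rfl⟩))
    · have hk' : up (partner k) = false := by rw [isPairing.up_partner, hk]; rfl
      exact Or.inl (Or.inl ⟨gridX k, gridX (partner k), gridY k,
        mem_halfGrid.2 ⟨k, by rw [mark_eq_X.2 hk]⟩,
        mem_halfGrid.2 ⟨partner k, by rw [mark_eq_O.2 hk', gridY_partner]⟩,
        by simp [archPos, gridPt, gridY_partner]⟩)
    · exact Or.inl (Or.inr (Or.inr ⟨gridX k, gridY k,
        mem_halfGrid.2 ⟨k, by rw [mark_eq_O.2 hk]⟩, rfl⟩))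
    · exact Or.inr (Or.inr ⟨gridX k, gridY k, mem_halfGrid.2 ⟨k, by rw [mark_eq_O.2 hk]⟩,
        by simp [archPos, gridPt]⟩)

/-- The positions of the strands on the way from Jones' tangle to the half grid diagram. -/
noncomputable def interX {I : SDPartition n} (t : ℝ) (k : I.Strand) : ℝ :=
  (1 - t) * mid k + t * gridX k

/-- The heights of the strands on the way from Jones' tangle to the half grid diagram. -/
noncomputable def interY {I : SDPartition n} (s t : ℝ) (k : I.Strand) : ℝ :=
  (1 - t) * len k + t * (gridY k - s)

theorem interX_lt {I : SDPartition n} {t : ℝ} (h0 : 0 ≤ t) (h1 : t ≤ 1) {k l : I.Strand}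
    (h : mid k < mid l) : interX t k < interX t l := by
  have h2 : (gridX k : ℝ) < gridX l := by exact_mod_cast gridX_lt_iff.2 h
  have := convex_comb_pos (sub_pos.2 h) (sub_pos.2 h2) h0 h1
  simp only [interX]
  linarith

theorem interY_lt {I : SDPartition n} {s t : ℝ} (h0 : 0 ≤ t) (h1 : t ≤ 1) {k l : I.Strand}
    (h : len k < len l) : interY s t k < interY s t l := by
  have h2 : (gridY k : ℝ) < gridY l := by exact_mod_cast gridY_lt h
  have := convex_comb_pos (sub_pos.2 h) (sub_pos.2 h2) h0 h1
  simp only [interY]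
  linarith

/-- Equal heights at any time `t` force equal lengths, because rows increase strictly with the
length; then the arches are disjoint over the midpoints, and strict monotonicity of the columns
keeps them disjoint. Rows start at `1`, so a shift by `s < 1` leaves the heights positive; tangles
use `s = 0` and glued links `s = 2 / 3`. -/
theorem isSeparated_inter (I : SDPartition n) {s t : ℝ} (hs : s < 1) (h0 : 0 ≤ t) (h1 : t ≤ 1) :
    IsSeparated (partner (I := I)) (interX t) (interY s t) where
  inj := by
    intro k l h
    rcases lt_trichotomy (mid k) (mid l) with h2 | h2 | h2
    · exact absurd h (interX_lt h0 h1 h2).ne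
    · exact mid_injective h2
    · exact absurd h (interX_lt h0 h1 h2).ne'
  pos := by
    intro k
    have h2 : (1 : ℝ) ≤ gridY k := by exact_mod_cast (gridY_mem k).1
    exact convex_comb_pos (len_pos k) (by linarith) h0 h1
  height := by
    intro k
    simp only [interY, len_partner, gridY_partner]
  sep := by
    intro k l h2 h3 h
    have h4 : len k = len l := by
      rcases lt_trichotomy (len k) (len l) with h4 | h4 | h4
      · exact absurd h (interY_lt h0 h1 h4).ne
      · exact h4
      · exact absurd h (interY_lt h0 h1 h4).ne'
    have hlt := fun a b : I.Strand => interX_lt (t := t) (k := a) (l := b) h0 h1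
    rcases mid_separated k l h2 h3 h4 with h5 | h5 <;>
      simp only [lt_min_iff, max_lt_iff] at h5 ⊢
    · exact Or.inl ⟨⟨hlt _ _ h5.1.1, hlt _ _ h5.1.2⟩, hlt _ _ h5.2.1, hlt _ _ h5.2.2⟩
    · exact Or.inr ⟨⟨hlt _ _ h5.1.1, hlt _ _ h5.1.2⟩, hlt _ _ h5.2.1, hlt _ _ h5.2.2⟩

theorem continuous_interX {I : SDPartition n} (k : I.Strand) : Continuous fun t => interX t k := by
  simp only [interX]; fun_prop

theorem continuous_interY {I : SDPartition n} (s : ℝ) (k : I.Strand) :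
    Continuous fun t => interY s t k := by
  simp only [interY]; fun_prop

theorem interX_zero {I : SDPartition n} : interX (I := I) 0 = mid := by
  funext k; simp [interX]

theorem interY_zero {I : SDPartition n} (s : ℝ) : interY (I := I) s 0 = len := by
  funext k; simp [interY]

theorem interX_one {I : SDPartition n} : interX (I := I) 1 = fun k => (gridX k : ℝ) := by
  funext k; simp [interX]

theorem interY_one {I : SDPartition n} (s : ℝ) :
    interY (I := I) s 1 = fun k => (gridY k : ℝ) - s := by
  funext k; simp [interY]

/-- The arch diagram over the midpoints of the intervals. -/
noncomputable def midTangle (I : SDPartition n) : Set Edge :=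
  polySet (ArchEdge (up (I := I)) partner) (archPos mid len)

theorem midTangle_isotopic_gridTangle (I : SDPartition n) :
    KindIsotopic (some (2 * n)) (midTangle I) (gridTangle I.halfGrid) := by
  have h := isotopic_arch (isPairing (I := I)) interX (interY 0) continuous_interX
    (continuous_interY 0) fun t ht => isSeparated_inter I zero_lt_one ht.1 ht.2
  rw [interX_zero, interY_zero, card_strand] at h
  have h' : interY (I := I) 0 1 = fun k => (gridY k : ℝ) := by
    funext k; simp [interY]
  rw [gridTangle_halfGrid]
  rw [interX_one, h'] at h
  exact h

/-! ## Iterated local replacements -/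

/-- The blocks are replaced one after the other. When it is the turn of block `i`, the others may be
in either state, so `hstep` has to cope with every mixture `F`. -/
theorem triangleIsotopic_of_local {κ : Option ℕ} {ι : Type*} [Finite ι] (R : Set Edge)
    (P P' : ι → Set Edge)
    (hstep : ∀ (i : ι) (F : ι → Set Edge), (∀ j, F j = P j ∨ F j = P' j) →
      IsKind κ (P i ∪ (R ∪ ⋃ j ∈ {j | j ≠ i}, F j)) →
      TriangleIsotopic κ (P i ∪ (R ∪ ⋃ j ∈ {j | j ≠ i}, F j))
        (P' i ∪ (R ∪ ⋃ j ∈ {j | j ≠ i}, F j)))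
    (hK : IsKind κ (R ∪ ⋃ i, P i)) :
    TriangleIsotopic κ (R ∪ ⋃ i, P i) (R ∪ ⋃ i, P' i) := by
  classical
  have := Fintype.ofFinite ι
  have split : ∀ (i : ι) (F : ι → Set Edge),
      R ∪ ⋃ j, F j = F i ∪ (R ∪ ⋃ j ∈ {j | j ≠ i}, F j) := by
    intro i F
    ext e
    simp only [Set.mem_union, Set.mem_iUnion, Set.mem_ofPred_eq, exists_prop]
    constructor
    · rintro (h | ⟨j, h⟩)
      · exact Or.inr (Or.inl h)
      · by_cases hj : j = i
        · exact Or.inl (hj ▸ h)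
        · exact Or.inr (Or.inr ⟨j, hj, h⟩)
    · rintro (h | h | ⟨j, -, h⟩)
      · exact Or.inr ⟨i, h⟩
      · exact Or.inl h
      · exact Or.inr ⟨j, h⟩
  have key : ∀ S : Finset ι, TriangleIsotopic κ (R ∪ ⋃ i, P i) (R ∪ ⋃ i, S.piecewise P' P i) := by
    intro S
    induction S using Finset.induction_on with
    | empty =>
      simp only [Finset.piecewise_empty]
      exact TriangleIsotopic.refl hK
    | insert i S hi ih =>
      refine ih.trans ?_
      set F := S.piecewise P' P with hF
      have h1 : F i = P i := Finset.piecewise_eq_of_notMem _ _ _ hi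
      have h2 : (insert i S).piecewise P' P i = P' i :=
        Finset.piecewise_eq_of_mem _ _ _ (Finset.mem_insert_self _ _)
      have h3 : ∀ j ≠ i, (insert i S).piecewise P' P j = F j := fun j hj => by
        simp [hF, Finset.piecewise, hj]
      have h4 : (⋃ j ∈ {j | j ≠ i}, (insert i S).piecewise P' P j) =
          ⋃ j ∈ {j | j ≠ i}, F j := Set.iUnion₂_congr h3
      have h5 := ih.2.1
      rw [split i, h1] at h5 ⊢
      rw [split i ((insert i S).piecewise P' P), h2, h4]
      refine hstep i F (fun j => ?_) h5
      by_cases hj : j ∈ S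
      · exact Or.inr (Finset.piecewise_eq_of_mem _ _ _ hj)
      · exact Or.inl (Finset.piecewise_eq_of_notMem _ _ _ hj)
  simpa using key Finset.univ

theorem merge_strand {κ : Option ℕ} {Q : Set Edge} {s : Bool} {p q r : Pt}
    (hK : IsKind κ (insert (strand s p q) (insert (strand s q r) Q)))
    (h1 : strand s p q ∉ Q) (h2 : strand s q r ∉ Q) (hpr : p ≠ r) (hq : q ∈ openSegment ℝ p r)
    (hκ : κ ≠ none → 0 < q.2.1 ∧ (0 < p.2.1 ∨ 0 < r.2.1)) :
    TriangleIsotopic κ (insert (strand s p q) (insert (strand s q r) Q))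
      (insert (strand s p r) Q) := by
  cases s with
  | true =>
    simp only [strand, if_true] at *
    exact (TriangleClear.merge hpr hK.polygonal h1 h2 hq).isotopic' hκ hK
  | false =>
    simp only [strand, Bool.false_eq_true, if_false] at *
    rw [Set.insert_comm] at hK ⊢
    rw [openSegment_symm] at hq
    exact (TriangleClear.merge hpr.symm hK.polygonal h2 h1 hq).isotopic'
      (fun h => ⟨(hκ h).1, (hκ h).2.symm⟩) hK

theorem subdivide_strand {κ : Option ℕ} {Q : Set Edge} {s : Bool} {p q r : Pt}
    (hK : IsKind κ (insert (strand s p r) Q))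
    (h1 : strand s p r ∉ Q) (hq : q ∈ openSegment ℝ p r)
    (hκ : κ ≠ none → 0 < q.2.1 ∧ (0 < p.2.1 ∨ 0 < r.2.1)) :
    TriangleIsotopic κ (insert (strand s p r) Q)
      (insert (strand s p q) (insert (strand s q r) Q)) := by
  cases s with
  | true =>
    simp only [strand, if_true] at *
    exact (TriangleClear.subdivide hK.polygonal h1 hq).isotopic hκ hK
  | false =>
    simp only [strand, Bool.false_eq_true, if_false] at *
    rw [Set.insert_comm]
    rw [openSegment_symm] at hq
    exact (TriangleClear.subdivide hK.polygonal h1 hq).isotopic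
      (fun h => ⟨(hκ h).1, (hκ h).2.symm⟩) hK

/-! ## The grid link of a compatible pair -/

section

variable {I J : SDPartition n}

/-- The order preserving bijection between the strands of two partitions. -/
noncomputable def strandEquiv (I J : SDPartition n) : I.Strand ≃ J.Strand :=
  (colEquiv I).trans (colEquiv J).symm

theorem colEquiv_strandEquiv (k : I.Strand) : colEquiv J (strandEquiv I J k) = colEquiv I k := by
  simp [strandEquiv]

theorem gridX_strandEquiv (k : I.Strand) : gridX (strandEquiv I J k) = gridX k := by
  rw [gridX_eq, gridX_eq, colEquiv_strandEquiv]

theorem up_strandEquiv (h : I.nSign = J.nSign) (k : I.Strand) :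
    up (strandEquiv I J k) = up k := by
  rw [up_eq (colEquiv_strandEquiv k), up_eq (k := k) rfl, h]

theorem strandEquiv_lt {k l : I.Strand} (h : mid k < mid l) :
    mid (strandEquiv I J k) < mid (strandEquiv I J l) := by
  rw [← colEquiv_lt_iff] at h ⊢
  rwa [colEquiv_strandEquiv, colEquiv_strandEquiv]

/-- The directed edges of two glued tangles of partitions. -/
def PairEdge (I J : SDPartition n) :=
  GlueEdge (up (I := I)) partner (up (I := J)) partner (strandEquiv I J)

/-- The link obtained by gluing the arch diagrams over the midpoints. -/
noncomputable def midLink (I J : SDPartition n) : Set Edge :=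
  polySet (PairEdge I J) (gluePos 1 0 (archPos mid len) (archPos mid len))

/-- The grid link with subdivided columns. -/
noncomputable def subdividedGridLink (I J : SDPartition n) : Set Edge :=
  polySet (PairEdge I J) (gluePos (n + 2 / 3) (n + 1 / 3)
    (archPos (fun k => (gridX k : ℝ)) (fun k => (gridY k : ℝ) - 2 / 3))
    (archPos (fun k => (gridX k : ℝ)) (fun k => (gridY k : ℝ) - 2 / 3)))

theorem midLink_isotopic_subdividedGridLink (h : I.nSign = J.nSign) :
    KindIsotopic none (midLink I J) (subdividedGridLink I J) := by
  classical
  have := Fintype.ofFinite (ArchVertex I.Strand)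
  have := Fintype.ofFinite (ArchVertex J.Strand)
  have hs : (2 / 3 : ℝ) < 1 := by norm_num
  have key := isotopic_of_family
    (isPattern_glue (isPairing (I := I)) (isPairing (I := J)) (up_strandEquiv h))
    -- At `t = 1` a row `r` of the upper part, shifted by `2 / 3`, arrives at `n + r`, and a row of
    -- the mirrored part at `n + 1 - r`.
    (fun t => gluePos ((1 - t) * 1 + t * (n + 2 / 3)) (t * (n + 1 / 3))
      (archPos (interX t) (interY (2 / 3) t)) (archPos (interX t) (interY (2 / 3) t)))
    (continuous_gluePos (by fun_prop) (by fun_prop)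
      (continuous_archPos continuous_interX (continuous_interY _))
      (continuous_archPos continuous_interX (continuous_interY _)))
    (by
      rintro t ⟨h0, h1⟩
      refine isEmbedded_glue isPairing isPairing (isSeparated_inter I hs h0 h1)
        (isSeparated_inter J hs h0 h1) (fun k l hkl => ?_) ?_
      · have hmid : mid k < mid l := by
          rcases lt_trichotomy (mid k) (mid l) with h2 | h2 | h2
          · exact h2
          · rw [Strand.mid_injective h2] at hkl
            exact absurd hkl (lt_irrefl _)
          · exact absurd hkl (interX_lt h0 h1 h2).not_gt
        exact interX_lt h0 h1 (strandEquiv_lt hmid)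
      -- The gap between the two halves shrinks from `1` to `1 / 3`.
      · have := convex_comb_pos (a := 1) (b := 1 / 3) one_pos (by norm_num) h0 h1
        linarith)
  simp only [interX_zero, interY_zero] at key
  convert key using 2
  · simp [midLink, PairEdge]
  · simp [subdividedGridLink, PairEdge, interX_one, interY_one]

theorem mem_stack {i r : ℕ} {μ : Mark} : (i, r, μ) ∈ stack n I.halfGrid J.halfGrid ↔
    (∃ k : I.Strand, i = gridX k ∧ r = n + gridY k ∧ μ = mark k) ∨
    (∃ k : J.Strand, i = gridX k ∧ r = n + 1 - gridY k ∧ μ = (mark k).swap) := by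
  constructor
  · rintro (⟨i, j, μ, h, he⟩ | ⟨i, j, μ, h, he⟩) <;> obtain ⟨k, hk⟩ := mem_halfGrid.1 h <;>
      simp only [Prod.mk.injEq] at hk he <;> obtain ⟨rfl, rfl, rfl⟩ := hk
    · exact Or.inl ⟨k, he⟩
    · exact Or.inr ⟨k, he⟩
  · rintro (⟨k, rfl, rfl, rfl⟩ | ⟨k, rfl, rfl, rfl⟩)
    · exact Or.inl ⟨_, _, _, mem_halfGrid.2 ⟨k, rfl⟩, rfl⟩
    · exact Or.inr ⟨_, _, _, mem_halfGrid.2 ⟨k, rfl⟩, rfl⟩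

theorem swap_eq_X {μ : Mark} : μ.swap = Mark.X ↔ μ = Mark.O := by
  cases μ <;> simp [Mark.swap]

theorem swap_eq_O {μ : Mark} : μ.swap = Mark.O ↔ μ = Mark.X := by
  cases μ <;> simp [Mark.swap]


theorem raise_low (k : I.Strand) : raiseMap (n + 2 / 3) (archPos (fun k => (gridX k : ℝ))
    (fun k => (gridY k : ℝ) - 2 / 3) (low k)) = gridPt (gridX k) (n + gridY k) 0 := by
  simp [archPos, gridPt]; ring

theorem raise_top (k : I.Strand) : raiseMap (n + 2 / 3) (archPos (fun k => (gridX k : ℝ))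
    (fun k => (gridY k : ℝ) - 2 / 3) (top k)) = gridPt (gridX k) (n + gridY k) 1 := by
  simp [archPos, gridPt]; ring

theorem raise_bot (k : I.Strand) : raiseMap (n + 2 / 3) (archPos (fun k => (gridX k : ℝ))
    (fun k => (gridY k : ℝ) - 2 / 3) (bot k)) = ((gridX k : ℝ), (n : ℝ) + 2 / 3, 0) := by
  simp [archPos]

theorem cast_lower (k : I.Strand) : ((n + 1 - gridY k : ℕ) : ℝ) = n + 1 - gridY k := by
  rw [Nat.cast_sub (by have := (gridY_mem k).2; omega)]
  push_cast
  rfl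

theorem mirror_low (k : I.Strand) : mirrorMap (n + 1 / 3) (archPos (fun k => (gridX k : ℝ))
    (fun k => (gridY k : ℝ) - 2 / 3) (low k)) = gridPt (gridX k) (n + 1 - gridY k) 0 := by
  simp [archPos, gridPt, cast_lower]; ring

theorem mirror_top (k : I.Strand) : mirrorMap (n + 1 / 3) (archPos (fun k => (gridX k : ℝ))
    (fun k => (gridY k : ℝ) - 2 / 3) (top k)) = gridPt (gridX k) (n + 1 - gridY k) 1 := by
  simp [archPos, gridPt, cast_lower]; ring

theorem mirror_bot (k : I.Strand) : mirrorMap (n + 1 / 3) (archPos (fun k => (gridX k : ℝ))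
    (fun k => (gridY k : ℝ) - 2 / 3) (bot k)) = ((gridX k : ℝ), (n : ℝ) + 1 / 3, 0) := by
  simp [archPos]

/-- The upper end of a column of the grid link. -/
noncomputable def columnTop (k : I.Strand) : Pt := gridPt (gridX k) (n + gridY k) 0

/-- The lower end of a column of the grid link. -/
noncomputable def columnBot (J : SDPartition n) (k : I.Strand) : Pt :=
  gridPt (gridX k) (n + 1 - gridY (strandEquiv I J k)) 0

/-- A subdivided column of the grid link. -/
noncomputable def subdividedColumn (J : SDPartition n) (k : I.Strand) : Set Edge :=
  {strand (up k) (columnBot J k) ((gridX k : ℝ), (n : ℝ) + 1 / 3, 0),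
    strand (up k) ((gridX k : ℝ), (n : ℝ) + 1 / 3, 0) ((gridX k : ℝ), (n : ℝ) + 2 / 3, 0),
    strand (up k) ((gridX k : ℝ), (n : ℝ) + 2 / 3, 0) (columnTop k)}

/-- Reversing the edges of the mirrored half amounts to exchanging `X` and `O`, so the rows are
those of the stacked grid. The feet of the two arch diagrams cut every column into three edges. -/
theorem subdividedGridLink_eq (h : I.nSign = J.nSign) : subdividedGridLink I J =
    rowEdges (stack n I.halfGrid J.halfGrid) ∪ ⋃ k : I.Strand, subdividedColumn J k := by
  have hβ := up_strandEquiv h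
  have hX := gridX_strandEquiv (I := I) (J := J)
  ext e
  simp only [Set.mem_union, Set.mem_iUnion]
  constructor
  · rintro ⟨_, _, (⟨_, _, h⟩ | ⟨_, _, h⟩ | ⟨k, hk⟩ | ⟨k, hk⟩), rfl⟩
    · rcases h with ⟨k, hk⟩ | ⟨k, hk⟩ | ⟨k, hk⟩ | ⟨k, hk⟩ | ⟨k, hk⟩
      · refine Or.inr ⟨k, Or.inr (Or.inr ?_)⟩
        simp only [gluePos, raise_low, raise_bot, strand, hk, if_true]
        rfl
      · refine Or.inl (Or.inr (Or.inl ⟨gridX k, n + gridY k, mem_stack.2 (Or.inl ⟨k, rfl, rfl, ?_⟩),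
          ?_⟩))
        · rw [mark_eq_X.2 hk]
        · simp only [gluePos, raise_low, raise_top]
      · have hk' : up (partner k) = false := by rw [isPairing.up_partner, hk]; rfl
        refine Or.inl (Or.inl ⟨gridX k, gridX (partner k), n + gridY k,
          mem_stack.2 (Or.inl ⟨k, rfl, rfl, ?_⟩), mem_stack.2 (Or.inl ⟨partner k, rfl, ?_, ?_⟩), ?_⟩)
        · rw [mark_eq_X.2 hk]
        · rw [gridY_partner]
        · rw [mark_eq_O.2 hk']
        · simp only [gluePos, raise_top, gridY_partner]
      · refine Or.inl (Or.inr (Or.inr ⟨gridX k, n + gridY k, mem_stack.2 (Or.inl ⟨k, rfl, rfl, ?_⟩),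
          ?_⟩))
        · rw [mark_eq_O.2 hk]
        · simp only [gluePos, raise_low, raise_top]
      · refine Or.inr ⟨k, Or.inr (Or.inr ?_)⟩
        simp only [gluePos, raise_low, raise_bot, strand, hk, Bool.false_eq_true, if_false]
        rfl
    · rcases h with ⟨k, hk⟩ | ⟨k, hk⟩ | ⟨k, hk⟩ | ⟨k, hk⟩ | ⟨k, hk⟩
      · obtain ⟨k, rfl⟩ := (strandEquiv I J).surjective k
        rw [hβ] at hk
        refine Or.inr ⟨k, Or.inl ?_⟩
        simp only [gluePos, mirror_low, mirror_bot, strand, hk, if_true, columnBot, hX]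
      · refine Or.inl (Or.inr (Or.inr ⟨gridX k, n + 1 - gridY k,
          mem_stack.2 (Or.inr ⟨k, rfl, rfl, ?_⟩), ?_⟩))
        · rw [mark_eq_X.2 hk]; rfl
        · simp only [gluePos, mirror_low, mirror_top]
      · have hk' : up (partner k) = false := by rw [isPairing.up_partner, hk]; rfl
        refine Or.inl (Or.inl ⟨gridX (partner k), gridX k, n + 1 - gridY k,
          mem_stack.2 (Or.inr ⟨partner k, rfl, ?_, ?_⟩), mem_stack.2 (Or.inr ⟨k, rfl, rfl, ?_⟩), ?_⟩)
        · rw [gridY_partner]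
        · rw [mark_eq_O.2 hk']; rfl
        · rw [mark_eq_X.2 hk]; rfl
        · simp only [gluePos, mirror_top, gridY_partner]
      · refine Or.inl (Or.inr (Or.inl ⟨gridX k, n + 1 - gridY k,
          mem_stack.2 (Or.inr ⟨k, rfl, rfl, ?_⟩), ?_⟩))
        · rw [mark_eq_O.2 hk]; rfl
        · simp only [gluePos, mirror_low, mirror_top]
      · obtain ⟨k, rfl⟩ := (strandEquiv I J).surjective k
        rw [hβ] at hk
        refine Or.inr ⟨k, Or.inl ?_⟩
        simp only [gluePos, mirror_low, mirror_bot, strand, hk, Bool.false_eq_true, if_false,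
          columnBot, hX]
    · refine Or.inr ⟨k, Or.inr (Or.inl ?_)⟩
      simp only [gluePos, mirror_bot, raise_bot, strand, hk, if_true, hX]
    · refine Or.inr ⟨k, Or.inr (Or.inl ?_)⟩
      simp only [gluePos, mirror_bot, raise_bot, strand, hk, Bool.false_eq_true, if_false, hX]
  · rintro ((⟨i, i', r, h1, h2, rfl⟩ | ⟨i, r, h1, rfl⟩ | ⟨i, r, h1, rfl⟩) | ⟨k, hk | hk | hk⟩)
    · rcases mem_stack.1 h1 with ⟨k, rfl, rfl, hk⟩ | ⟨k, rfl, rfl, hk⟩ <;>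
      rcases mem_stack.1 h2 with ⟨l, rfl, hr, hl⟩ | ⟨l, rfl, hr, hl⟩
      · have hk := mark_eq_X.1 hk.symm
        have hl := mark_eq_O.1 hl.symm
        rcases eq_or_eq_partner_of_gridY (Nat.add_left_cancel hr) with rfl | rfl
        · simp [hk] at hl
        · refine ⟨_, _, .upper _ _ (.row k hk), ?_⟩
          simp only [gluePos, raise_top, gridY_partner]
      · have := gridY_mem k
        have := gridY_mem l
        omega
      · have := gridY_mem k
        have := gridY_mem l
        omega
      · have hk := mark_eq_O.1 (swap_eq_X.1 hk.symm)
        have hl := mark_eq_X.1 (swap_eq_O.1 hl.symm)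
        have h3 : gridY l = gridY k := by
          have := gridY_mem k
          have := gridY_mem l
          omega
        rcases eq_or_eq_partner_of_gridY h3 with rfl | rfl
        · simp [hk] at hl
        · refine ⟨_, _, .lower _ _ (.row l hl), ?_⟩
          simp only [gluePos, mirror_top, gridY_partner]
    · rcases mem_stack.1 h1 with ⟨k, rfl, rfl, hk⟩ | ⟨k, rfl, rfl, hk⟩
      · refine ⟨_, _, .upper _ _ (.zup k (mark_eq_X.1 hk.symm)), ?_⟩
        simp only [gluePos, raise_low, raise_top]
      · refine ⟨_, _, .lower _ _ (.zdown k (mark_eq_O.1 (swap_eq_X.1 hk.symm))), ?_⟩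
        simp only [gluePos, mirror_low, mirror_top]
    · rcases mem_stack.1 h1 with ⟨k, rfl, rfl, hk⟩ | ⟨k, rfl, rfl, hk⟩
      · refine ⟨_, _, .upper _ _ (.zdown k (mark_eq_O.1 hk.symm)), ?_⟩
        simp only [gluePos, raise_low, raise_top]
      · refine ⟨_, _, .lower _ _ (.zup k (mark_eq_X.1 (swap_eq_O.1 hk.symm))), ?_⟩
        simp only [gluePos, mirror_low, mirror_top]
    · rcases hu : up k with _ | _
      · refine ⟨_, _, .lower _ _ (.vdown (strandEquiv I J k) (by rw [hβ, hu])), ?_⟩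
        rw [hk]
        simp only [gluePos, mirror_low, mirror_bot, strand, hu, Bool.false_eq_true, if_false,
          columnBot, hX]
      · refine ⟨_, _, .lower _ _ (.vup (strandEquiv I J k) (by rw [hβ, hu])), ?_⟩
        rw [hk]
        simp only [gluePos, mirror_low, mirror_bot, strand, hu, if_true, columnBot, hX]
    · rcases hu : up k with _ | _
      · refine ⟨_, _, .cdown k hu, ?_⟩
        rw [hk]
        simp only [gluePos, mirror_bot, raise_bot, strand, hu, Bool.false_eq_true, if_false, hX]
      · refine ⟨_, _, .cup k hu, ?_⟩
        rw [hk]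
        simp only [gluePos, mirror_bot, raise_bot, strand, hu, if_true, hX]
    · obtain rfl : e = _ := hk
      rcases hu : up k with _ | _
      · refine ⟨_, _, .upper _ _ (.vdown k hu), ?_⟩
        simp only [gluePos, raise_low, raise_bot, strand, Bool.false_eq_true, if_false,
          columnTop]
      · refine ⟨_, _, .upper _ _ (.vup k hu), ?_⟩
        simp only [gluePos, raise_low, raise_bot, strand, if_true, columnTop]

/-- In each column both half diagrams have the same mark, and the lower one is swapped. So the `O`
and the `X` of the column lie in different halves, and the column is traversed in the direction of
its strand. -/
theorem gridLink_stack_eq (h : I.nSign = J.nSign) : gridLink (stack n I.halfGrid J.halfGrid) =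
    rowEdges (stack n I.halfGrid J.halfGrid) ∪
      ⋃ k : I.Strand, {strand (up k) (columnBot J k) (columnTop k)} := by
  have hβ := up_strandEquiv h
  have hX := gridX_strandEquiv (I := I) (J := J)
  ext e
  simp only [gridLink, Set.mem_union, Set.mem_iUnion, Set.mem_singleton_iff]
  refine or_congr Iff.rfl ⟨?_, ?_⟩
  · rintro ⟨i, r, r', h1, h2, rfl⟩
    rcases mem_stack.1 h1 with ⟨k, rfl, rfl, hk⟩ | ⟨k, rfl, rfl, hk⟩ <;>
    rcases mem_stack.1 h2 with ⟨l, hi, rfl, hl⟩ | ⟨l, hi, rfl, hl⟩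
    · have hk := mark_eq_O.1 hk.symm
      have hl := mark_eq_X.1 hl.symm
      obtain rfl := gridX_injective hi
      simp [hk] at hl
    · have hk := mark_eq_O.1 hk.symm
      rw [← hX k] at hi
      obtain rfl := gridX_injective hi
      refine ⟨k, ?_⟩
      simp only [strand, hk, Bool.false_eq_true, if_false, columnTop, columnBot]
    · have hl := mark_eq_X.1 hl.symm
      rw [← hX l] at hi
      obtain rfl := gridX_injective hi
      refine ⟨l, ?_⟩
      simp only [strand, hl, if_true, columnTop, columnBot, hX]
    · have hk := mark_eq_X.1 (swap_eq_O.1 hk.symm)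
      have hl := mark_eq_O.1 (swap_eq_X.1 hl.symm)
      obtain rfl := gridX_injective hi
      simp [hk] at hl
  · rintro ⟨k, rfl⟩
    rcases hu : up k with _ | _
    · refine ⟨gridX k, n + gridY k, n + 1 - gridY (strandEquiv I J k),
        mem_stack.2 (Or.inl ⟨k, rfl, rfl, (mark_eq_O.2 hu).symm⟩),
        mem_stack.2 (Or.inr ⟨strandEquiv I J k, (hX k).symm, rfl, ?_⟩), ?_⟩
      · rw [mark_eq_O.2 ((hβ k).trans hu)]; rfl
      · simp only [strand, Bool.false_eq_true, if_false, columnTop, columnBot]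
    · refine ⟨gridX k, n + 1 - gridY (strandEquiv I J k), n + gridY k,
        mem_stack.2 (Or.inr ⟨strandEquiv I J k, (hX k).symm, rfl, ?_⟩),
        mem_stack.2 (Or.inl ⟨k, rfl, rfl, (mark_eq_X.2 hu).symm⟩), ?_⟩
      · rw [mark_eq_X.2 ((hβ k).trans hu)]; rfl
      · simp only [strand, if_true, columnTop, columnBot]

theorem strand_fst_or (s : Bool) (p q : Pt) :
    (strand s p q = (p, q)) ∨ (strand s p q = (q, p)) := by
  cases s <;> simp [strand]

/-- The three collinear edges of a column are merged in two steps, at `n + 1 / 3` and then at `n + 2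
/ 3`. -/
theorem subdividedGridLink_isotopic_gridLink (h : I.nSign = J.nSign)
    (hK : IsKind none (subdividedGridLink I J)) :
    TriangleIsotopic none (subdividedGridLink I J)
      (gridLink (stack n I.halfGrid J.halfGrid)) := by
  rw [subdividedGridLink_eq h] at hK ⊢
  rw [gridLink_stack_eq h]
  refine triangleIsotopic_of_local _ _ _ (fun k F hF hK => ?_) hK
  set Q := rowEdges (stack n I.halfGrid J.halfGrid) ∪ ⋃ j ∈ {j | j ≠ k}, F j with hQ
  -- the other edges have an end at height `1` or lie over another column
  have hQ' : ∀ e ∈ Q, e.1.2.2 = 0 → e.2.2.2 = 0 → e.1.1 ≠ gridX k := by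
    rintro e (he | he) h1 h2 h3
    · rcases he with ⟨i, i', r, -, -, rfl⟩ | ⟨i, r, -, rfl⟩ | ⟨i, r, -, rfl⟩ <;>
        simp [gridPt] at h1 h2
    · obtain ⟨j, hj, he⟩ := Set.mem_iUnion₂.1 he
      have h4 : e.1.1 = gridX j := by
        rcases hF j with h5 | h5 <;> rw [h5] at he
        · rcases he with rfl | rfl | he
          · rcases strand_fst_or (up j) (columnBot J j) ((gridX j : ℝ), (n : ℝ) + 1 / 3, 0)
              with h6 | h6 <;> rw [h6] ; rfl
          · rcases strand_fst_or (up j) ((gridX j : ℝ), (n : ℝ) + 1 / 3, 0)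
              ((gridX j : ℝ), (n : ℝ) + 2 / 3, 0) with h6 | h6 <;> rw [h6]
          · obtain rfl : e = _ := he
            rcases strand_fst_or (up j) ((gridX j : ℝ), (n : ℝ) + 2 / 3, 0) (columnTop j)
              with h6 | h6 <;> rw [h6] ; rfl
        · obtain rfl : e = _ := he
          rcases strand_fst_or (up j) (columnBot J j) (columnTop j) with h6 | h6 <;> rw [h6] <;> rfl
      rw [h4] at h3
      exact hj (gridX_injective (by exact_mod_cast h3))
  have hnot : ∀ p q : Pt, p.1 = gridX k → q.1 = gridX k → p.2.2 = 0 → q.2.2 = 0 →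
      strand (up k) p q ∉ Q := by
    intro p q h1 h2 h3 h4 hmem
    rcases strand_fst_or (up k) p q with h5 | h5 <;> rw [h5] at hmem
    · exact hQ' _ hmem h3 h4 h1
    · exact hQ' _ hmem h4 h3 h2
  set a : Pt := ((gridX k : ℝ), (n : ℝ) + 1 / 3, 0) with ha
  set b : Pt := ((gridX k : ℝ), (n : ℝ) + 2 / 3, 0) with hb
  set L := columnBot J k with hL
  set U := columnTop k with hU
  have hLy : L.2.1 = n + 1 - gridY (strandEquiv I J k) := cast_lower _
  have hUy : U.2.1 = n + gridY k := by simp [hU, columnTop, gridPt]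
  have h1 : (1 : ℝ) ≤ gridY k := by exact_mod_cast (gridY_mem k).1
  have h1' : (1 : ℝ) ≤ gridY (strandEquiv I J k) := by exact_mod_cast (gridY_mem _).1
  have hopen : ∀ p q r : Pt, p.1 = q.1 → q.1 = r.1 → p.2.2 = 0 → q.2.2 = 0 → r.2.2 = 0 →
      p.2.1 < q.2.1 → q.2.1 < r.2.1 → q ∈ openSegment ℝ p r := by
    rintro ⟨x, y, z⟩ ⟨x', y', z'⟩ ⟨x'', y'', z''⟩ g1 g2 g3 g4 g5 g6 g7
    simp only at g1 g2 g3 g4 g5 g6 g7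
    subst g1 g2 g3 g4 g5
    have hd : 0 < y'' - y := by linarith
    refine ⟨(y'' - y') / (y'' - y), (y' - y) / (y'' - y), div_pos (by linarith) hd,
      div_pos (by linarith) hd, ?_, ?_⟩
    · field_simp; ring
    · simp only [Prod.smul_mk, Prod.mk_add_mk, smul_eq_mul, Prod.mk.injEq]
      refine ⟨?_, ?_, ?_⟩ <;> field_simp <;> ring
  have eQ : subdividedColumn J k ∪ Q =
      insert (strand (up k) L a) (insert (strand (up k) a b) (insert (strand (up k) b U) Q)) := by
    ext e
    simp only [subdividedColumn, Set.mem_union, Set.mem_insert_iff, Set.mem_singleton_iff]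
    tauto
  rw [eQ] at hK ⊢
  have hne : ∀ {p q : Pt}, p.2.1 < q.2.1 → p ≠ q := by
    rintro p q h rfl
    exact lt_irrefl _ h
  have strand_ne : ∀ {p q r s : Pt}, p.2.1 < q.2.1 → r.2.1 < s.2.1 → p.2.1 ≠ r.2.1 →
      strand (up k) p q ≠ strand (up k) r s := by
    intro p q r s g1 g2 g3 he
    cases hu : up k <;> simp only [strand, hu, Bool.false_eq_true, if_false, if_true,
      Prod.mk.injEq] at he
    · exact g3 (by rw [he.2])
    · exact g3 (by rw [he.1])
  have ya : a.2.1 = n + 1 / 3 := rfl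
  have yb : b.2.1 = n + 2 / 3 := rfl
  have i1 := merge_strand hK (by
      rintro (he | he)
      · exact strand_ne (by linarith) (by linarith) (by rw [hLy, yb]; linarith) he
      · exact hnot L a rfl rfl rfl rfl he)
    (by
      rintro (he | he)
      · exact strand_ne (by linarith) (by linarith) (by rw [ya, yb]; linarith) he
      · exact hnot a b rfl rfl rfl rfl he)
    (hne (by linarith)) (hopen L a b rfl rfl rfl rfl rfl (by linarith) (by linarith))
    (fun h => absurd rfl h)
  have i2 := merge_strand i1.2.1 (hnot L b rfl rfl rfl rfl) (hnot b U rfl rfl rfl rfl)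
    (hne (by linarith)) (hopen L b U rfl rfl rfl rfl rfl (by linarith) (by linarith))
    (fun h => absurd rfl h)
  exact i1.trans i2

/-- The grid link of a pair of partitions is isotopic to the link of glued arch diagrams. -/
theorem gridLink_isotopic_midLink (h : I.nSign = J.nSign) :
    KindIsotopic none (gridLink (stack n I.halfGrid J.halfGrid)) (midLink I J) := by
  have h1 := midLink_isotopic_subdividedGridLink h
  exact (h1.trans (subdividedGridLink_isotopic_gridLink h h1.2.1).kindIsotopic).symm

theorem halfGridCompatible (h : I.nSign = J.nSign) :
    HalfGridCompatible n I.halfGrid J.halfGrid := by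
  refine ⟨Strand.isHalfGridDiagram I, Strand.isHalfGridDiagram J, ?_⟩
  have key : ∀ I J : SDPartition n, I.nSign = J.nSign → ∀ i μ,
      (∃ j, (i, j, μ) ∈ I.halfGrid) → ∃ j, (i, j, μ) ∈ J.halfGrid := by
    rintro I J h i μ ⟨j, hj⟩
    obtain ⟨k, hk⟩ := mem_halfGrid.1 hj
    simp only [Prod.mk.injEq] at hk
    obtain ⟨rfl, rfl, rfl⟩ := hk
    refine ⟨gridY (strandEquiv I J k), mem_halfGrid.2 ⟨strandEquiv I J k, ?_⟩⟩
    rw [gridX_strandEquiv, mark, mark, up_strandEquiv h]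
  exact fun i _ _ μ => ⟨key I J h i μ, key J I h.symm i μ⟩

end

/-- Two compatible half grid diagrams give a grid diagram. -/
theorem HalfGridCompatible.isGridDiagram {H₁ H₂ : MarkedGrid} (h : HalfGridCompatible n H₁ H₂) :
    IsGridDiagram (2 * n) (stack n H₁ H₂) := by
  obtain ⟨a, b, c⟩ := h
  have swap_swap : ∀ μ : Mark, μ.swap.swap = μ := by rintro (_ | _) <;> rfl
  have swap_ne : ∀ μ : Mark, μ ≠ μ.swap := by rintro (_ | _) h <;> cases h
  -- Rows of `H₂` start at `1`, so after the flip they are at most `n`.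
  have up : ∀ {i r μ}, n < r → ((i, r, μ) ∈ stack n H₁ H₂ ↔ (i, r - n, μ) ∈ H₁) := by
    intro i r μ hr
    constructor
    · rintro (⟨i', j, μ', h, he⟩ | ⟨i', j, μ', h, he⟩) <;> simp only [Prod.mk.injEq] at he <;>
        obtain ⟨rfl, rfl, rfl⟩ := he
      · rwa [Nat.add_sub_cancel_left]
      · have := (b.range _ _ _ h).2
        omega
    · intro h
      refine Or.inl ⟨i, r - n, μ, h, ?_⟩
      rw [Nat.add_sub_cancel' hr.le]
  have lo : ∀ {i r μ}, r ≤ n → ((i, r, μ) ∈ stack n H₁ H₂ ↔ (i, n + 1 - r, μ.swap) ∈ H₂) := by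
    intro i r μ hr
    constructor
    · rintro (⟨i', j, μ', h, he⟩ | ⟨i', j, μ', h, he⟩) <;> simp only [Prod.mk.injEq] at he <;>
        obtain ⟨rfl, rfl, rfl⟩ := he
      · have := (a.range _ _ _ h).2
        omega
      · have := (b.range _ _ _ h).2
        rw [swap_swap]
        have h2 : n + 1 - (n + 1 - j) = j := by omega
        rwa [h2]
    · intro h
      have := (b.range _ _ _ h).2
      refine Or.inr ⟨i, n + 1 - r, μ.swap, h, ?_⟩
      have h2 : n + 1 - (n + 1 - r) = r := by omega
      rw [swap_swap, h2]
  have range : ∀ i j μ, (i, j, μ) ∈ stack n H₁ H₂ →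
      (1 ≤ i ∧ i ≤ 2 * n) ∧ (1 ≤ j ∧ j ≤ 2 * n) := by
    rintro i j μ (⟨i', j', μ', h, he⟩ | ⟨i', j', μ', h, he⟩) <;> simp only [Prod.mk.injEq] at he <;>
      obtain ⟨rfl, rfl, rfl⟩ := he
    · have := a.range _ _ _ h
      omega
    · have := b.range _ _ _ h
      omega
  refine ⟨range, ?_, ?_, ?_⟩
  · rintro i j ⟨h1, h2⟩
    have hi := (range _ _ _ h1).1
    rcases lt_or_ge n j with hj | hj
    · rw [up hj] at h1 h2
      have := (a.col i hi.1 hi.2).unique (y₁ := (j - n, Mark.X)) (y₂ := (j - n, Mark.O)) h1 h2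
      simp at this
    · rw [lo hj] at h1 h2
      have := (b.col i hi.1 hi.2).unique (y₁ := (n + 1 - j, Mark.X.swap))
        (y₂ := (n + 1 - j, Mark.O.swap)) h1 h2
      simp [Mark.swap] at this
  · intro j h1 h2 μ
    rcases lt_or_ge n j with hj | hj
    · simp only [up hj]
      exact a.row (j - n) (by omega) (by omega) μ
    · simp only [lo hj]
      exact b.row (n + 1 - j) (by omega) (by omega) μ.swap
  · intro i h1 h2 μ
    -- Column `i` has the mark `ν` in both half diagrams, hence `ν` above and `ν.swap` below in the
    -- stack.
    obtain ⟨⟨r, ν⟩, hr, hu⟩ := a.col i h1 h2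
    obtain ⟨r', hr'⟩ := (c i h1 h2 ν).1 ⟨r, hr⟩
    have hu' : ∀ q : ℕ × Mark, (i, q.1, q.2) ∈ H₂ → q = (r', ν) := fun q hq =>
      (b.col i h1 h2).unique hq hr'
    by_cases hμ : μ = ν
    · subst hμ
      refine ⟨n + r, Or.inl ⟨i, r, μ, hr, rfl⟩, ?_⟩
      rintro j (⟨i', j', μ', h, he⟩ | ⟨i', j', μ', h, he⟩) <;> simp only [Prod.mk.injEq] at he <;>
        obtain ⟨rfl, rfl, rfl⟩ := he
      · have h5 : j' = r := congrArg Prod.fst (hu (j', μ) h)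
        rw [h5]
      · exact absurd (congrArg Prod.snd (hu' (j', μ') h)) (swap_ne μ')
    · have hμ' : μ = ν.swap := by
        rcases μ with _ | _ <;> rcases ν with _ | _ <;> first | rfl | exact absurd rfl hμ
      subst hμ'
      refine ⟨n + 1 - r', Or.inr ⟨i, r', ν, hr', rfl⟩, ?_⟩
      rintro j (⟨i', j', μ', h, he⟩ | ⟨i', j', μ', h, he⟩) <;> simp only [Prod.mk.injEq] at he <;>
        obtain ⟨rfl, rfl, hν⟩ := he
      · exact absurd ((congrArg Prod.snd (hu (j', μ') h)).symm.trans hν.symm) (swap_ne ν)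
      · have h5 : j' = r' := congrArg Prod.fst (hu' (j', μ') h)
        rw [h5]

end ThompsonLink

namespace ThompsonLink

open ArchVertex SDPartition SDInterval SDPartition.Strand

variable {n : ℕ}

/-! ## Straightening the arch diagram to Jones' tangle -/

theorem segment_strand (s : Bool) (p q : Pt) :
    segment ℝ (strand s p q).1 (strand s p q).2 = segment ℝ p q := by
  cases s
  · simp only [strand, Bool.false_eq_true, if_false]
    exact segment_symm ℝ q p
  · simp only [strand, if_true]

theorem support_insert_strand (s : Bool) (p q : Pt) (Q : Set Edge) :
    support (insert (strand s p q) Q) = segment ℝ p q ∪ support Q := by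
  rw [support_insert, segment_strand]

/-- Two consecutive edges of a strand can be replaced by a single edge across a clear triangle. -/
theorem collapse_strand {κ : Option ℕ} {Q : Set Edge} {s : Bool} {p q r : Pt}
    (hK : IsKind κ (insert (strand s p q) (insert (strand s q r) Q))) (h : TriangleClear Q p r q)
    (hκ : κ ≠ none → 0 < q.2.1 ∧ (0 < p.2.1 ∨ 0 < r.2.1)) :
    TriangleIsotopic κ (insert (strand s p q) (insert (strand s q r) Q))
      (insert (strand s p r) Q) := by
  cases s with
  | true =>
    simp only [strand, if_true] at *
    exact h.isotopic' hκ hK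
  | false =>
    simp only [strand, Bool.false_eq_true, if_false] at *
    rw [Set.insert_comm] at hK ⊢
    exact h.symm.isotopic' (fun h => ⟨(hκ h).1, (hκ h).2.symm⟩) hK

theorem segment_column {a b p : Pt} {x : ℝ} (ha : a.1 = x) (hb : b.1 = x) (ha' : a.2.2 = 0)
    (hb' : b.2.2 = 0) (hp : p ∈ segment ℝ a b) : p.1 = x ∧ p.2.2 = 0 := by
  obtain ⟨s, t, hs, ht, hst, rfl⟩ := hp
  simp only [Prod.snd_add, Prod.smul_snd, Prod.fst_add, Prod.smul_fst, smul_eq_mul, ha, hb, ha', hb']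
  exact ⟨by rw [← add_mul, hst, one_mul], by ring⟩

theorem segment_level {a b p : Pt} {y : ℝ} (ha : a.2.1 = y) (hb : b.2.1 = y)
    (hp : p ∈ segment ℝ a b) : p.2.1 = y := by
  obtain ⟨s, t, hs, ht, hst, rfl⟩ := hp
  simp only [Prod.snd_add, Prod.smul_snd, Prod.fst_add, Prod.smul_fst, smul_eq_mul, ha, hb]
  rw [← add_mul, hst, one_mul]

theorem segment_level_le {a b p : Pt} {y : ℝ} (ha : a.2.1 ≤ y) (hb : b.2.1 ≤ y)
    (hp : p ∈ segment ℝ a b) : p.2.1 ≤ y := by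
  obtain ⟨s, t, hs, ht, hst, rfl⟩ := hp
  simp only [Prod.snd_add, Prod.smul_snd, Prod.fst_add, Prod.smul_fst, smul_eq_mul]
  calc s * a.2.1 + t * b.2.1 ≤ s * y + t * y := by gcongr
    _ = y := by rw [← add_mul, hst, one_mul]

/-! ### Distinguished points of the strand of an interval -/

namespace SDInterval

/-- The lower end of the strand of an interval. -/
noncomputable def foot (A : SDInterval) : Pt := (A.mid, 0, 0)

/-- The upper end at height `0` of the vertical strand of an interval. -/
noncomputable def elbow (A : SDInterval) : Pt := (A.mid, A.length, 0)

/-- The upper end at height `1` of the vertical strand of an interval. -/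
noncomputable def peak (A : SDInterval) : Pt := (A.mid, A.length, 1)

/-- The upper end of the edge of the tree that is labelled by an interval. -/
noncomputable def joint (A : SDInterval) : Pt := (A.parent.mid, A.length, 1)

theorem joint_conj (A : SDInterval) : A.conj.joint = A.joint := by
  rw [joint, joint, parent_conj, length_conj]

theorem length_le_half {A : SDInterval} (h : A.lvl ≠ 0) : A.length ≤ 1 / 2 := by
  have h1 : A.parent.length ≤ root.length := length_le_iff.2 (Nat.zero_le _)
  rw [parent_length h, root_length] at h1
  linarith

theorem parent_mid_eq {A : SDInterval} (h : A.lvl ≠ 0) :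
    A.parent.mid = A.mid + A.length / 2 ∨ A.parent.mid = A.mid - A.length / 2 := by
  rcases half_cases h with h1 | h1
  · left; rw [← h1.2.1, right_eq, mid_eq]; ring
  · right; rw [← h1.1, mid_eq]; ring

/-- Consequently the `joint` is the middle of the arch between the interval and its conjugate. -/
theorem mid_conj_add {A : SDInterval} (h : A.lvl ≠ 0) : A.mid + A.conj.mid = 2 * A.parent.mid := by
  rcases half_cases h with ⟨h1, h2, h3, h4, -⟩ | ⟨h1, h2, h3, h4, -⟩ <;>
  · rw [mid, mid, h1, h2, h3, h4, mid]
    ring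

theorem mid_pos (A : SDInterval) : 0 < A.mid := lt_of_le_of_lt A.left_nonneg A.left_lt_mid

end SDInterval

namespace SDPartition

variable (I : SDPartition n)

/-- The lower vertex of the edge of the tree that is labelled by an interval. -/
noncomputable def node (A : SDInterval) : Pt := (A.mid, I.height A, 0)

theorem height_nonneg (A : SDInterval) : 0 ≤ I.height A := by
  have := A.length_pos
  rw [height]
  split_ifs <;> linarith

theorem height_lt (A : SDInterval) : I.height A < A.length := by
  have := A.length_pos
  rw [height]
  split_ifs <;> linarith

variable {I}

theorem height_of_isSub {A : SDInterval} (h : I.IsSub A) : I.height A = 0 := if_pos h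

theorem height_of_not_isSub {A : SDInterval} (h : ¬ I.IsSub A) : I.height A = A.length / 2 :=
  if_neg h

theorem node_of_isSub {A : SDInterval} (h : I.IsSub A) : I.node A = A.foot := by
  rw [node, height_of_isSub h, foot]

/-- The parent splits, so its lower vertex is at half its length. Thus the edge labelled by `A` in
Jones' tangle ends exactly at the `joint`. -/
theorem height_parent {A : SDInterval} (hA : A ∈ I.intervals) (h : A.lvl ≠ 0) :
    I.height A.parent = A.length := by
  rw [height_of_not_isSub (I.parent_not_isSub hA h), parent_length h]
  ring

/-! ### The tetrahedra of the intervals and their intersections -/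

variable (I) in
/-- The points of the tetrahedron spanned by the lower vertex of an edge of the tree, the two upper ends
of the vertical strand, and the upper vertex of the edge. -/
def InFan (A : SDInterval) (p : Pt) : Prop :=
  ∃ l t z : ℝ, 0 ≤ l ∧ l ≤ z ∧ 0 ≤ t ∧ z + t ≤ 1 ∧
    p = (A.mid + l * (A.parent.mid - A.mid), A.length - (A.length - I.height A) * t, z)

/-- It is the image of the convex set `0 ≤ l ≤ z`, `0 ≤ t ≤ 1 - z` under an affine map. -/
theorem convex_inFan (A : SDInterval) : Convex ℝ {p | I.InFan A p} := by
  rintro _ ⟨l, t, z, h1, h2, h3, h4, rfl⟩ _ ⟨l', t', z', h1', h2', h3', h4', rfl⟩ u v hu hv huv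
  refine ⟨u * l + v * l', u * t + v * t', u * z + v * z', by positivity, by gcongr, by positivity,
    ?_, ?_⟩
  · calc u * z + v * z' + (u * t + v * t') = u * (z + t) + v * (z' + t') := by ring
      _ ≤ u * 1 + v * 1 := by gcongr
      _ = 1 := by linarith
  · obtain rfl : v = 1 - u := by linarith
    simp only [Prod.smul_mk, Prod.mk_add_mk, smul_eq_mul, Prod.mk.injEq]
    refine ⟨by ring, by ring, trivial⟩

theorem inFan_node (A : SDInterval) : I.InFan A (I.node A) :=
  ⟨0, 1, 0, by simp, by simp, by simp, by simp, by simp [node]⟩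

theorem inFan_elbow (A : SDInterval) : I.InFan A A.elbow :=
  ⟨0, 0, 0, by simp, by simp, by simp, by simp, by simp [elbow]⟩

theorem inFan_peak (A : SDInterval) : I.InFan A A.peak :=
  ⟨0, 0, 1, by simp, by simp, by simp, by simp, by simp [peak]⟩

theorem inFan_joint (A : SDInterval) : I.InFan A A.joint :=
  ⟨1, 0, 1, by simp, by simp, by simp, by simp, by simp [joint]⟩

namespace InFan

variable {A B : SDInterval} {p : Pt}

theorem fst_eq (h : I.InFan A p) (hz : p.2.2 = 0) : p.1 = A.mid := by
  obtain ⟨l, t, z, h1, h2, h3, h4, rfl⟩ := h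
  obtain rfl : z = 0 := hz
  obtain rfl : l = 0 := le_antisymm h2 h1
  simp

theorem left_le (hA : A.lvl ≠ 0) (h : I.InFan A p) : A.left ≤ p.1 := by
  obtain ⟨l, t, z, h1, h2, h3, h4, rfl⟩ := h
  have h5 := A.length_pos
  have h6 := A.mid_eq
  rcases parent_mid_eq hA with h7 | h7 <;> simp only [h7] <;> nlinarith

theorem le_right (hA : A.lvl ≠ 0) (h : I.InFan A p) : p.1 ≤ A.right := by
  obtain ⟨l, t, z, h1, h2, h3, h4, rfl⟩ := h
  have h5 := A.length_pos
  have h6 := A.mid_eq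
  have h8 := A.right_eq
  rcases parent_mid_eq hA with h7 | h7 <;> simp only [h7] <;> nlinarith

theorem le_length (h : I.InFan A p) : p.2.1 ≤ A.length := by
  obtain ⟨l, t, z, h1, h2, h3, h4, rfl⟩ := h
  have := mul_nonneg (sub_nonneg.2 (I.height_lt A).le) h3
  simp only
  linarith

/-- The coordinate `y` depends on `t` only and reaches its minimum at `t = 1`, which forces `z = 0`
and `l = 0`. -/
theorem eq_node (h : I.InFan A p) (hp : p.2.1 ≤ I.height A) : p = I.node A := by
  obtain ⟨l, t, z, h1, h2, h3, h4, rfl⟩ := h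
  have h5 := I.height_lt A
  have h6 : t = 1 := by
    simp only at hp
    by_contra hne
    have : t < 1 := lt_of_le_of_ne (by linarith) hne
    nlinarith
  obtain rfl : z = 0 := by linarith
  obtain rfl : l = 0 := le_antisymm h2 h1
  simp [node, h6]

/-- From the midpoint of `A`, the end of `A` that is the midpoint of the parent is reached only at
`l = 1`, which forces `z = 1` and `t = 0`; the other end is never reached. -/
theorem eq_joint (hA : A.lvl ≠ 0) (h : I.InFan A p) (hp : p.1 ≤ A.left ∨ A.right ≤ p.1) :
    p = A.joint := by
  obtain ⟨l, t, z, h1, h2, h3, h4, rfl⟩ := h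
  have h5 := A.length_pos
  have h6 := A.mid_eq
  have h8 := A.right_eq
  have h9 : l = 1 := by
    simp only at hp
    by_contra hne
    have : l < 1 := lt_of_le_of_ne (by linarith) hne
    rcases parent_mid_eq hA with h7 | h7 <;> rw [h7] at hp <;> rcases hp with hp | hp <;> nlinarith
  obtain rfl : z = 1 := by linarith
  obtain rfl : t = 0 := by linarith
  simp [joint, h9]

/-- An interval of the tree that contains a smaller one is not a subinterval. -/
theorem _root_.ThompsonLink.SDPartition.not_isSub_of_lt (hB : B ∈ I.intervals)
    (h : A.left ≤ B.left) (h' : B.right ≤ A.right) (hne : B ≠ A) : ¬ I.IsSub A := by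
  rintro ⟨i, rfl⟩
  have h1 := B.left_lt_right
  refine hne (eq_of_left_of_right ?_ ?_)
  · rcases I.breakpoint_cases i hB.1 with h2 | h2 <;> linarith
  · rcases I.breakpoint_cases i hB.2 with h2 | h2 <;> linarith

/-- An interval of the tree with a smaller one inside is not a subinterval of the partition, so its
lower vertex is at half its length, which is at least the length of `B` and hence above everything
in the tetrahedron of `B`. -/
theorem eq_node_of_lt (h : I.InFan A p) (h' : I.InFan B p) (hB : B ∈ I.intervals)
    (h1 : A.left ≤ B.left) (h2 : B.right ≤ A.right) (hne : B ≠ A) : p = I.node A := by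
  refine h.eq_node (h'.le_length.trans ?_)
  rw [height_of_not_isSub (not_isSub_of_lt hB h1 h2 hne)]
  have h3 : A.lvl < B.lvl := by
    by_contra! h3
    have h4 : A.length ≤ B.length := length_le_iff.2 h3
    have h5 := A.right_eq
    have h6 := B.right_eq
    exact hne (eq_of_left_of_right (by linarith) (by linarith))
  have h4 : B.lvl ≠ 0 := by omega
  rw [le_div_iff₀ two_pos, mul_comm, ← parent_length h4, length_le_iff]
  exact Nat.le_sub_one_of_lt h3

/-- If the intervals do not overlap, the tetrahedra are on two sides of a vertical plane and can
touch only in the `joint`. If `B` is inside `A`, it lies below the lower vertex of `A`. If `A` is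
inside `B`, a common point would be the lower vertex of `B`, at `z = 0`, and the midpoints would
agree. -/
theorem inter (hA : A ∈ I.intervals) (hB : B ∈ I.intervals) (hA' : A.lvl ≠ 0) (hB' : B.lvl ≠ 0)
    (hne : A ≠ B) (h : I.InFan A p) (h' : I.InFan B p) : p = I.node A ∨ p = A.joint := by
  have h1 := h'.left_le hB'
  have h2 := h'.le_right hB'
  have hdisj : B.right ≤ A.left ∨ A.right ≤ B.left → p = A.joint := fun h3 =>
    h.eq_joint hA' (h3.imp (fun h => h2.trans h) fun h => h.trans h1)
  rcases le_total A.lvl B.lvl with hl | hl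
  · rcases nested_or_disjoint hl with h3 | h3 | ⟨h3, h4⟩
    · exact Or.inr (hdisj (Or.inl h3))
    · exact Or.inr (hdisj (Or.inr h3))
    · exact Or.inl (h.eq_node_of_lt h' hB h3 h4 hne.symm)
  · rcases nested_or_disjoint hl with h3 | h3 | ⟨h3, h4⟩
    · exact Or.inr (hdisj (Or.inr h3))
    · exact Or.inr (hdisj (Or.inl h3))
    · have h5 := h'.eq_node_of_lt h hA h3 h4 hne
      have h6 := h.fst_eq (by rw [h5]; rfl)
      rw [h5] at h6
      exact absurd (SDInterval.mid_injective h6).symm hne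

end InFan

/-! ### Families of edges between the arch diagram and Jones' tangle -/

/-- The edges of the cap of the arch diagram. -/
def archCap : Set Edge :=
  {((1 / 2, 1, 0), (1 / 2, 1, 1)), ((1 / 2, 1, 1), (0, 1, 1)), ((0, 1, 1), (0, 1, 0)),
    ((0, 1, 0), (0, 0, 0))}

/-- The edges of the vertical strand of an interval in the arch diagram. -/
def archStrand (A : SDInterval) : Set Edge :=
  {e | e = strand A.sign A.foot A.elbow ∨ (A.lvl ≠ 0 ∧ e = strand A.sign A.elbow A.peak)}

/-- The horizontal edge of a positive interval in the arch diagram. -/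
def archRow (A : SDInterval) : Set Edge :=
  {e | (A.lvl ≠ 0 ∧ A.sign = true) ∧ e = (A.peak, A.conj.peak)}

/-- The subdivided horizontal edge of a positive interval in the arch diagram. -/
def archHalfRow (A : SDInterval) : Set Edge :=
  {e | (A.lvl ≠ 0 ∧ A.sign = true) ∧ (e = (A.peak, A.joint) ∨ e = (A.joint, A.conj.peak))}

/-- The edges of an interval after the subdivision of the horizontal edges. -/
def bentStrand (A : SDInterval) : Set Edge :=
  {e | e = strand A.sign A.foot A.elbow ∨
    (A.lvl ≠ 0 ∧ (e = strand A.sign A.elbow A.peak ∨ e = strand A.sign A.peak A.joint))}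

variable (I) in
/-- The edges of an interval in Jones' tangle. -/
def jonesStrand (A : SDInterval) : Set Edge :=
  {e | (A.lvl ≠ 0 ∧ e = strand A.sign (I.node A) A.joint) ∨
    (A.lvl = 0 ∧ e = strand A.sign (I.node A) A.elbow) ∨
    (¬ I.IsSub A ∧ e = strand A.sign A.foot (I.node A))}

theorem jonesCap_eq : I.jonesCap = {((1 / 2, 1, 0), (0, 1, 0)), ((0, 1, 0), (0, 0, 0))} ∪
    ⋃ A : I.intervals, I.jonesStrand A := by
  rw [jonesCap, Set.union_comm]
  congr 1
  ext e
  simp only [jonesTangle, Set.mem_ofPred_eq, Set.mem_iUnion, jonesStrand, Subtype.exists,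
    exists_prop, exists_or, sign_eq_edgeSign, foot, node]
  refine or_congr ?_ (or_congr ?_ Iff.rfl)
  · refine exists_congr fun A => and_congr_right fun hA => and_congr_right fun h => ?_
    rw [height_parent hA h, joint]
  · refine exists_congr fun A => and_congr_right fun hA => and_congr_right fun h => ?_
    rw [eq_root h, elbow, root_length]

theorem midTangle_eq : midTangle I = (archCap ∪ ⋃ A : I.intervals, archStrand A) ∪
    ⋃ A : I.intervals, archRow A := by
  ext e
  simp only [Set.mem_union, Set.mem_iUnion, archStrand, archRow, archCap, Set.mem_ofPred_eq,
    Set.mem_insert_iff, Set.mem_singleton_iff]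
  constructor
  · rintro ⟨_, _, ⟨k, hk⟩ | ⟨k, hk⟩ | ⟨k, hk⟩ | ⟨k, hk⟩ | ⟨k, hk⟩, rfl⟩ <;>
      revert k <;> refine Strand.cases' ?_ ?_ fun A hA => ?_ <;> intro h <;>
      simp only [Strand.up, sign_root, Bool.false_eq_true, Bool.true_eq_false] at h
    · exact Or.inl (Or.inr ⟨⟨root, I.root_mem⟩, Or.inl rfl⟩)
    · exact Or.inl (Or.inr ⟨A, Or.inl (by rw [h]; rfl)⟩)
    · left; left; left
      simp [archPos, Strand.mid, Strand.len]
    · exact Or.inl (Or.inr ⟨A, Or.inr ⟨hA, by rw [h]; rfl⟩⟩)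
    · left; left; right; left
      simp [archPos, Strand.mid, Strand.len, partner_root]
    · refine Or.inr ⟨A, ⟨hA, h⟩, ?_⟩
      rw [partner_some hA]
      rfl
    · left; left; right; right; left
      simp [archPos, Strand.mid, Strand.len]
    · exact Or.inl (Or.inr ⟨A, Or.inr ⟨hA, by rw [h]; rfl⟩⟩)
    · left; left; right; right; right
      simp [archPos, Strand.mid, Strand.len]
    · exact Or.inl (Or.inr ⟨A, Or.inl (by rw [h]; rfl)⟩)
  · have hr : Strand.up (some ⟨root, I.root_mem⟩ : I.Strand) = true := rfl
    have hn : Strand.up (none : I.Strand) = false := rfl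
    rintro (((rfl | rfl | rfl | rfl) | ⟨A, rfl | ⟨hA, rfl⟩⟩) | ⟨A, ⟨hA, hs⟩, rfl⟩)
    · exact ⟨_, _, .zup _ hr, by simp [archPos, Strand.mid, Strand.len]⟩
    · exact ⟨_, _, .row _ hr, by simp [archPos, Strand.mid, Strand.len, partner_root]⟩
    · exact ⟨_, _, .zdown _ hn, by simp [archPos, Strand.mid, Strand.len]⟩
    · exact ⟨_, _, .vdown _ hn, by simp [archPos, Strand.mid, Strand.len]⟩
    · rcases h : A.1.sign with _ | _
      · exact ⟨_, _, .vdown (some A) h, rfl⟩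
      · exact ⟨_, _, .vup (some A) h, rfl⟩
    · rcases h : A.1.sign with _ | _
      · exact ⟨_, _, .zdown (some A) h, rfl⟩
      · exact ⟨_, _, .zup (some A) h, rfl⟩
    · refine ⟨_, _, .row (some A) hs, ?_⟩
      rw [partner_some hA]
      rfl

/-- The two halves of an arch are redistributed: the first belongs to the positive interval and the
second to its conjugate, whose `joint` is the same. -/
theorem bent_eq : (archCap ∪ ⋃ A : I.intervals, archStrand A) ∪
    (⋃ A : I.intervals, archHalfRow A) = archCap ∪ ⋃ A : I.intervals, bentStrand A := by
  rw [Set.union_assoc]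
  congr 1
  ext e
  simp only [Set.mem_union, Set.mem_iUnion, archStrand, archHalfRow, bentStrand, Set.mem_ofPred_eq]
  constructor
  · rintro (⟨A, h | h⟩ | ⟨A, ⟨hA, hs⟩, rfl | rfl⟩)
    · exact ⟨A, Or.inl h⟩
    · exact ⟨A, Or.inr ⟨h.1, Or.inl h.2⟩⟩
    · exact ⟨A, Or.inr ⟨hA, Or.inr (by rw [hs]; rfl)⟩⟩
    · refine ⟨⟨A.1.conj, I.conj_mem A.2 hA⟩, Or.inr ⟨hA, Or.inr ?_⟩⟩
      rw [sign_conj hA, hs, joint_conj]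
      rfl
  · rintro ⟨A, h | ⟨hA, h | h⟩⟩
    · exact Or.inl ⟨A, Or.inl h⟩
    · exact Or.inl ⟨A, Or.inr ⟨hA, h⟩⟩
    · rcases hs : A.1.sign with _ | _
      · refine Or.inr ⟨⟨A.1.conj, I.conj_mem A.2 hA⟩, ⟨hA, by rw [sign_conj hA, hs]; rfl⟩,
          Or.inr ?_⟩
        rw [h, hs, joint_conj, conj_conj]
        rfl
      · exact Or.inr ⟨A, ⟨hA, hs⟩, Or.inl (by rw [h, hs]; rfl)⟩

end SDPartition

end ThompsonLink

namespace ThompsonLink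

open SDInterval

namespace SDPartition

variable {n : ℕ} {I : SDPartition n}

/-! ### From the arch diagram to Jones' tangle by triangle moves -/

theorem midTangle_isotopic_bent {k : ℕ} (hK : IsKind (some k) (midTangle I)) :
    TriangleIsotopic (some k) (midTangle I) (archCap ∪ ⋃ A : I.intervals, bentStrand A) := by
  rw [midTangle_eq] at hK ⊢
  rw [← bent_eq]
  refine triangleIsotopic_of_local _ _ _ (fun A F hF hK => ?_) hK
  set Q := (archCap ∪ ⋃ A : I.intervals, archStrand A) ∪ ⋃ j ∈ {j | j ≠ A}, F j with hQ
  by_cases hA : A.1.lvl ≠ 0 ∧ A.1.sign = true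
  · have e1 : archRow A ∪ Q = insert (strand true A.1.peak A.1.conj.peak) Q := by
      ext e
      simp [archRow, hA, strand]
    have e2 : archHalfRow A ∪ Q =
        insert (strand true A.1.peak A.1.joint) (insert (strand true A.1.joint A.1.conj.peak) Q) := by
      ext e
      simp [archHalfRow, hA, strand, or_assoc]
    rw [e1] at hK ⊢
    rw [e2]
    have hlen := A.1.length_pos
    have hhalf := length_le_half hA.1
    refine subdivide_strand hK ?_ ?_ fun _ => ⟨hlen, Or.inl hlen⟩
    · rintro ((h | h) | h)
      · simp only [archCap, Set.mem_insert_iff, Set.mem_singleton_iff, strand, if_true, peak,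
          Prod.mk.injEq] at h
        rcases h with h | h | h | h <;> linarith [h.1.2.1]
      · obtain ⟨B, h | ⟨-, h⟩⟩ := Set.mem_iUnion.1 h <;> cases hs : B.1.sign <;>
          simp [strand, hs, foot, elbow, peak] at h
      · obtain ⟨B, hB, h⟩ := Set.mem_iUnion₂.1 h
        have hmid : B.1.mid ≠ A.1.mid := fun h => hB (Subtype.ext (SDInterval.mid_injective h))
        rcases hF B with h1 | h1 <;> rw [h1] at h
        · obtain ⟨-, h⟩ := h
          simp only [strand, if_true, peak, Prod.mk.injEq] at h
          exact hmid h.1.1.symm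
        · obtain ⟨hB', h | h⟩ := h <;> simp only [strand, if_true, peak, joint, Prod.mk.injEq] at h
          · exact hmid h.1.1.symm
          -- If the arch of `A` were the second half of the arch of `B`, the conjugates would agree,
          -- hence also the parents. But this half starts over the midpoint of the parent, and the
          -- arch over the midpoint of `A`.
          · have h2 := mid_conj_add hA.1
            have h3 := mid_conj_add hB'.1
            have h4 := h.1.1
            have h5 := h.2.1
            rcases parent_mid_eq hB'.1 with h6 | h6 <;> rcases parent_mid_eq hA.1 with h7 | h7 <;>
              have h8 := A.1.length_pos <;> have h9 := B.1.length_pos <;>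
              have h10 := congrArg SDInterval.parent
                (SDInterval.mid_injective (A := A.1.conj) (B := B.1.conj) h5) <;>
              rw [parent_conj, parent_conj] at h10 <;> rw [h10] at h7 <;> linarith
    · refine ⟨1 / 2, 1 / 2, by norm_num, by norm_num, by norm_num, ?_⟩
      have := mid_conj_add hA.1
      simp only [peak, joint, Prod.smul_mk, Prod.mk_add_mk, smul_eq_mul, Prod.mk.injEq, length_conj]
      refine ⟨by linarith, by ring, by ring⟩
  · have e1 : archRow A.1 = ∅ := by
      ext e
      simp only [archRow, hA, false_and, Set.ofPred_false]
    have e2 : archHalfRow A.1 = ∅ := by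
      ext e
      simp only [archHalfRow, hA, false_and, Set.ofPred_false]
    rw [e1] at hK ⊢
    rw [e2]
    exact TriangleIsotopic.refl hK

/-- The points over which the edges of an interval lie. -/
theorem mem_strand_cases {A : SDInterval} {e : Edge} {p : Pt}
    (he : e ∈ bentStrand A ∨ e ∈ I.jonesStrand A) (hp : p ∈ segment ℝ e.1 e.2) :
    (p.1 = A.mid ∧ p.2.2 = 0 ∧ p.2.1 ≤ A.length) ∨ (A.lvl ≠ 0 ∧ I.InFan A p) := by
  have hlen := A.length_pos.le
  have hh := (I.height_lt A).le
  have hcol : ∀ a b : Pt, a.1 = A.mid → b.1 = A.mid → a.2.2 = 0 → b.2.2 = 0 →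
      a.2.1 ≤ A.length → b.2.1 ≤ A.length → p ∈ segment ℝ a b →
      (p.1 = A.mid ∧ p.2.2 = 0 ∧ p.2.1 ≤ A.length) ∨ (A.lvl ≠ 0 ∧ I.InFan A p) := by
    intro a b h1 h2 h3 h4 h5 h6 h
    have := segment_column h1 h2 h3 h4 h
    exact Or.inl ⟨this.1, this.2, segment_level_le h5 h6 h⟩
  have hfan : ∀ a b : Pt, A.lvl ≠ 0 → I.InFan A a → I.InFan A b → p ∈ segment ℝ a b →
      (p.1 = A.mid ∧ p.2.2 = 0 ∧ p.2.1 ≤ A.length) ∨ (A.lvl ≠ 0 ∧ I.InFan A p) :=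
    fun a b h h1 h2 h3 => Or.inr ⟨h, (convex_inFan A).segment_subset h1 h2 h3⟩
  rcases he with (rfl | ⟨h, rfl | rfl⟩) | (⟨h, rfl⟩ | ⟨h, rfl⟩ | ⟨h, rfl⟩) <;>
    rw [segment_strand] at hp
  · exact hcol _ _ rfl rfl rfl rfl hlen le_rfl hp
  · exact hfan _ _ h (inFan_elbow A) (inFan_peak A) hp
  · exact hfan _ _ h (inFan_peak A) (inFan_joint A) hp
  · exact hfan _ _ h (inFan_node A) (inFan_joint A) hp
  · exact hcol _ _ rfl rfl rfl rfl hh le_rfl hp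
  · exact hcol _ _ rfl rfl rfl rfl hlen hh hp

theorem archCap_cases {p : Pt} (hp : p ∈ support archCap) : p.1 = 0 ∨ p.2.1 = 1 := by
  simp only [archCap, support_insert, Set.mem_union] at hp
  rcases hp with hp | hp | hp | hp
  · exact Or.inr (segment_level rfl rfl hp)
  · exact Or.inr (segment_level rfl rfl hp)
  · exact Or.inr (segment_level rfl rfl hp)
  · obtain ⟨e, rfl, hp⟩ := mem_support.1 hp
    exact Or.inl (segment_column (a := (0, 1, 0)) (b := (0, 0, 0)) (x := 0) rfl rfl rfl rfl hp).1

/-- The vertical strand of an interval can be straightened if the other edges meet the tetrahedron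
of the interval only in the ends of its edge in the tree. -/
theorem straighten {A : SDInterval} (hA : A.lvl ≠ 0) {κ : Option ℕ} {Q : Set Edge} {s : Bool}
    (hQ : ∀ p ∈ support Q, I.InFan A p → p = I.node A ∨ p = A.joint)
    (hK : IsKind κ (insert (strand s (I.node A) A.elbow) (insert (strand s A.elbow A.peak)
      (insert (strand s A.peak A.joint) Q)))) :
    TriangleIsotopic κ (insert (strand s (I.node A) A.elbow) (insert (strand s A.elbow A.peak)
      (insert (strand s A.peak A.joint) Q))) (insert (strand s (I.node A) A.joint) Q) := by
  have hlen := A.length_pos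
  have hh := I.height_lt A
  have hmid : A.parent.mid ≠ A.mid := by
    intro h
    rcases parent_mid_eq hA with h1 | h1 <;> linarith
  have hull : ∀ a b c : Pt, I.InFan A a → I.InFan A b → I.InFan A c → ∀ p,
      p ∈ convexHull ℝ {a, b, c} → I.InFan A p := by
    intro a b c ha hb hc p hp
    refine convexHull_min ?_ (convex_inFan A) hp
    rintro q (rfl | rfl | hq)
    · exact ha
    · exact hb
    · obtain rfl : q = c := hq
      exact hc
  -- The first triangle lies in the plane `x = A.mid` and cuts off the elbow.
  have t1 : TriangleClear (insert (strand s A.peak A.joint) Q) (I.node A) A.peak A.elbow := by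
    refine ⟨?_, ?_, ?_, ?_, ?_⟩
    · simp [node, peak]
    · simp [node, elbow, hh.ne]
    · simp [elbow, peak]
    · rintro ⟨x, y, z⟩ ⟨h1, h2⟩
      have h3 := segment_column (x := A.mid) rfl rfl rfl rfl h1
      have h4 := segment_level (y := A.length) rfl rfl h2
      simp only at h3 h4
      simp [elbow, h3, h4]
    · rintro p ⟨h1, h2⟩
      have hx : p.1 = A.mid := by
        obtain ⟨α, β, γ, -, -, -, h, rfl⟩ := mem_convexHull_triple.1 h1
        simp only [node, peak, elbow, Prod.fst_add, Prod.smul_fst, smul_eq_mul]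
        rw [← add_mul, ← add_mul, h, one_mul]
      rw [support_insert_strand] at h2
      rcases h2 with h2 | h2
      · right
        obtain ⟨u, v, hu, hv, huv, rfl⟩ := h2
        simp only [peak, joint, Prod.fst_add, Prod.smul_fst, smul_eq_mul] at hx
        have h3 : v * (A.parent.mid - A.mid) = 0 := by
          obtain rfl : u = 1 - v := by linarith
          linarith
        obtain rfl : v = 0 := (mul_eq_zero.1 h3).resolve_right (sub_ne_zero.2 hmid)
        obtain rfl : u = 1 := by linarith
        simp
      · rcases hQ p h2 (hull _ _ _ (inFan_node A) (inFan_peak A) (inFan_elbow A) p h1) with h3 | h3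
        · exact Or.inl h3
        · rw [h3] at hx
          exact absurd hx hmid
  -- The second triangle cuts off the peak and leaves the slanted edge.
  have t2 : TriangleClear Q (I.node A) A.joint A.peak := by
    refine ⟨?_, ?_, ?_, ?_, ?_⟩
    · simp [node, joint]
    · simp [node, peak]
    · simp [peak, joint, hmid.symm]
    · rintro p ⟨h1, h2⟩
      have h4 := segment_level (y := A.length) rfl rfl h2
      obtain ⟨u, v, hu, hv, huv, rfl⟩ := h1
      simp only [node, peak, Prod.fst_add, Prod.smul_fst, Prod.snd_add, Prod.smul_snd,
        smul_eq_mul] at h4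
      have h3 : u * (A.length - I.height A) = 0 := by
        obtain rfl : v = 1 - u := by linarith
        linarith
      obtain rfl : u = 0 := (mul_eq_zero.1 h3).resolve_right (sub_ne_zero.2 hh.ne')
      obtain rfl : v = 1 := by linarith
      simp
    · rintro p ⟨h1, h2⟩
      exact hQ p h2 (hull _ _ _ (inFan_node A) (inFan_joint A) (inFan_peak A) p h1)
  have i1 := collapse_strand hK t1 fun _ => ⟨hlen, Or.inr hlen⟩
  exact i1.trans (collapse_strand i1.2.1 t2 fun _ => ⟨hlen, Or.inr hlen⟩)

/-- The strand is cut at the vertex of the tree, and the part above it is straightened in its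
tetrahedron. The edges of another interval, straightened or not, lie in the tetrahedron of that
interval or at `z = 0` over its midpoint. The strand of `[0, 1]` is already straight and is at most
cut. -/
theorem bent_isotopic_jonesStrand {k : ℕ}
    (hK : IsKind (some k) (archCap ∪ ⋃ A : I.intervals, bentStrand A)) :
    TriangleIsotopic (some k) (archCap ∪ ⋃ A : I.intervals, bentStrand A)
      (archCap ∪ ⋃ A : I.intervals, I.jonesStrand A) := by
  refine triangleIsotopic_of_local _ _ _ (fun A F hF hK => ?_) hK
  obtain ⟨A, hAI⟩ := A
  set Q := archCap ∪ ⋃ j ∈ {j : I.intervals | j ≠ ⟨A, hAI⟩}, F j with hQ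
  have hlen := A.length_pos
  have hpos := A.mid_pos
  have hcases : ∀ p ∈ support Q, p.1 = 0 ∨ p.2.1 = 1 ∨ ∃ B ∈ I.intervals, B ≠ A ∧
      ((p.1 = B.mid ∧ p.2.2 = 0) ∨ (B.lvl ≠ 0 ∧ I.InFan B p)) := by
    intro p hp
    rw [hQ, support_union] at hp
    rcases hp with hp | hp
    · rcases archCap_cases hp with h | h
      · exact Or.inl h
      · exact Or.inr (Or.inl h)
    · obtain ⟨e, he, hp⟩ := mem_support.1 hp
      obtain ⟨B, hB, he⟩ := Set.mem_iUnion₂.1 he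
      refine Or.inr (Or.inr ⟨B, B.2, fun h => hB (Subtype.ext h), ?_⟩)
      have he' : e ∈ bentStrand B.1 ∨ e ∈ I.jonesStrand B.1 := by
        rcases hF B with h | h <;> rw [h] at he
        · exact Or.inl he
        · exact Or.inr he
      rcases mem_strand_cases he' hp with h | h
      · exact Or.inl ⟨h.1, h.2.1⟩
      · exact Or.inr h
  have hfoot : A.foot ∉ support Q := by
    intro hp
    rcases hcases _ hp with h | h | ⟨B, -, hB, h | ⟨-, h⟩⟩
    · exact hpos.ne' h
    · exact zero_ne_one h
    · exact hB (SDInterval.mid_injective h.1).symm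
    · exact hB (SDInterval.mid_injective (h.fst_eq rfl)).symm
  have hfootQ : ∀ s q, strand s A.foot q ∉ Q := fun s q h =>
    hfoot (mem_support.2 ⟨_, h, by rw [segment_strand]; exact left_mem_segment ℝ _ _⟩)
  have hopen : ¬ I.IsSub A → I.node A ∈ openSegment ℝ A.foot A.elbow := by
    intro h
    refine ⟨1 / 2, 1 / 2, by norm_num, by norm_num, by norm_num, ?_⟩
    simp only [node, foot, elbow, height_of_not_isSub h, Prod.smul_mk, Prod.mk_add_mk, smul_eq_mul,
      Prod.mk.injEq]
    refine ⟨by ring, by ring, by ring⟩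
  have hnode : ¬ I.IsSub A → 0 < (I.node A).2.1 := by
    intro h
    simp only [node, height_of_not_isSub h]
    linarith
  by_cases hA : A.lvl = 0
  · have e1 : bentStrand A ∪ Q = insert (strand A.sign A.foot A.elbow) Q := by
      ext e
      simp [bentStrand, hA]
    by_cases hs : I.IsSub A
    · have e2 : I.jonesStrand A ∪ Q = insert (strand A.sign A.foot A.elbow) Q := by
        ext e
        simp [jonesStrand, hA, hs, node_of_isSub hs]
      rw [e2, ← e1]
      exact TriangleIsotopic.refl hK
    · have e2 : I.jonesStrand A ∪ Q = insert (strand A.sign A.foot (I.node A))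
          (insert (strand A.sign (I.node A) A.elbow) Q) := by
        ext e
        simp only [jonesStrand, Set.mem_union, Set.mem_insert_iff, Set.mem_ofPred_eq, hA, hs]
        tauto
      change TriangleIsotopic _ (bentStrand A ∪ Q) (I.jonesStrand A ∪ Q)
      change IsKind _ (bentStrand A ∪ Q) at hK
      rw [e1] at hK ⊢
      rw [e2]
      exact subdivide_strand hK (hfootQ _ _) (hopen hs) fun _ => ⟨hnode hs, Or.inr hlen⟩
  · have hfan : ∀ p ∈ support Q, I.InFan A p → p = I.node A ∨ p = A.joint := by
      intro p hp h
      rcases hcases p hp with h1 | h1 | ⟨B, hB, hBA, h1 | ⟨hB', h1⟩⟩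
      · exact Or.inr (h.eq_joint hA (Or.inl (h1.trans_le A.left_nonneg)))
      -- The part of the cap at `y = 1` is above the tetrahedron, since an interval other than `[0,
      -- 1]` has length at most `1 / 2`.
      · have := h.le_length
        have := length_le_half hA
        linarith
      · exact absurd (SDInterval.mid_injective (h1.1.symm.trans (h.fst_eq h1.2))) hBA
      · exact InFan.inter hAI hB hA hB' hBA.symm h h1
    have e1 : bentStrand A ∪ Q = insert (strand A.sign A.foot A.elbow)
        (insert (strand A.sign A.elbow A.peak) (insert (strand A.sign A.peak A.joint) Q)) := by
      ext e
      simp only [bentStrand, Set.mem_union, Set.mem_insert_iff, Set.mem_ofPred_eq]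
      tauto
    change TriangleIsotopic _ (bentStrand A ∪ Q) (I.jonesStrand A ∪ Q)
    change IsKind _ (bentStrand A ∪ Q) at hK
    rw [e1] at hK ⊢
    by_cases hs : I.IsSub A
    · have e2 : I.jonesStrand A ∪ Q = insert (strand A.sign (I.node A) A.joint) Q := by
        ext e
        simp [jonesStrand, hA, hs]
      rw [e2]
      rw [← node_of_isSub hs] at hK ⊢
      exact straighten hA hfan hK
    · have e2 : I.jonesStrand A ∪ Q = insert (strand A.sign (I.node A) A.joint)
          (insert (strand A.sign A.foot (I.node A)) Q) := by
        ext e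
        simp only [jonesStrand, Set.mem_union, Set.mem_insert_iff, Set.mem_ofPred_eq]
        tauto
      rw [e2]
      have hnot : strand A.sign A.foot A.elbow ∉ insert (strand A.sign A.elbow A.peak)
          (insert (strand A.sign A.peak A.joint) Q) := by
        rintro (h | h | h)
        · cases hs : A.sign <;> simp [strand, hs, foot, elbow, peak] at h
        · cases hs : A.sign <;> simp [strand, hs, foot, elbow, peak, joint] at h
        · exact hfootQ _ _ h
      have i1 := subdivide_strand hK hnot (hopen hs) fun _ => ⟨hnode hs, Or.inr hlen⟩
      have e3 : insert (strand A.sign A.foot (I.node A)) (insert (strand A.sign (I.node A) A.elbow)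
          (insert (strand A.sign A.elbow A.peak) (insert (strand A.sign A.peak A.joint) Q))) =
          insert (strand A.sign (I.node A) A.elbow) (insert (strand A.sign A.elbow A.peak)
            (insert (strand A.sign A.peak A.joint)
              (insert (strand A.sign A.foot (I.node A)) Q))) := by
        rw [Set.insert_comm, Set.insert_comm (strand A.sign A.foot (I.node A)),
          Set.insert_comm (strand A.sign A.foot (I.node A))]
      rw [e3] at i1
      refine i1.trans (straighten hA ?_ i1.2.1)
      intro p hp h
      rw [support_insert_strand] at hp
      rcases hp with hp | hp
      -- The remaining vertical part ends at the vertex of the tree and touches the tetrahedron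
      -- nowhere else.
      · exact Or.inl (h.eq_node (segment_level_le (I.height_nonneg A) le_rfl hp))
      · exact hfan p hp h

/-- Three sides of a rectangle in the plane `y = 1` are replaced by the fourth across two triangles
in that plane, where the other edges have at most the ends of the fourth side. -/
theorem collapse_cap {k : ℕ} {Q : Set Edge}
    (hQ : ∀ p ∈ support Q, p.2.1 = 1 → p = ((1 / 2, 1, 0) : Pt) ∨ p = ((0, 1, 0) : Pt))
    (hK : IsKind (some k) (insert ((1 / 2, 1, 0), (1 / 2, 1, 1)) (insert ((1 / 2, 1, 1), (0, 1, 1))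
      (insert ((0, 1, 1), (0, 1, 0)) Q)))) :
    TriangleIsotopic (some k) (insert ((1 / 2, 1, 0), (1 / 2, 1, 1))
      (insert ((1 / 2, 1, 1), (0, 1, 1)) (insert ((0, 1, 1), (0, 1, 0)) Q)))
      (insert ((1 / 2, 1, 0), (0, 1, 0)) Q) := by
  have t1 : TriangleClear (insert ((0, 1, 1), (0, 1, 0)) Q) ((1 / 2, 1, 0) : Pt) (0, 1, 1)
      (1 / 2, 1, 1) := by
    refine ⟨by simp, by simp, by simp, ?_, ?_⟩
    · rintro p ⟨⟨u, v, hu, hv, huv, rfl⟩, ⟨u', v', hu', hv', huv', h⟩⟩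
      simp only [Prod.smul_mk, Prod.mk_add_mk, smul_eq_mul, Prod.mk.injEq] at h
      simp only [Prod.smul_mk, Prod.mk_add_mk, smul_eq_mul, Set.mem_singleton_iff, Prod.mk.injEq]
      refine ⟨?_, ?_, ?_⟩ <;> linarith [h.1, h.2.1, h.2.2]
    · rintro p ⟨hp, hp'⟩
      obtain ⟨α, β, γ, hα, hβ, hγ, h, rfl⟩ := mem_convexHull_triple.1 hp
      simp only [support_insert, Set.mem_union] at hp'
      simp only [Prod.smul_mk, Prod.mk_add_mk, smul_eq_mul, Set.mem_insert_iff,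
        Set.mem_singleton_iff, Prod.mk.injEq] at hp' ⊢
      rcases hp' with hp' | hp'
      · obtain ⟨u, v, hu, hv, huv, h1⟩ := hp'
        simp only [Prod.smul_mk, Prod.mk_add_mk, smul_eq_mul, Prod.mk.injEq] at h1
        right
        refine ⟨?_, ?_, ?_⟩ <;> linarith [h1.1]
      · rcases hQ _ hp' (by simp only; linarith) with h1 | h1 <;> simp only [Prod.mk.injEq] at h1
        · exact Or.inl h1
        · linarith [h1.1, h1.2.2]
  have t2 : TriangleClear Q ((1 / 2, 1, 0) : Pt) (0, 1, 0) (0, 1, 1) := by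
    refine ⟨by simp, by simp, by simp, ?_, ?_⟩
    · rintro p ⟨⟨u, v, hu, hv, huv, rfl⟩, ⟨u', v', hu', hv', huv', h⟩⟩
      simp only [Prod.smul_mk, Prod.mk_add_mk, smul_eq_mul, Prod.mk.injEq] at h
      simp only [Prod.smul_mk, Prod.mk_add_mk, smul_eq_mul, Set.mem_singleton_iff, Prod.mk.injEq]
      refine ⟨?_, ?_, ?_⟩ <;> linarith [h.1, h.2.1, h.2.2]
    · rintro p ⟨hp, hp'⟩
      obtain ⟨α, β, γ, hα, hβ, hγ, h, rfl⟩ := mem_convexHull_triple.1 hp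
      exact hQ _ hp' (by
        simp only [Prod.smul_mk, Prod.mk_add_mk, smul_eq_mul]
        linarith)
  have i1 := t1.isotopic' (κ := some k) (fun _ => ⟨one_pos, Or.inl one_pos⟩) hK
  exact i1.trans (t2.isotopic' (fun _ => ⟨one_pos, Or.inl one_pos⟩) i1.2.1)

/-- The arch diagram of a partition is isotopic to Jones' tangle. -/
theorem midTangle_isotopic_jonesCap {k : ℕ} (hK : IsKind (some k) (midTangle I)) :
    TriangleIsotopic (some k) (midTangle I) I.jonesCap := by
  have i1 := midTangle_isotopic_bent hK
  have i2 := i1.trans (bent_isotopic_jonesStrand i1.2.1)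
  refine i2.trans ?_
  have i3 := i2.2.1
  set Q : Set Edge := insert ((0, 1, 0), (0, 0, 0)) (⋃ A : I.intervals, I.jonesStrand A) with hQ
  have e1 : archCap ∪ ⋃ A : I.intervals, I.jonesStrand A =
      insert ((1 / 2, 1, 0), (1 / 2, 1, 1)) (insert ((1 / 2, 1, 1), (0, 1, 1))
        (insert ((0, 1, 1), (0, 1, 0)) Q)) := by
    simp only [archCap, hQ, Set.insert_union, Set.singleton_union]
  have e2 : I.jonesCap = insert ((1 / 2, 1, 0), (0, 1, 0)) Q := by
    simp only [jonesCap_eq, hQ, Set.insert_union, Set.singleton_union]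
  rw [e1] at i3 ⊢
  rw [e2]
  refine collapse_cap (fun p hp hy => ?_) i3
  rw [hQ, support_insert] at hp
  rcases hp with hp | hp
  · right
    obtain ⟨u, v, hu, hv, huv, rfl⟩ := hp
    simp only [Prod.smul_mk, Prod.mk_add_mk, smul_eq_mul, Prod.mk.injEq] at hy ⊢
    refine ⟨?_, ?_, ?_⟩ <;> linarith
  · left
    obtain ⟨e, he, hp⟩ := mem_support.1 hp
    obtain ⟨A, he⟩ := Set.mem_iUnion.1 he
    -- Only the strand of `[0, 1]` reaches the plane `y = 1`.
    have key : A.1.lvl = 0 ∨ p.2.1 ≤ 1 / 2 := by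
      by_cases h : A.1.lvl = 0
      · exact Or.inl h
      · have := length_le_half h
        rcases mem_strand_cases (Or.inr he) hp with h1 | h1
        · exact Or.inr (h1.2.2.trans this)
        · exact Or.inr (h1.2.le_length.trans this)
    rcases key with h | h
    · rcases mem_strand_cases (Or.inr he) hp with h1 | h1
      · rw [eq_root h, root_mid] at h1
        exact Prod.ext h1.1 (Prod.ext hy h1.2.1)
      · exact absurd h h1.1
    · linarith

theorem jonesCap_isotopic_gridTangle (I : SDPartition n) :
    TangleIsotopic (2 * n) I.jonesCap (gridTangle I.halfGrid) := by
  have h := midTangle_isotopic_gridTangle I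
  exact (midTangle_isotopic_jonesCap h.1).kindIsotopic.symm.trans h

end SDPartition

end ThompsonLink

namespace ThompsonLink

open SDInterval ArchVertex

namespace SDPartition

open Strand

variable {n : ℕ} {I J : SDPartition n}

/-! ## Jones' link of a compatible pair -/

/-- Columns of even index, counted from `0`, are over left ends of subintervals and those of odd
index over their midpoints; `up_eq` turns the `n`-sign into the directions of the strands. -/
theorem connection_eq (I J : SDPartition n) : connection I J =
    {e | ∃ k : I.Strand, e = strand (up k) (mid (strandEquiv I J k), 0, 0) (mid k, 1, 0)} := by
  have key : ∀ (k : I.Strand) (j : Fin (2 * n)), colEquiv I k = j →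
      mid k = columnPos I j ∧ mid (strandEquiv I J k) = columnPos J j := by
    rintro k j rfl
    refine ⟨(columnPos_colEquiv k).symm, ?_⟩
    rw [← columnPos_colEquiv, colEquiv_strandEquiv]
  have even : ∀ i : Fin n, (2 * i.1) % 2 = 0 ∧ (2 * i.1) / 2 = i.1 := fun i => by omega
  have odd : ∀ i : Fin n, ¬ (2 * i.1 + 1) % 2 = 0 ∧ (2 * i.1 + 1) / 2 = i.1 := fun i => by omega
  have heven : ∀ (k : I.Strand) (i : Fin n), colEquiv I k = ⟨2 * i.1, by omega⟩ →
      strand (up k) (mid (strandEquiv I J k), 0, 0) (mid k, 1, 0) =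
        strand (!I.nSign i) (J.pt i.castSucc, 0, 0) (I.pt i.castSucc, 1, 0) := by
    intro k i hk
    obtain ⟨h1, h2⟩ := key k _ hk
    rw [h1, h2, up_eq hk]
    simp only [columnPos, even, if_true, sub_left]
  have hodd : ∀ (k : I.Strand) (i : Fin n), colEquiv I k = ⟨2 * i.1 + 1, by omega⟩ →
      strand (up k) (mid (strandEquiv I J k), 0, 0) (mid k, 1, 0) =
        strand (I.nSign i) ((J.sub i).mid, 0, 0) ((I.sub i).mid, 1, 0) := by
    intro k i hk
    obtain ⟨h1, h2⟩ := key k _ hk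
    rw [h1, h2, up_eq hk]
    simp only [columnPos, odd, if_false]
  ext e
  constructor
  · rintro ⟨i, rfl | rfl⟩
    · exact ⟨(colEquiv I).symm ⟨2 * i.1, by omega⟩, (heven _ i (by simp)).symm⟩
    · exact ⟨(colEquiv I).symm ⟨2 * i.1 + 1, by omega⟩, (hodd _ i (by simp)).symm⟩
  · rintro ⟨k, rfl⟩
    obtain ⟨j, hj⟩ : ∃ j, colEquiv I k = j := ⟨_, rfl⟩
    by_cases h : j.1 % 2 = 0
    · refine ⟨⟨j.1 / 2, by omega⟩, Or.inl (heven k _ (hj.trans (Fin.ext ?_)))⟩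
      simp only
      omega
    · refine ⟨⟨j.1 / 2, by omega⟩, Or.inr (hodd k _ (hj.trans (Fin.ext ?_)))⟩
      simp only
      omega

theorem midLink_eq (I J : SDPartition n) : midLink I J =
    mapEdge (raiseMap 1) false '' midTangle I ∪
      (connection I J ∪ mapEdge (mirrorMap 0) true '' midTangle J) := by
  rw [connection_eq]
  ext e
  constructor
  · rintro ⟨_, _, (⟨a, b, h⟩ | ⟨a, b, h⟩ | ⟨k, hk⟩ | ⟨k, hk⟩), rfl⟩
    · exact Or.inl ⟨_, ⟨a, b, h, rfl⟩, rfl⟩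
    · exact Or.inr (Or.inr ⟨_, ⟨a, b, h, rfl⟩, rfl⟩)
    · exact Or.inr (Or.inl ⟨k, by simp [gluePos, archPos, strand, hk]⟩)
    · exact Or.inr (Or.inl ⟨k, by simp [gluePos, archPos, strand, hk]⟩)
  · rintro (⟨_, ⟨a, b, h, rfl⟩, rfl⟩ | ⟨k, rfl⟩ | ⟨_, ⟨a, b, h, rfl⟩, rfl⟩)
    · exact ⟨_, _, .upper a b h, rfl⟩
    · rcases hk : up k with _ | _
      · exact ⟨_, _, .cdown k hk, by simp [gluePos, archPos, strand]⟩
      · exact ⟨_, _, .cup k hk, by simp [gluePos, archPos, strand]⟩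
    · exact ⟨_, _, .lower a b h, rfl⟩

theorem jonesLink_eq (I J : SDPartition n) : I.jonesLink J =
    mapEdge (raiseMap 1) false '' I.jonesCap ∪
      (connection I J ∪ mapEdge (mirrorMap 0) true '' J.jonesCap) := by
  rw [jonesLink, Set.union_assoc]
  congr 1
  · ext e
    simp [mapEdge, raise, eq_comm]
  · congr 1
    ext e
    simp [mapEdge, mirror, eq_comm]

theorem support_nonneg {k : ℕ} {K : Set Edge} (hK : IsOrientedTangle k K) {p : Pt}
    (hp : p ∈ support K) : 0 ≤ p.2.1 := by
  obtain ⟨e, he, hp⟩ := mem_support.1 hp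
  exact segment_y_nonneg (hK.nonneg e he).1 (hK.nonneg e he).2 hp

theorem support_connection {p : Pt} (hp : p ∈ support (connection I J)) :
    0 ≤ p.2.1 ∧ p.2.1 ≤ 1 := by
  obtain ⟨e, he, hp⟩ := mem_support.1 hp
  rw [connection_eq] at he
  obtain ⟨k, rfl⟩ := he
  rw [segment_strand] at hp
  obtain ⟨s, t, hs, ht, hst, rfl⟩ := hp
  simp only [Prod.snd_add, Prod.smul_snd, Prod.fst_add, Prod.smul_fst, smul_eq_mul]
  constructor <;> linarith

/-- The straightening uses no endpoint slides, so it can be done inside the link, in the upper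
half-space first and then in the mirrored lower one. The connecting lines lie in `0 ≤ y ≤ 1` between
them. -/
theorem midLink_isotopic_jonesLink (hK : IsKind none (midLink I J)) :
    TriangleIsotopic none (midLink I J) (I.jonesLink J) := by
  have hI := midTangle_isotopic_jonesCap (midTangle_isotopic_gridTangle I).1
  have hJ := midTangle_isotopic_jonesCap (midTangle_isotopic_gridTangle J).1
  rw [midLink_eq] at hK ⊢
  rw [jonesLink_eq]
  have i1 := hI.extend (raiseMap_injective 1) false (fun p hp => ?_) hK
  · refine i1.trans ?_
    have i2 := i1.2.1
    have swap : ∀ X Y Z : Set Edge, X ∪ (Y ∪ Z) = Z ∪ (Y ∪ X) := fun X Y Z => by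
      rw [Set.union_comm, Set.union_comm Y, Set.union_assoc]
    rw [swap] at i2 ⊢
    rw [swap _ _ (mapEdge (mirrorMap 0) true '' J.jonesCap)]
    refine hJ.extend (mirrorMap_injective 0) true (fun p hp => ?_) i2
    rw [support_union, support_mapEdge] at hp
    rcases hp with hp | ⟨q, hq, h⟩
    · have := (support_connection hp).1
      simp only [mirrorMap_apply] at this
      linarith
    · have := support_nonneg hI.2.1 hq
      simp only [mirrorMap_apply, raiseMap_apply, Prod.mk.injEq] at h
      linarith
  · rw [support_union, support_mapEdge] at hp
    rcases hp with hp | ⟨q, hq, h⟩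
    · have := (support_connection hp).2
      simp only [raiseMap_apply] at this
      linarith
    · have := support_nonneg hJ.1 hq
      simp only [mirrorMap_apply, raiseMap_apply, Prod.mk.injEq] at h
      linarith

theorem gridLink_isotopic_jonesLink (h : I.nSign = J.nSign) :
    LinkIsotopic (gridLink (stack n I.halfGrid J.halfGrid)) (I.jonesLink J) := by
  have h1 := gridLink_isotopic_midLink h
  exact h1.trans (midLink_isotopic_jonesLink h1.2.1).kindIsotopic

end SDPartition

end ThompsonLink

namespace ThompsonLink

open SDInterval SDPartition

/-! ## Representing pairs of elements of the Thompson group -/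

/-- `regionSign m k` is the parity of the number of ones among the lowest `m` binary digits of `k`,
and `k * 2 ^ r + a` has the digits of `k` followed by the `r` digits of `a`. The test `==` is the
product of signs. -/
theorem regionSign_add (m k r a : ℕ) (h : a < 2 ^ r) :
    regionSign (m + r) (k * 2 ^ r + a) = (regionSign m k == regionSign r a) := by
  induction r generalizing a with
  | zero =>
    obtain rfl : a = 0 := by simpa using h
    simp [regionSign]
  | succ r ih =>
    rw [pow_succ] at h
    have h1 : (k * 2 ^ (r + 1) + a) % 2 = a % 2 := by rw [pow_succ, ← mul_assoc]; omega
    have h2 : (k * 2 ^ (r + 1) + a) / 2 = k * 2 ^ r + a / 2 := by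
      rw [pow_succ, ← mul_assoc]; omega
    rw [← add_assoc, regionSign, regionSign, h1, h2, ih _ (by omega)]
    split_ifs
    · rfl
    · cases regionSign m k <;> cases regionSign r (a / 2) <;> rfl

/-- `g` maps `A` linearly onto `B`. -/
def MapsLinearly (g : unitInterval ≃ₜ unitInterval) (A B : SDInterval) : Prop :=
  ∀ x : unitInterval, A.left ≤ x → (x : ℝ) ≤ A.right →
    (g x : ℝ) = B.left + (B.right - B.left) / (A.right - A.left) * ((x : ℝ) - A.left)

variable {g : unitInterval ≃ₜ unitInterval}

namespace MapsLinearly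

variable {A B : SDInterval}

theorem apply_left (h : MapsLinearly g A B) {x : unitInterval} (hx : (x : ℝ) = A.left) :
    (g x : ℝ) = B.left := by
  rw [h x hx.ge (hx.trans_le A.left_lt_right.le), hx]
  ring

theorem apply_right (h : MapsLinearly g A B) {x : unitInterval} (hx : (x : ℝ) = A.right) :
    (g x : ℝ) = B.right := by
  have h1 := sub_pos.2 A.left_lt_right
  rw [h x (A.left_lt_right.le.trans hx.ge) hx.le, hx, div_mul_cancel₀ _ h1.ne']
  ring

/-- A linear map between standard dyadic intervals relates the signs of the regions above dyadic
numbers. -/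
theorem edgeSign_eq {C D : SDInterval} (h : MapsLinearly g C D) (hs : edgeSign C = edgeSign D)
    {x : unitInterval} (hA : (x : ℝ) = A.left) (hB : (g x : ℝ) = B.left) (h1 : C.left ≤ A.left)
    (h2 : A.left < C.right) : edgeSign A = edgeSign B := by
  have hx := h x (hA ▸ h1) (hA ▸ h2.le)
  rw [hA, hB] at hx
  have hAl : A.left = ((A.idx * 2 ^ C.lvl : ℕ) : ℝ) / 2 ^ (C.lvl + A.lvl) := by
    rw [left, pow_add]
    push_cast
    field_simp
  have hCl : C.left = ((C.idx * 2 ^ A.lvl : ℕ) : ℝ) / 2 ^ (C.lvl + A.lvl) := by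
    rw [left, pow_add]
    push_cast
    field_simp
  have hCr : C.right = (((C.idx + 1) * 2 ^ A.lvl : ℕ) : ℝ) / 2 ^ (C.lvl + A.lvl) := by
    rw [right, pow_add]
    push_cast
    field_simp
  have h1' : C.idx * 2 ^ A.lvl ≤ A.idx * 2 ^ C.lvl := by
    rw [hAl, hCl, div_le_div_iff_of_pos_right (by positivity)] at h1
    exact_mod_cast h1
  have h2' : A.idx * 2 ^ C.lvl < (C.idx + 1) * 2 ^ A.lvl := by
    rw [hAl, hCr, div_lt_div_iff_of_pos_right (by positivity)] at h2
    exact_mod_cast h2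
  -- The left end of `A` is at the relative position `a / 2 ^ A.lvl` in `C`, and linearity of `g`
  -- carries it to the same relative position in `D`.
  obtain ⟨a, ha⟩ := Nat.exists_eq_add_of_le h1'
  have ha' : a < 2 ^ A.lvl := by
    rw [add_mul] at h2'
    omega
  have hBl : B.left = ((D.idx * 2 ^ A.lvl + a : ℕ) : ℝ) / 2 ^ (D.lvl + A.lvl) := by
    rw [hx, hAl, hCl, ha, right_eq, right_eq]
    simp only [left, length, pow_add]
    push_cast
    field_simp
    ring
  have eA : edgeSign A = regionSign (C.lvl + A.lvl) (C.idx * 2 ^ A.lvl + a) :=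
    regionSign_congr (by rw [← ha]; exact hAl)
  have eB : edgeSign B = regionSign (D.lvl + A.lvl) (D.idx * 2 ^ A.lvl + a) :=
    regionSign_congr hBl
  rw [eA, eB, regionSign_add _ _ _ _ ha', regionSign_add _ _ _ _ ha']
  exact congrArg (· == _) hs

end MapsLinearly

namespace Represents

variable {n : ℕ} {I J : SDPartition n}

theorem mapsLinearly (h : Represents g I J) (i : Fin n) : MapsLinearly g (I.sub i) (J.sub i) := by
  intro x h1 h2
  rw [sub_left, sub_right, sub_left, sub_right] at *
  exact h i x ⟨h1, h2⟩

theorem apply_pt (h : Represents g I J) (i : Fin (n + 1)) {x : unitInterval}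
    (hx : (x : ℝ) = I.pt i) : (g x : ℝ) = J.pt i := by
  rcases Fin.eq_zero_or_eq_succ i with rfl | ⟨i, rfl⟩
  · have hn := I.pos_n
    have h0 : (0 : Fin (n + 1)) = (⟨0, hn⟩ : Fin n).castSucc := rfl
    rw [h0, ← sub_left] at hx ⊢
    exact (h.mapsLinearly _).apply_left hx
  · rw [← sub_right] at hx ⊢
    exact (h.mapsLinearly i).apply_right hx

theorem left_mem_unitInterval (A : SDInterval) : A.left ∈ unitInterval :=
  ⟨A.left_nonneg, A.left_lt_right.le.trans A.right_le_one⟩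

/-- All pairs that represent an element of the oriented Thompson group induce equal signs. -/
theorem nSign_eq {m : ℕ} {K L : SDPartition m} (h : Represents g I J) (hK : Represents g K L)
    (hs : K.nSign = L.nSign) : I.nSign = J.nSign := by
  funext i
  have h1 : (I.sub i).left < 1 := (I.sub i).left_lt_right.trans_le (I.sub i).right_le_one
  -- The left end of the `i`-th subinterval lies in a subinterval of `K` on which `g` is linear and
  -- whose image has the same sign.
  obtain ⟨j, hj, hj'⟩ := K.exists_sub (I.sub i).left_nonneg h1
  let x : unitInterval := ⟨(I.sub i).left, left_mem_unitInterval _⟩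
  exact (hK.mapsLinearly j).edgeSign_eq (congrFun hs j) (x := x) rfl
    ((h.mapsLinearly i).apply_left rfl) hj hj'

end Represents

theorem Compatible.nSign_eq {n : ℕ} {I J : SDPartition n} (h : Compatible I J) :
    I.nSign = J.nSign := by
  obtain ⟨g, ⟨-, m, K, L, hK, hs⟩, hg⟩ := h
  exact hg.nSign_eq hK hs

/-! ## Uniqueness of reduced pairs -/

/-- Leave out the `d` breakpoints after the `a`-th one. -/
def SDPartition.coarsen {m d : ℕ} (I : SDPartition (m + d)) (a : ℕ) (ha : a < m)
    (hA : ∃ A : SDInterval, A.left = I.pt ⟨a, by omega⟩ ∧ A.right = I.pt ⟨a + 1 + d, by omega⟩) :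
    SDPartition m where
  pt k := I.pt ⟨if k.1 ≤ a then k.1 else k.1 + d, by split_ifs <;> omega⟩
  strictMono := by
    intro k l hkl
    have hkl' : k.1 < l.1 := hkl
    refine I.strictMono (Fin.lt_def.2 ?_)
    simp only
    split_ifs <;> omega
  zero := I.zero
  one := by
    rw [← I.one]
    congr 1
    simp [Fin.ext_iff, ha]
  sd := by
    intro k
    rcases lt_trichotomy k.1 a with h | h | h
    · obtain ⟨A, h1, h2⟩ := I.sd ⟨k.1, by omega⟩
      refine ⟨A, h1.trans (congrArg I.pt (Fin.ext ?_)), h2.trans (congrArg I.pt (Fin.ext ?_))⟩ <;>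
        simp only [Fin.val_castSucc, Fin.val_succ] <;> rw [if_pos (by omega)]
    · obtain ⟨A, h1, h2⟩ := hA
      refine ⟨A, h1.trans (congrArg I.pt (Fin.ext ?_)), h2.trans (congrArg I.pt (Fin.ext ?_))⟩ <;>
        simp only [Fin.val_castSucc, Fin.val_succ] <;> split_ifs <;> omega
    · obtain ⟨A, h1, h2⟩ := I.sd ⟨k.1 + d, by omega⟩
      refine ⟨A, h1.trans (congrArg I.pt (Fin.ext ?_)), h2.trans (congrArg I.pt (Fin.ext ?_))⟩ <;>
        simp only [Fin.val_castSucc, Fin.val_succ] <;> split_ifs <;> omega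

/-- Since `g` is linear on `A`, the `d` breakpoints inside `A` and those inside `B` can be left out,
and the coarser pair still represents `g`. By reducedness no breakpoint is lost, not even the one
with index `a + 1`. -/
theorem IsReducedPair.eq_zero {m d : ℕ} {I J : SDPartition (m + d)} (hr : IsReducedPair I J)
    (h : Represents g I J) (a : ℕ) (ha : a < m) {A B : SDInterval} (hA : A.left = I.pt ⟨a, by omega⟩)
    (hA' : A.right = I.pt ⟨a + 1 + d, by omega⟩) (hB : B.left = J.pt ⟨a, by omega⟩)
    (hB' : B.right = J.pt ⟨a + 1 + d, by omega⟩) (hg : MapsLinearly g A B) : d = 0 := by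
  set I' := I.coarsen a ha ⟨A, hA, hA'⟩ with hI'
  set J' := J.coarsen a ha ⟨B, hB, hB'⟩ with hJ'
  have hsub : I'.breakpoints ⊆ I.breakpoints := by
    rintro _ ⟨k, rfl⟩
    exact ⟨_, rfl⟩
  have hsub' : J'.breakpoints ⊆ J.breakpoints := by
    rintro _ ⟨k, rfl⟩
    exact ⟨_, rfl⟩
  have key : ∀ (i j i' j' : Fin (m + d + 1)), i = i' → j = j' →
      (∀ x : unitInterval, (x : ℝ) ∈ Set.Icc (I.pt i) (I.pt j) →
        (g x : ℝ) = J.pt i + (J.pt j - J.pt i) / (I.pt j - I.pt i) * ((x : ℝ) - I.pt i)) →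
      ∀ x : unitInterval, (x : ℝ) ∈ Set.Icc (I.pt i') (I.pt j') →
        (g x : ℝ) = J.pt i' + (J.pt j' - J.pt i') / (I.pt j' - I.pt i') * ((x : ℝ) - I.pt i') := by
    rintro i j _ _ rfl rfl h
    exact h
  have hrep : Represents g I' J' := by
    intro k
    rcases lt_trichotomy k.1 a with h1 | h1 | h1
    · refine key _ _ _ _ (Fin.ext ?_) (Fin.ext ?_) (h ⟨k.1, by omega⟩) <;>
        simp only [Fin.val_castSucc, Fin.val_succ] <;> rw [if_pos (by omega)]
    · refine key ⟨a, by omega⟩ ⟨a + 1 + d, by omega⟩ _ _ (Fin.ext ?_) (Fin.ext ?_) fun x hx => ?_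
      · simp only [Fin.val_castSucc]
        split_ifs <;> omega
      · simp only [Fin.val_succ]
        split_ifs <;> omega
      · rw [← hA, ← hA'] at hx
        rw [← hA, ← hA', ← hB, ← hB']
        exact hg x hx.1 hx.2
    · refine key _ _ _ _ (Fin.ext ?_) (Fin.ext ?_) (h ⟨k.1 + d, by omega⟩) <;>
        simp only [Fin.val_castSucc, Fin.val_succ] <;> split_ifs <;> omega
  have h1 := (hr m I' J' ⟨hsub, hsub', g, h, hrep⟩).1
  have h2 : I.pt ⟨a + 1, by omega⟩ ∈ I'.breakpoints := h1 ▸ ⟨_, rfl⟩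
  obtain ⟨k, hk⟩ := h2
  have h3 := congrArg Fin.val (I.strictMono.injective hk)
  simp only at h3
  split_ifs at h3 <;> omega

/-- A standard dyadic interval that is mapped linearly onto another one and contains a subinterval of
a reduced pair is equal to this subinterval. -/
theorem IsReducedPair.eq_sub {n : ℕ} {I J : SDPartition n} (hr : IsReducedPair I J)
    (h : Represents g I J) {A B : SDInterval} (hg : MapsLinearly g A B) {i : Fin n}
    (h1 : A.left ≤ (I.sub i).left) (h2 : (I.sub i).right ≤ A.right) : A = I.sub i := by
  have h3 := (I.sub i).left_lt_right
  -- A subinterval with an end of `A` in its interior would contain `A`, hence also `sub i`, whose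
  -- ends are breakpoints. So both ends of `A` are breakpoints.
  have key : ∀ j, ¬ ((I.sub j).left < A.left ∧ A.left < (I.sub j).right) ∧
      ¬ ((I.sub j).left < A.right ∧ A.right < (I.sub j).right) := by
    intro j
    have h4 := A.left_lt_right
    have h5 := I.breakpoint_cases j (I.sub_left_mem i)
    have h6 := I.breakpoint_cases j (I.sub_right_mem i)
    rcases le_total (I.sub j).lvl A.lvl with hl | hl <;>
      rcases nested_or_disjoint hl with h7 | h7 | h7 <;> refine ⟨?_, ?_⟩ <;> rintro ⟨h8, h9⟩ <;>
      rcases h5 with h5 | h5 <;> rcases h6 with h6 | h6 <;> linarith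
  have hl : A.left ∈ I.breakpoints := by
    by_contra hx
    obtain ⟨j, hj⟩ := I.exists_sub_of_not_breakpoint A.left_nonneg
      (A.left_lt_right.trans_le A.right_le_one) hx
    exact (key j).1 hj
  have hright : A.right ∈ I.breakpoints := by
    by_contra hx
    obtain ⟨j, hj⟩ := I.exists_sub_of_not_breakpoint (A.left_nonneg.trans A.left_lt_right.le)
      (lt_of_le_of_ne A.right_le_one fun h => hx (h ▸ I.one_mem)) hx
    exact (key j).2 hj
  obtain ⟨⟨a, ha⟩, hA⟩ := hl
  obtain ⟨⟨b, hb⟩, hA'⟩ := hright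
  have hab : a < b := by
    have := A.left_lt_right
    rw [← hA, ← hA', I.strictMono.lt_iff_lt] at this
    exact this
  have hB : B.left = J.pt ⟨a, ha⟩ := by
    let x : unitInterval := ⟨A.left, Represents.left_mem_unitInterval A⟩
    rw [← h.apply_pt ⟨a, ha⟩ (x := x) hA.symm, hg.apply_left rfl]
  have hB' : B.right = J.pt ⟨b, hb⟩ := by
    let x : unitInterval := ⟨A.right, A.left_nonneg.trans A.left_lt_right.le, A.right_le_one⟩
    rw [← h.apply_pt ⟨b, hb⟩ (x := x) hA'.symm, hg.apply_right rfl]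
  obtain ⟨d, rfl⟩ : ∃ d, b = a + 1 + d := ⟨b - (a + 1), by omega⟩
  obtain ⟨m, rfl⟩ : ∃ m, n = m + d := ⟨n - d, by omega⟩
  obtain rfl := hr.eq_zero h a (by omega) hA.symm hA'.symm hB hB' hg
  have h4 : A.left = (I.sub ⟨a, by omega⟩).left := by
    rw [sub_left, ← hA]
    rfl
  have h5 : A.right = (I.sub ⟨a, by omega⟩).right := by
    rw [sub_right, ← hA']
    rfl
  have h6 := I.breakpoint_cases ⟨a, by omega⟩ (I.sub_left_mem i)
  have h7 := I.breakpoint_cases ⟨a, by omega⟩ (I.sub_right_mem i)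
  refine eq_of_left_of_right ?_ ?_
  · rcases h6 with h6 | h6 <;> linarith
  · rcases h7 with h7 | h7 <;> linarith

/-- A subinterval of `I` and the subinterval of `K` that contains its left end overlap, so they are
nested. As `g` is linear on the larger one, reducedness of the pair of the smaller one makes them
equal. -/
theorem IsReducedPair.breakpoints_subset {n m : ℕ} {I J : SDPartition n} {K L : SDPartition m}
    (hI : IsReducedPair I J) (hK : IsReducedPair K L) (h : Represents g I J)
    (h' : Represents g K L) : I.breakpoints ⊆ K.breakpoints := by
  rintro _ ⟨k, rfl⟩
  rcases Fin.eq_castSucc_or_eq_last k with ⟨i, rfl⟩ | rfl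
  · have h1 : (I.sub i).left < 1 := (I.sub i).left_lt_right.trans_le (I.sub i).right_le_one
    obtain ⟨j, hj, hj'⟩ := K.exists_sub (I.sub i).left_nonneg h1
    have h2 := (I.sub i).left_lt_right
    have h3 : I.sub i = K.sub j := by
      rcases le_total (K.sub j).lvl (I.sub i).lvl with hl | hl
      · rcases nested_or_disjoint hl with h4 | h4 | h4
        · linarith
        · linarith
        · exact (hI.eq_sub h (h'.mapsLinearly j) h4.1 h4.2).symm
      · rcases nested_or_disjoint hl with h4 | h4 | h4
        · linarith
        · linarith
        · exact hK.eq_sub h' (h.mapsLinearly i) h4.1 h4.2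
    rw [← sub_left, h3]
    exact K.sub_left_mem j
  · rw [I.one]
    exact K.one_mem

theorem SDPartition.eq_of_pt {n : ℕ} {I J : SDPartition n} (h : I.pt = J.pt) : I = J := by
  cases I
  cases J
  cases h
  rfl

/-- The reduced pair of an element of the Thompson group is unique. -/
theorem IsReducedPair.unique {n m : ℕ} {I J : SDPartition n} {K L : SDPartition m}
    (hI : IsReducedPair I J) (hK : IsReducedPair K L) (h : Represents g I J)
    (h' : Represents g K L) : (⟨n, I, J⟩ : PartitionPair) = ⟨m, K, L⟩ := by
  have hb : Set.range I.pt = Set.range K.pt :=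
    (hI.breakpoints_subset hK h h').antisymm (hK.breakpoints_subset hI h' h)
  have hcard : n + 1 = m + 1 := by
    have h1 := Nat.card_range_of_injective I.strictMono.injective
    have h2 := Nat.card_range_of_injective K.strictMono.injective
    rw [Nat.card_fin] at h1 h2
    rw [← h1, ← h2, hb]
  obtain rfl : n = m := by omega
  have hpt := (I.strictMono.range_inj K.strictMono).1 hb
  have hJL : J.pt = L.pt := by
    funext i
    have hi : I.pt i ∈ unitInterval := by
      constructor
      · rw [← I.zero]
        exact I.strictMono.monotone (Fin.zero_le _)
      · rw [← I.one]
        exact I.strictMono.monotone (Fin.le_last _)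
    let x : unitInterval := ⟨I.pt i, hi⟩
    rw [← h.apply_pt i (x := x) rfl, ← h'.apply_pt i (x := x) (congrFun hpt i)]
  rw [SDPartition.eq_of_pt hpt, SDPartition.eq_of_pt hJL]

/-- By uniqueness, the pair chosen in the definition of the link is the given one. -/
theorem thompsonLink_eq {n : ℕ} {I J : SDPartition n} (h : Represents g I J)
    (hr : IsReducedPair I J) : thompsonLink g = I.jonesLink J := by
  have hex : ∃ P : PartitionPair, Represents g P.2.1 P.2.2 ∧ IsReducedPair P.2.1 P.2.2 :=
    ⟨⟨n, I, J⟩, h, hr⟩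
  have hP := Classical.choose_spec hex
  have he : Classical.choose hex = ⟨n, I, J⟩ := hP.2.unique hr hP.1 h
  rw [thompsonLink, dif_pos hex, he]

end ThompsonLink

theorem mainTheorem2 :
    (∀ (n : ℕ) (I : SDPartition n),
      IsHalfGridDiagram n I.halfGrid ∧
        TangleIsotopic (2 * n) I.jonesCap (gridTangle I.halfGrid)) ∧
    (∀ (n : ℕ) (I J : SDPartition n), Compatible I J →
      HalfGridCompatible n I.halfGrid J.halfGrid ∧
        IsGridDiagram (2 * n) (stack n I.halfGrid J.halfGrid) ∧
        LinkIsotopic (gridLink (stack n I.halfGrid J.halfGrid)) (I.jonesLink J)) ∧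
    (∀ g ∈ orientedThompsonF, ∀ (n : ℕ) (I J : SDPartition n),
      Represents g I J → IsReducedPair I J →
        LinkIsotopic (gridLink (stack n I.halfGrid J.halfGrid)) (thompsonLink g)) := by
  refine ⟨fun n I => ⟨SDPartition.Strand.isHalfGridDiagram I,
    SDPartition.jonesCap_isotopic_gridTangle I⟩, fun n I J h => ?_, fun g hg n I J h hr => ?_⟩
  · have h' := halfGridCompatible h.nSign_eq
    exact ⟨h', h'.isGridDiagram, SDPartition.gridLink_isotopic_jonesLink h.nSign_eq⟩
  · rw [thompsonLink_eq h hr]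
    exact SDPartition.gridLink_isotopic_jonesLink (Compatible.nSign_eq ⟨g, hg, h⟩)
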